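/- Let $d\ge 1$ and let $p=(p_x)_{x\in\mathbb Z^d}$ be a probability distribution on $\mathbb Z^d$. The lonely branching random walks with jump kernel $p$ and branching rate $\gamma$ are the Markov process $\eta(t)=(\eta_x(t))_{x\in\mathbb Z^d}\in\mathbb N_0^{\mathbb Z^d}$, $t\ge 0$, where $\eta_x(t)$ is the number of particles at site $x$ at time $t$, with the following dynamics. Each particle at a site $x$ jumps to $y$ at rate $p_{y-x}$, for every $y\in\mathbb Z^d$, and a particle that is alone at its site branches at rate $\gamma$: it then splits into two particles or disappears, with probability $1/2$ each. That is, from a configuration $\eta$ the transitions are $$\eta\to\eta-\delta_x+\delta_y \ \text{ at rate } \eta_x\,p_{y-x},\qquad \eta\to\eta+\delta_x\ \text{ and }\ \eta\to\eta-\delta_x,\ \text{ each at rate } \tfrac{\gamma}{2}\mathbf 1_{\{\eta_x=1\}}.$$ For finitely many particles this is a non-explosive continuous-time Markov chain. For an infinite initial configuration the transition law at time $t$ is the limit, as $n\to\infty$ and in the sense of convergence of the probabilities of all events that prescribe the particle numbers at finitely many sites, of the laws at time $t$ of the systems started from the restrictions of the configuration to $[-n,n]^d$. The initial configuration $\eta(0)$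 may be random. **Theorem.** Suppose that the random walk on $\mathbb Z^d$ with jump kernel $p$ is irreducible and that the random walk with the symmetrised jump kernel $\widehat p_x=(p_x+p_{-x})/2$ is recurrent. Suppose further that $\gamma>0$ and $\sup_{x\in\mathbb Z^d}\mathbb E[\eta_x(0)]<\infty$. Then the lonely branching random walks die out locally in probability: $$\lim_{t\to\infty}\mathbb P(\eta_x(t)=0)=1\qquad\text{for all }x\in\mathbb Z^d .$$ -/

import Mathlib

open MeasureTheory Filter Topology
open scoped ENNReal NNReal

noncomputable section

namespace LonelyBRW

/-- The lattice `ℤ^d`. -/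
abbrev Site (d : ℕ) := Fin d → ℤ

/-- Particle configurations `η ∈ ℕ₀^(ℤ^d)`: `η x` is the number of particles at the site `x`. -/
abbrev Config (d : ℕ) := Site d → ℕ

/-- Configurations with finitely many particles. -/
abbrev FinConfig (d : ℕ) := Site d →₀ ℕ

variable {d : ℕ}

/-! ### Random walks on the lattice -/

/-- `nStep q n x` is the probability that the (discrete-time) walk with jump kernel `q`, started
at `0`, is at `x` after `n` steps. -/
def nStep (q : Site d → ℝ≥0∞) : ℕ → Site d → ℝ≥0∞
  | 0, x => if x = 0 then 1 else 0
  | n + 1, x => ∑' y, q y * nStep q n (x - y)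

/-- Irreducibility: every site is reached with positive probability (from `0`, hence, by
translation invariance, from every site). -/
def IsIrreducible (q : Site d → ℝ≥0∞) : Prop :=
  ∀ x, ∃ n, 0 < nStep q n x

/-- The symmetrised kernel `x ↦ (q x + q (-x)) / 2`. -/
def symmetrised (q : Site d → ℝ≥0∞) (x : Site d) : ℝ≥0∞ := (q x + q (-x)) / 2

/-- `hitWithin q n x` is the probability that the walk with jump kernel `q`, started at `x`, visits
`0` at one of the times `0, 1, …, n`. -/
def hitWithin (q : Site d → ℝ≥0∞) : ℕ → Site d → ℝ≥0∞
  | 0, x => if x = 0 then 1 else 0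
  | n + 1, x => if x = 0 then 1 else ∑' y, q y * hitWithin q n (x + y)

/-- Recurrence: the walk started at `0` returns to `0` (at some time `≥ 1`) with probability `1`.
The first step leads to `y` with probability `q y`. -/
def IsRecurrent (q : Site d → ℝ≥0∞) : Prop :=
  ∑' y, q y * (⨆ n, hitWithin q n y) = 1

/-! ### Systems with finitely many particles

With finitely many particles the system is a continuous-time Markov chain on the countable set
`FinConfig d` with the following transitions:
`ξ ⟶ ξ - δ_x + δ_y` at rate `ξ x * p (y - x)`, for all sites `x`, `y`;
`ξ ⟶ ξ + δ_x` and `ξ ⟶ ξ - δ_x`, each at rate `γ / 2`, for all `x` with `ξ x = 1`. -/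

/-- The total rate of all transitions from `ξ`: each particle jumps at rate `1` (jumps of length
zero count), each lonely particle branches at rate `γ`. -/
def totalRate (γ : ℝ≥0) (ξ : FinConfig d) : ℝ≥0 :=
  ∑ x ∈ ξ.support, ((ξ x : ℝ≥0) + if ξ x = 1 then γ else 0)

/-- The sum of `g ξ'` over all transitions `ξ ⟶ ξ'`, weighted by their rates. -/
def rateSum (p : PMF (Site d)) (γ : ℝ≥0) (g : FinConfig d → ℝ≥0∞) (ξ : FinConfig d) : ℝ≥0∞ :=
  ∑ x ∈ ξ.support,
    ((∑' y, (ξ x : ℝ≥0∞) * p (y - x) * g (ξ - Finsupp.single x 1 + Finsupp.single y 1)) +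
      if ξ x = 1 then
        (γ : ℝ≥0∞) / 2 * (g (ξ + Finsupp.single x 1) + g (ξ - Finsupp.single x 1))
      else 0)

/-- `transProbLT p γ A n t ξ` is the probability that the chain started at `ξ` makes fewer than
`n` transitions up to time `t` and is in `A` at time `t`: either there is no transition up to time
`t`, or the first one happens at a time `s ≤ t`. -/
def transProbLT (p : PMF (Site d)) (γ : ℝ≥0) (A : Set (FinConfig d)) :
    ℕ → ℝ → FinConfig d → ℝ≥0∞
  | 0, _, _ => 0
  | n + 1, t, ξ =>
      ENNReal.ofReal (Real.exp (-(totalRate γ ξ * t))) * A.indicator 1 ξ +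
        ∫⁻ s in Set.Icc 0 t, ENNReal.ofReal (Real.exp (-(totalRate γ ξ * s))) *
          rateSum p γ (fun ξ' => transProbLT p γ A n (t - s) ξ') ξ

/-- The transition probability `P_ξ(ξ(t) ∈ A)` of the system with finitely many particles. -/
def transProb (p : PMF (Site d)) (γ : ℝ≥0) (t : ℝ≥0) (ξ : FinConfig d)
    (A : Set (FinConfig d)) : ℝ≥0∞ :=
  ⨆ n, transProbLT p γ A n t ξ

/-! ### General systems -/

/-- The restriction of the configuration `η` to the box `[-n, n]^d`. -/
def truncate (n : ℕ) (η : Config d) : FinConfig d :=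
  Finsupp.onFinset (Finset.Icc (fun _ => -(n : ℤ)) (fun _ => (n : ℤ)))
    (fun x => if x ∈ Finset.Icc (fun _ : Fin d => -(n : ℤ)) (fun _ => (n : ℤ)) then η x else 0)
    (fun x hx => by
      by_contra h
      exact hx (if_neg h))

/-- The σ-algebra generated by `η r`, `r ≤ s`. -/
abbrev past {Ω : Type*} (η : ℝ≥0 → Ω → Config d) (s : ℝ≥0) : MeasurableSpace Ω :=
  ⨆ r : ℝ≥0, ⨆ _ : r ≤ s, MeasurableSpace.comap (η r) inferInstance

/-- `η` is a (locally finite) system of lonely branching random walks with jump kernel `p` and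
branching rate `γ`, defined on the probability space `(Ω, μ)`, with arbitrary, possibly random,
initial configuration: it is the Markov process whose transition laws are the limits of those of
the systems with finitely many particles. That is, given the past up to time `s`, the configuration
at time `s + t` has the law of the system at time `t` started from `η s`, and this law is the
limit, as `n → ∞`, of the laws of the systems started from the restriction of `η s` to `[-n, n]^d`,
in the sense that the probability of seeing prescribed particle numbers `k x` at finitely many
sites `x ∈ F` converges. -/
structure IsLonelyBRW {Ω : Type*} [MeasurableSpace Ω] (p : PMF (Site d)) (γ : ℝ≥0)
    (μ : Measure Ω) (η : ℝ≥0 → Ω → Config d) : Prop where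
  measurable : ∀ t, Measurable (η t)
  markov : ∀ (s t : ℝ≥0) (F : Finset (Site d)) (k : Config d), ∀ᵐ ω ∂μ,
    Tendsto
      (fun n : ℕ => (transProb p γ t (truncate n (η s ω)) {ξ | ∀ x ∈ F, ξ x = k x}).toReal)
      atTop
      (𝓝 ((μ[Set.indicator {ω' | ∀ x ∈ F, η (s + t) ω' x = k x} (fun _ => (1 : ℝ)) |
        past η s]) ω))

end LonelyBRW

end

/-! Quantities are treated as functions of time and of a finite initial configuration, and are
compared through the backward equation and a maximum principle (`nonpos_of_le_gen`, packaged as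
`Forced.nonpos`). No coupling or path construction is needed.

Reduction to one particle. The branching is neither additive nor monotone, but the probability that
a site is occupied is a submodular function of the initial configuration: the inequality holds at
time `0` and the generator propagates it (`mixedDiff_prob_nonneg`). Hence occupation probabilities
are subadditive (`occ_add_le`), and by translation the probability that `x` is occupied in the
infinite system is at most the supremum of the initial means times `occSum`, the expected number of
occupied sites of the system started from one particle (`IsLonelyBRW.one_le_add`). It remains to
show that `occSum` tends to `0`. It is nonincreasing (`occSum_add_le`), because the generator
annihilates the total number of particles, so otherwise it stays above some `ε > 0`.

Many lonely particles. Irreducibility and `d ≥ 1` prevent the walk from being concentrated at time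
`1`. Comparison with independent walks then shows that occupied sites hold exactly one particle with
a probability bounded below, up to an error of order mean over `K` (`exists_occ_sub_mean_le_lone`).
So if `occSum` stays above `ε`, the expected number of lonely particles is bounded below at all
times from `1` on (`le_tsum_lone`).

Lonely particles are costly. Move the particles as independent walks and select each one found at
`x` at time `t` with probability `1/2`. The probability that none is selected is a product over
particles, solves the equation without branching, and is increased by the branching of a lonely
particle at `w`, by its squared hitting probability times the remaining product. Duhamel's formula
then bounds the expected number of lonely particles, integrated against the squared kernel
(`occ_add_convolution_le`, `sum_convolution_lone_le`).

Contradiction. The two bounds give `c * overlap T ≤ 4 / γ * exp K + overlap (T + 1) / K`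
(`mul_overlap_le`). With `K = 2 / c` this bounds the expected time that two independent walks spend
together. That time is half the Green function of the symmetrised walk at `0`, hence infinite by
recurrence (`lintegral_kern_sq_eq_top`). -/

noncomputable section

namespace LonelyBRW

variable {d : ℕ}

/-! ### A maximum principle for families of functions -/

/-- If a family of functions is bounded above, starts below `0`, and the right derivative of each
positive member is at most `L` times any common nonnegative upper bound, then all members stay
below `0`. -/
theorem nonpos_of_rightDeriv_le {I : Type*} {u u' : ℝ → I → ℝ} {T C L : ℝ} (hL0 : 0 ≤ L)
    (hC : ∀ t ∈ Set.Icc 0 T, ∀ i, u t i ≤ C)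
    (hcont : ∀ i, ContinuousOn (fun t => u t i) (Set.Icc 0 T))
    (hder : ∀ i, ∀ t ∈ Set.Ico 0 T, HasDerivWithinAt (fun t => u t i) (u' t i) (Set.Ici t) t)
    (h0 : ∀ i, u 0 i ≤ 0)
    (hL : ∀ t ∈ Set.Ico 0 T, ∀ m, 0 ≤ m → (∀ j, u t j ≤ m) → ∀ i, 0 < u t i → u' t i ≤ L * m) :
    ∀ t ∈ Set.Icc 0 T, ∀ i, u t i ≤ 0 := by
  set K := max C 0 with hK
  have hK0 : 0 ≤ K := le_max_right _ _
  -- Picard iteration: a common bound at order `n`, inserted into the derivative bound and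
  -- integrated, gives order `n + 1`. The term `e * (1 + t)` below supplies the strict inequality
  -- that the comparison theorem requires.
  have key : ∀ n : ℕ, ∀ t ∈ Set.Icc 0 T, ∀ i, u t i ≤ K * ((L * t) ^ n / n.factorial) := by
    intro n
    induction n with
    | zero =>
      intro t ht i
      rw [pow_zero, Nat.factorial_zero, Nat.cast_one, div_one, mul_one]
      exact (hC t ht i).trans (le_max_left _ _)
    | succ n ih =>
      intro t ht i
      refine le_of_forall_pos_le_add fun δ hδ => ?_
      have hT : 0 ≤ T := ht.1.trans ht.2
      have hδ' : 0 < δ / (1 + t) := div_pos hδ (by linarith [ht.1])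
      set e := δ / (1 + t)
      have := image_le_of_deriv_right_lt_deriv_boundary (f := fun t => u t i)
        (f' := fun t => u' t i) (a := 0) (b := T) (hcont i) (hder i)
        (B := fun t => K * ((L * t) ^ (n + 1) / (n + 1).factorial) + e * (1 + t))
        (B' := fun t => L * (K * ((L * t) ^ n / n.factorial)) + e) ?_ ?_ ?_ ht
      · refine this.trans (le_of_eq ?_)
        have : e * (1 + t) = δ := div_mul_cancel₀ _ (by linarith [ht.1])
        simp only [this]
      · have := h0 i
        simp
        linarith
      · intro s
        have h1 : HasDerivAt (fun t : ℝ => (L * t) ^ (n + 1)) ((n + 1 : ℕ) * (L * s) ^ n * L) s := by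
          have := ((hasDerivAt_id' s).const_mul L).fun_pow (n + 1)
          simpa using this
        have h2 := ((h1.div_const ((n + 1).factorial : ℝ)).const_mul K).add
          (((hasDerivAt_id s).const_add 1).const_mul e)
        refine h2.congr_deriv ?_
        have : ((n + 1).factorial : ℝ) = (n + 1) * n.factorial := by
          push_cast [Nat.factorial_succ]; ring
        rw [this]
        have h3 : (n.factorial : ℝ) ≠ 0 := by positivity
        field_simp
        push_cast
        ring
      · intro s hs heq
        have hs0 : 0 ≤ s := hs.1
        have hb : 0 ≤ K * ((L * s) ^ n / n.factorial) := by positivity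
        have := hL s hs _ hb (fun j => ih s ⟨hs.1, hs.2.le⟩ j) i (by
          rw [heq]; positivity)
        linarith
  intro t ht i
  have hlim : Tendsto (fun n : ℕ => K * ((L * t) ^ n / n.factorial)) atTop (𝓝 (K * 0)) :=
    (FloorSemiring.tendsto_pow_div_factorial_atTop (L * t)).const_mul K
  rw [mul_zero] at hlim
  exact ge_of_tendsto' hlim fun n => key n t ht i

/-- Right derivative of a convolution `∫₀ᵗ a(r) S(t - r) dr` in `t`. -/
theorem hasDerivWithinAt_convolution {a S σ : ℝ → ℝ} (ha : Continuous a) (hσ : Continuous σ)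
    (hS : ∀ s, 0 ≤ s → S s = S 0 + ∫ τ in (0 : ℝ)..s, σ τ) {t₀ : ℝ} (ht₀ : 0 ≤ t₀) :
    HasDerivWithinAt (fun t => ∫ r in (0 : ℝ)..t, a r * S (t - r))
      (a t₀ * S 0 + ∫ r in (0 : ℝ)..t₀, a r * σ (t₀ - r)) (Set.Ici t₀) t₀ := by
  -- `S` is only controlled on nonnegative arguments. `R` agrees with it there and is differentiable
  -- on the whole line, so two-sided derivatives are available.
  set R : ℝ → ℝ := fun s => S 0 + ∫ τ in (0 : ℝ)..s, σ τ with hR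
  have hRd : ∀ s, HasDerivAt R (σ s) s := fun s =>
    (intervalIntegral.integral_hasDerivAt_right (hσ.intervalIntegrable _ _)
      hσ.aestronglyMeasurable.stronglyMeasurableAtFilter hσ.continuousAt).const_add _
  have hRc : Continuous R := continuous_iff_continuousAt.2 fun s => (hRd s).continuousAt
  have hR0 : R 0 = S 0 := by simp [hR]
  have heq : ∀ t ∈ Set.Ici t₀, (∫ r in (0 : ℝ)..t, a r * S (t - r)) =
      (∫ r in (0 : ℝ)..t₀, a r * R (t - r)) + ((∫ r in t₀..t, a r * (R (t - r) - R 0)) +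
        (∫ r in t₀..t, a r) * R 0) := by
    intro t ht
    have ht0 : 0 ≤ t := ht₀.trans ht
    have c1 : ∀ x y, IntervalIntegrable (fun r => a r * R (t - r)) volume x y := fun x y =>
      Continuous.intervalIntegrable (by fun_prop) _ _
    have c2 : IntervalIntegrable (fun r => a r * (R (t - r) - R 0)) volume t₀ t :=
      Continuous.intervalIntegrable (by fun_prop) _ _
    have c3 : IntervalIntegrable (fun r => a r * R 0) volume t₀ t :=
      Continuous.intervalIntegrable (by fun_prop) _ _
    rw [← intervalIntegral.integral_mul_const, ← intervalIntegral.integral_add c2 c3]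
    simp_rw [← mul_add, sub_add_cancel]
    rw [intervalIntegral.integral_add_adjacent_intervals (c1 _ _) (c1 _ _)]
    refine intervalIntegral.integral_congr fun r hr => ?_
    rw [Set.uIcc_of_le ht0] at hr
    rw [hS (t - r) (by linarith [hr.2])]
  have d1 : HasDerivAt (fun t => ∫ r in (0 : ℝ)..t₀, a r * R (t - r))
      (∫ r in (0 : ℝ)..t₀, a r * σ (t₀ - r)) t₀ := by
    have hcomp : IsCompact (Set.Icc (-1 : ℝ) (t₀ + 1)) := isCompact_Icc
    obtain ⟨A, hA⟩ := hcomp.exists_bound_of_continuousOn (f := a) ha.continuousOn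
    obtain ⟨B, hB⟩ := hcomp.exists_bound_of_continuousOn (f := σ) hσ.continuousOn
    refine (intervalIntegral.hasDerivAt_integral_of_dominated_loc_of_deriv_le
      (F := fun t r => a r * R (t - r)) (F' := fun t r => a r * σ (t - r))
      (bound := fun _ => A * B) (Metric.ball_mem_nhds t₀ one_pos)
      (Eventually.of_forall fun t => (Continuous.aestronglyMeasurable (by fun_prop)))
      (Continuous.intervalIntegrable (by fun_prop) _ _)
      (Continuous.aestronglyMeasurable (by fun_prop)) ?_
      intervalIntegrable_const ?_).2
    · refine Eventually.of_forall fun r hr t ht => ?_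
      rw [Set.uIoc_of_le ht₀] at hr
      rw [Metric.mem_ball, Real.dist_eq, abs_lt] at ht
      have m1 : r ∈ Set.Icc (-1 : ℝ) (t₀ + 1) := ⟨by linarith [hr.1], by linarith [hr.2]⟩
      have m2 : t - r ∈ Set.Icc (-1 : ℝ) (t₀ + 1) :=
        ⟨by linarith [hr.2, ht.1], by linarith [hr.1, ht.2]⟩
      rw [norm_mul]
      exact mul_le_mul (hA r m1) (hB _ m2) (norm_nonneg _) ((norm_nonneg _).trans (hA r m1))
    · refine Eventually.of_forall fun r _ t _ => ?_
      have := ((hRd (t - r)).comp t ((hasDerivAt_id t).sub_const r)).const_mul (a r)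
      simpa [Function.comp_def] using this
  -- Both the length of the interval and the factor `R (t - r) - R 0` are of order `|t - t₀|`, so
  -- the integral is of second order.
  have d2 : HasDerivAt (fun t => ∫ r in t₀..t, a r * (R (t - r) - R 0)) 0 t₀ := by
    have hcomp : IsCompact (Set.Icc (t₀ - 1) (t₀ + 1)) := isCompact_Icc
    have hcomp' : IsCompact (Set.Icc (-1 : ℝ) 1) := isCompact_Icc
    obtain ⟨A, hA⟩ := hcomp.exists_bound_of_continuousOn (f := a) ha.continuousOn
    obtain ⟨B, hB⟩ := hcomp'.exists_bound_of_continuousOn (f := σ) hσ.continuousOn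
    have hlip : ∀ s ∈ Set.Icc (-1 : ℝ) 1, ‖R s - R 0‖ ≤ B * ‖s - 0‖ := fun s hs =>
      (convex_Icc (-1 : ℝ) 1).norm_image_sub_le_of_norm_hasDerivWithin_le
        (fun x _ => (hRd x).hasDerivWithinAt) hB (by norm_num) hs
    have hO : (fun t => ∫ r in t₀..t, a r * (R (t - r) - R 0)) =O[𝓝 t₀]
        fun t => ‖t - t₀‖ ^ 2 := by
      refine Asymptotics.IsBigO.of_bound (A * B) ?_
      filter_upwards [Metric.ball_mem_nhds t₀ one_pos] with t ht
      rw [Metric.mem_ball, Real.dist_eq] at ht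
      have hA0 : 0 ≤ A := (norm_nonneg _).trans (hA t₀ ⟨by linarith, by linarith⟩)
      have hB0 : 0 ≤ B := (norm_nonneg _).trans (hB 0 (by norm_num))
      have hb : ∀ r ∈ Set.uIoc t₀ t, ‖a r * (R (t - r) - R 0)‖ ≤ A * (B * |t - t₀|) := by
        intro r hr
        have hr' : r ∈ Set.uIcc t₀ t := Set.uIoc_subset_uIcc hr
        have e1 : |t - r| ≤ |t - t₀| := by
          have := Set.abs_sub_right_of_mem_uIcc hr'
          simpa [abs_sub_comm] using this
        have e2 : |r - t₀| ≤ |t - t₀| := by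
          have := Set.abs_sub_left_of_mem_uIcc hr'
          simpa [abs_sub_comm] using this
        have e3 := abs_le.1 (e1.trans ht.le)
        have e4 := abs_le.1 (e2.trans ht.le)
        rw [norm_mul]
        refine mul_le_mul (hA r ⟨by linarith, by linarith⟩)
          ((hlip (t - r) ⟨by linarith, by linarith⟩).trans ?_) (norm_nonneg _) hA0
        rw [sub_zero, Real.norm_eq_abs]
        gcongr
      have := intervalIntegral.norm_integral_le_of_norm_le_const hb
      refine this.trans (le_of_eq ?_)
      simp only [norm_pow, Real.norm_eq_abs, abs_abs]
      ring
    have := (hO.hasFDerivAt (n := 2) one_lt_two).hasDerivAt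
    simpa using this
  have d3 : HasDerivAt (fun t => ∫ r in t₀..t, a r) (a t₀) t₀ :=
    intervalIntegral.integral_hasDerivAt_right (ha.intervalIntegrable _ _)
      ha.aestronglyMeasurable.stronglyMeasurableAtFilter ha.continuousAt
  have dsum := (d1.add (d2.add (d3.mul_const (R 0)))).hasDerivWithinAt (s := Set.Ici t₀)
  refine (dsum.congr heq (heq t₀ (Set.mem_Ici.2 le_rfl))).congr_deriv ?_
  rw [hR0]; ring

/-! ### The generator of the finite systems -/

/-- The configuration `ξ` after a jump of a particle from `x` to `x + v`. -/
def jump (ξ : FinConfig d) (x v : Site d) : FinConfig d :=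
  ξ - Finsupp.single x 1 + Finsupp.single (x + v) 1

/-- The number of particles of a finite configuration, as a real number. -/
def size (ξ : FinConfig d) : ℝ := (Finsupp.degree ξ : ℕ)

/-- The generator of the systems with finitely many particles. -/
def gen (p : PMF (Site d)) (γ : ℝ≥0) (g : FinConfig d → ℝ) (ξ : FinConfig d) : ℝ :=
  ∑ x ∈ ξ.support, ((ξ x : ℝ) * (∫ v, g (jump ξ x v) ∂p.toMeasure - g ξ) +
    if ξ x = 1 then
      (γ : ℝ) / 2 * (g (ξ + Finsupp.single x 1) + g (ξ - Finsupp.single x 1) - 2 * g ξ) else 0)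

/-- A function of finite configurations that is bounded in terms of the number of particles. -/
def Controlled (g : FinConfig d → ℝ) : Prop := ∃ ψ : ℕ → ℝ, ∀ ξ, |g ξ| ≤ ψ (Finsupp.degree ξ)

theorem sub_single_add_single {ξ : FinConfig d} {x : Site d} (h : ξ x ≠ 0) :
    ξ - Finsupp.single x 1 + Finsupp.single x 1 = ξ :=
  tsub_add_cancel_of_le (by rw [Finsupp.single_le_iff]; omega)

theorem degree_sub_single {ξ : FinConfig d} {x : Site d} (h : ξ x ≠ 0) :
    Finsupp.degree (ξ - Finsupp.single x 1) + 1 = Finsupp.degree ξ := by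
  conv_rhs => rw [← sub_single_add_single h, map_add, Finsupp.degree_single]

theorem degree_jump {ξ : FinConfig d} {x : Site d} (h : ξ x ≠ 0) (v : Site d) :
    Finsupp.degree (jump ξ x v) = Finsupp.degree ξ := by
  rw [jump, map_add, Finsupp.degree_single, degree_sub_single h]

theorem size_nonneg (ξ : FinConfig d) : 0 ≤ size ξ := Nat.cast_nonneg _

theorem size_add (ξ ζ : FinConfig d) : size (ξ + ζ) = size ξ + size ζ := by
  simp [size, map_add]

@[simp] theorem size_single (x : Site d) (n : ℕ) : size (Finsupp.single x n) = n := by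
  simp [size]

theorem size_sub_single {ξ : FinConfig d} {x : Site d} (h : ξ x ≠ 0) :
    size (ξ - Finsupp.single x 1) = size ξ - 1 := by
  simp [size, ← degree_sub_single h]

theorem size_jump {ξ : FinConfig d} {x : Site d} (h : ξ x ≠ 0) (v : Site d) :
    size (jump ξ x v) = size ξ := by
  rw [size, degree_jump h, size]

theorem sum_eq_size (ξ : FinConfig d) : ∑ x ∈ ξ.support, (ξ x : ℝ) = size ξ := by
  simp [size, Finsupp.degree_apply]

theorem card_support_le_size (ξ : FinConfig d) : (ξ.support.card : ℝ) ≤ size ξ := by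
  rw [← sum_eq_size, Finset.card_eq_sum_ones, Nat.cast_sum]
  refine Finset.sum_le_sum fun x hx => ?_
  have := Finsupp.mem_support_iff.1 hx
  exact_mod_cast Nat.one_le_iff_ne_zero.2 this

theorem Controlled.integrable {p : PMF (Site d)} {g : FinConfig d → ℝ} (hg : Controlled g)
    {ξ : FinConfig d} {x : Site d} (h : ξ x ≠ 0) :
    Integrable (fun v => g (jump ξ x v)) p.toMeasure := by
  obtain ⟨ψ, hψ⟩ := hg
  refine Integrable.of_bound (C := ψ (Finsupp.degree ξ))
    (measurable_of_countable _).aestronglyMeasurable (Eventually.of_forall fun v => ?_)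
  have := hψ (jump ξ x v)
  rwa [degree_jump h] at this

theorem controlled_of_bounded {g : FinConfig d → ℝ} (C : ℝ) (h : ∀ ξ, |g ξ| ≤ C) :
    Controlled g := ⟨fun _ => C, h⟩

theorem controlled_size : Controlled (size : FinConfig d → ℝ) :=
  ⟨fun n => n, fun ξ => by rw [abs_of_nonneg (size_nonneg ξ), size]⟩

theorem controlled_const (c : ℝ) : Controlled (fun _ : FinConfig d => c) :=
  controlled_of_bounded |c| fun _ => le_rfl

theorem Controlled.add {g h : FinConfig d → ℝ} (hg : Controlled g) (hh : Controlled h) :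
    Controlled (fun ξ => g ξ + h ξ) := by
  obtain ⟨ψ, hψ⟩ := hg
  obtain ⟨φ, hφ⟩ := hh
  exact ⟨fun n => ψ n + φ n, fun ξ => (abs_add_le _ _).trans (add_le_add (hψ ξ) (hφ ξ))⟩

theorem Controlled.const_mul {g : FinConfig d → ℝ} (hg : Controlled g) (c : ℝ) :
    Controlled (fun ξ => c * g ξ) := by
  obtain ⟨ψ, hψ⟩ := hg
  exact ⟨fun n => |c| * ψ n, fun ξ => by
    rw [abs_mul]; exact mul_le_mul_of_nonneg_left (hψ ξ) (abs_nonneg _)⟩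

theorem Controlled.sub {g h : FinConfig d → ℝ} (hg : Controlled g) (hh : Controlled h) :
    Controlled (fun ξ => g ξ - h ξ) := by
  simpa [sub_eq_add_neg] using hg.add (hh.const_mul (-1))

section gen
variable {p : PMF (Site d)} {γ : ℝ≥0}

theorem gen_add {g h : FinConfig d → ℝ} (hg : Controlled g) (hh : Controlled h)
    (ξ : FinConfig d) : gen p γ (fun ξ => g ξ + h ξ) ξ = gen p γ g ξ + gen p γ h ξ := by
  rw [gen, gen, gen, ← Finset.sum_add_distrib]
  refine Finset.sum_congr rfl fun x hx => ?_
  have hx' := Finsupp.mem_support_iff.1 hx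
  rw [integral_add (hg.integrable hx') (hh.integrable hx')]
  split_ifs <;> ring

theorem gen_const_mul (g : FinConfig d → ℝ) (c : ℝ) (ξ : FinConfig d) :
    gen p γ (fun ξ => c * g ξ) ξ = c * gen p γ g ξ := by
  rw [gen, gen, Finset.mul_sum]
  refine Finset.sum_congr rfl fun x _ => ?_
  rw [integral_const_mul]
  split_ifs <;> ring

theorem gen_sub {g h : FinConfig d → ℝ} (hg : Controlled g) (hh : Controlled h)
    (ξ : FinConfig d) : gen p γ (fun ξ => g ξ - h ξ) ξ = gen p γ g ξ - gen p γ h ξ := by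
  have := gen_add (p := p) (γ := γ) hg (hh.const_mul (-1)) ξ
  rw [gen_const_mul] at this
  simpa [sub_eq_add_neg] using this

theorem gen_const (c : ℝ) (ξ : FinConfig d) : gen p γ (fun _ => c) ξ = 0 := by
  rw [gen]
  refine Finset.sum_eq_zero fun x _ => ?_
  rw [integral_const]
  simp
  ring_nf
  simp

/-- Jumps conserve the number of particles and the branching is critical. -/
theorem gen_size (ξ : FinConfig d) : gen p γ size ξ = 0 := by
  rw [gen]
  refine Finset.sum_eq_zero fun x hx => ?_
  have hx' := Finsupp.mem_support_iff.1 hx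
  simp_rw [size_jump hx', size_sub_single hx', size_add, size_single, integral_const]
  simp
  ring_nf
  simp

/-- Maximum principle for the backward equation of the finite systems. -/
theorem nonpos_of_le_gen {u u' : ℝ → FinConfig d → ℝ} {T C : ℝ}
    (hC : ∀ t ∈ Set.Icc 0 T, ∀ ξ, u t ξ ≤ C)
    (hcontr : ∀ t ∈ Set.Icc 0 T, Controlled (u t))
    (hcont : ∀ ξ, ContinuousOn (fun t => u t ξ) (Set.Icc 0 T))
    (hder : ∀ ξ, ∀ t ∈ Set.Ico 0 T, HasDerivWithinAt (fun t => u t ξ) (u' t ξ) (Set.Ici t) t)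
    (h0 : ∀ ξ, u 0 ξ ≤ 0)
    (hgen : ∀ ξ, ∀ t ∈ Set.Ico 0 T, u' t ξ ≤ gen p γ (u t) ξ) :
    ∀ t ∈ Set.Icc 0 T, ∀ ξ, u t ξ ≤ 0 := by
  intro t ht ξ
  refine le_of_forall_pos_le_add fun δ hδ => ?_
  have hs : 0 < 1 + size ξ := by linarith [size_nonneg ξ]
  set e := δ / (1 + size ξ) with he
  have he0 : 0 < e := div_pos hδ hs
  have hL0 : 0 ≤ (1 + (γ : ℝ)) * (max C 0 / e) := by positivity
  -- The transition rates are unbounded. Since `gen` annihilates `1 + size`, the penalty leaves the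
  -- inequality intact and confines positive values to configurations of bounded size.
  have key := nonpos_of_rightDeriv_le (u := fun t ξ => u t ξ - e * (1 + size ξ)) (u' := u')
    (T := T) (C := C) hL0
    (fun t ht ξ => by
      have := hC t ht ξ
      have := size_nonneg ξ
      nlinarith)
    (fun ξ => (hcont ξ).sub continuousOn_const)
    (fun ξ t ht => (hder ξ t ht).sub_const _)
    (fun ξ => by
      have := h0 ξ
      have := size_nonneg ξ
      nlinarith) ?_ t ht ξ
  · have : e * (1 + size ξ) = δ := div_mul_cancel₀ _ hs.ne'
    simp only [this] at key
    linarith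
  · intro t ht m hm hle ξ hpos
    have ht' : t ∈ Set.Icc 0 T := ⟨ht.1, ht.2.le⟩
    refine (hgen ξ t ht).trans ?_
    -- Where the penalised function is positive, `e * (1 + size ξ)` is below the bound `C` of `u`.
    -- This bounds the total rate and produces the constant `L`.
    have hsize : size ξ ≤ max C 0 / e := by
      rw [le_div_iff₀ he0]
      have h1 := hC t ht' ξ
      have h2 : C ≤ max C 0 := le_max_left _ _
      nlinarith
    have hle' : ∀ ζ, u t ζ ≤ m + e * (1 + size ζ) := fun ζ => by linarith [hle ζ]
    have hterm : ∀ x ∈ ξ.support, ((ξ x : ℝ) * (∫ v, u t (jump ξ x v) ∂p.toMeasure - u t ξ) +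
        if ξ x = 1 then (γ : ℝ) / 2 *
          (u t (ξ + Finsupp.single x 1) + u t (ξ - Finsupp.single x 1) - 2 * u t ξ) else 0) ≤
        (ξ x : ℝ) * m + γ * m := by
      intro x hx
      have hx' := Finsupp.mem_support_iff.1 hx
      have hint : ∫ v, u t (jump ξ x v) ∂p.toMeasure ≤ m + e * (1 + size ξ) := by
        have := integral_mono ((hcontr t ht').integrable hx') (integrable_const _)
          (fun v => (hle' (jump ξ x v)).trans_eq (by rw [size_jump hx'])) (μ := p.toMeasure)
        simpa using this
      have hγm : 0 ≤ (γ : ℝ) * m := by positivity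
      refine add_le_add (mul_le_mul_of_nonneg_left (by linarith) (Nat.cast_nonneg _)) ?_
      split_ifs
      · have h1 := hle' (ξ + Finsupp.single x 1)
        have h2 := hle' (ξ - Finsupp.single x 1)
        rw [size_add, size_single] at h1
        rw [size_sub_single hx'] at h2
        have h3 : u t (ξ + Finsupp.single x 1) + u t (ξ - Finsupp.single x 1) - 2 * u t ξ ≤
            2 * m := by
          push_cast at h1
          linarith
        have h4 : (0 : ℝ) ≤ γ / 2 := by positivity
        nlinarith
      · exact hγm
    refine (Finset.sum_le_sum hterm).trans ?_
    rw [Finset.sum_add_distrib, ← Finset.sum_mul, sum_eq_size, Finset.sum_const, nsmul_eq_mul]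
    have h5 := card_support_le_size ξ
    have hγm : 0 ≤ (γ : ℝ) * m := by positivity
    calc size ξ * m + ξ.support.card * (γ * m) ≤ size ξ * m + size ξ * (γ * m) := by gcongr
      _ = (1 + γ) * size ξ * m := by ring
      _ ≤ (1 + γ) * (max C 0 / e) * m := by gcongr

end gen

/-! ### The backward equation of the transition probabilities -/

section backward
variable {p : PMF (Site d)} {γ : ℝ≥0}

/-- Substituting `y = x + v` turns the sum over target sites into an integral over the increment, to
which monotone convergence applies. -/
theorem rateSum_eq_lintegral (g : FinConfig d → ℝ≥0∞) (ξ : FinConfig d) :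
    rateSum p γ g ξ = ∑ x ∈ ξ.support, ((ξ x : ℝ≥0∞) * ∫⁻ v, g (jump ξ x v) ∂p.toMeasure +
      if ξ x = 1 then
        (γ : ℝ≥0∞) / 2 * (g (ξ + Finsupp.single x 1) + g (ξ - Finsupp.single x 1)) else 0) := by
  refine Finset.sum_congr rfl fun x _ => ?_
  congr 1
  rw [lintegral_countable', ← ENNReal.tsum_mul_left, ← (Equiv.addLeft x).tsum_eq]
  refine tsum_congr fun v => ?_
  rw [PMF.toMeasure_apply_singleton _ _ (measurableSet_singleton v), Equiv.coe_addLeft,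
    add_sub_cancel_left, jump, mul_assoc, mul_comm (p v)]

theorem rateSum_mono {g h : FinConfig d → ℝ≥0∞} (hgh : g ≤ h) (ξ : FinConfig d) :
    rateSum p γ g ξ ≤ rateSum p γ h ξ := by
  simp_rw [rateSum_eq_lintegral]
  refine Finset.sum_le_sum fun x _ => ?_
  gcongr
  · exact hgh _
  · split_ifs
    · gcongr <;> exact hgh _
    · exact le_rfl

theorem rateSum_one (ξ : FinConfig d) : rateSum p γ (fun _ => 1) ξ = totalRate γ ξ := by
  rw [rateSum_eq_lintegral, totalRate, ENNReal.ofNNReal_finsetSum]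
  refine Finset.sum_congr rfl fun x _ => ?_
  rw [lintegral_const, measure_univ]
  split_ifs
  · simp [ENNReal.div_mul_cancel, one_add_one_eq_two]
  · simp

theorem rateSum_iSup {g : ℕ → FinConfig d → ℝ≥0∞} (hg : Monotone g) (ξ : FinConfig d) :
    rateSum p γ (fun ζ => ⨆ n, g n ζ) ξ = ⨆ n, rateSum p γ (g n) ξ := by
  simp_rw [rateSum_eq_lintegral]
  refine Eq.trans ?_ (ENNReal.finsetSum_iSup_of_monotone ?_)
  · refine Finset.sum_congr rfl fun x _ => ?_
    rw [lintegral_iSup (f := fun n v => g n (jump ξ x v)) (fun n => measurable_of_countable _)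
      (fun m n h v => hg h _), ENNReal.mul_iSup]
    split_ifs
    · rw [ENNReal.iSup_add_iSup_of_monotone (fun m n h => hg h _) (fun m n h => hg h _),
        ENNReal.mul_iSup, ENNReal.iSup_add_iSup_of_monotone]
      · intro m n h
        dsimp only
        gcongr
        exact hg h _
      · intro m n h
        dsimp only
        gcongr <;> exact hg h _
    · simp
  · intro x m n h
    dsimp only
    gcongr
    · exact hg h _
    · split_ifs
      · gcongr <;> exact hg h _
      · exact le_rfl

theorem measurable_rateSum {α : Type*} [MeasurableSpace α] {g : α → FinConfig d → ℝ≥0∞}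
    (hg : ∀ ξ, Measurable fun a => g a ξ) (ξ : FinConfig d) :
    Measurable fun a => rateSum p γ (g a) ξ := by
  refine Finset.measurable_sum _ fun x _ => Measurable.add ?_ ?_
  · exact Measurable.tsum fun y => (hg _).const_mul _
  · split_ifs
    · exact ((hg _).add (hg _)).const_mul _
    · exact measurable_const

theorem measurable_transProbLT (A : Set (FinConfig d)) (n : ℕ) (ξ : FinConfig d) :
    Measurable fun t => transProbLT p γ A n t ξ := by
  induction n generalizing ξ with
  | zero => exact measurable_const
  | succ n ih =>
    simp only [transProbLT]
    refine Measurable.add (by fun_prop) ?_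
    have h1 : Measurable fun q : ℝ × ℝ => (Set.Icc 0 q.1).indicator (fun s =>
        ENNReal.ofReal (Real.exp (-(totalRate γ ξ * s))) *
          rateSum p γ (fun ξ' => transProbLT p γ A n (q.1 - s) ξ') ξ) q.2 := by
      have h2 : Measurable fun q : ℝ × ℝ => ENNReal.ofReal (Real.exp (-(totalRate γ ξ * q.2))) *
          rateSum p γ (fun ξ' => transProbLT p γ A n (q.1 - q.2) ξ') ξ :=
        Measurable.mul (by fun_prop) (measurable_rateSum
          (fun ζ => (ih ζ).comp (measurable_fst.sub measurable_snd)) ξ)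
      have h3 : MeasurableSet {q : ℝ × ℝ | q.2 ∈ Set.Icc 0 q.1} :=
        (measurableSet_le measurable_const measurable_snd).inter
          (measurableSet_le measurable_snd measurable_fst)
      exact h2.indicator h3
    simpa only [lintegral_indicator measurableSet_Icc] using h1.lintegral_prod_right'

theorem monotone_transProbLT (A : Set (FinConfig d)) :
    Monotone fun n => transProbLT p γ A n := by
  refine monotone_nat_of_le_succ fun n => ?_
  induction n with
  | zero => intro t ξ; simp [transProbLT]
  | succ n ih =>
    intro t ξ
    rw [transProbLT, transProbLT]
    gcongr with s
    exact rateSum_mono (fun ζ => ih _ _) ξ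

theorem lintegral_exp_mul_rate (q : ℝ≥0) {t : ℝ} (ht : 0 ≤ t) :
    ∫⁻ s in Set.Icc 0 t, ENNReal.ofReal (Real.exp (-(q * s))) * q =
      ENNReal.ofReal (1 - Real.exp (-(q * t))) := by
  have h : ∀ s, ENNReal.ofReal (Real.exp (-(q * s))) * q =
      ENNReal.ofReal (Real.exp (-(q * s)) * q) := fun s => by
    rw [ENNReal.ofReal_mul (Real.exp_nonneg _), ENNReal.ofReal_coe_nnreal]
  simp_rw [h]
  rw [← ofReal_integral_eq_lintegral_ofReal
    (Continuous.integrableOn_Icc (by fun_prop)) (Eventually.of_forall fun s => by positivity),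
    integral_Icc_eq_integral_Ioc, ← intervalIntegral.integral_of_le ht]
  congr 1
  have hd : ∀ s ∈ Set.uIcc 0 t, HasDerivAt (fun s : ℝ => -Real.exp (-(q * s)))
      (Real.exp (-(q * s)) * q) s := fun s _ => by
    have := (((hasDerivAt_id' s).const_mul (q : ℝ)).fun_neg.exp).fun_neg
    simpa using this
  rw [intervalIntegral.integral_eq_sub_of_hasDerivAt hd
    (Continuous.intervalIntegrable (by fun_prop) _ _)]
  simp
  ring

/-- The weight of having no transition up to `t` and the total weight of a first transition at some
`s ≤ t` add up to `1`. -/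
theorem transProbLT_le_one (A : Set (FinConfig d)) (n : ℕ) {t : ℝ} (ht : 0 ≤ t)
    (ξ : FinConfig d) : transProbLT p γ A n t ξ ≤ 1 := by
  induction n generalizing t ξ with
  | zero => simp [transProbLT]
  | succ n ih =>
    rw [transProbLT]
    have h1 : ∫⁻ s in Set.Icc 0 t, ENNReal.ofReal (Real.exp (-(totalRate γ ξ * s))) *
        rateSum p γ (fun ξ' => transProbLT p γ A n (t - s) ξ') ξ ≤
        ENNReal.ofReal (1 - Real.exp (-(totalRate γ ξ * t))) := by
      rw [← lintegral_exp_mul_rate _ ht]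
      refine setLIntegral_mono' measurableSet_Icc fun s hs => ?_
      rw [← rateSum_one (p := p)]
      gcongr
      exact rateSum_mono (fun ζ => ih (sub_nonneg.2 hs.2) ζ) ξ
    have h2 : A.indicator (1 : FinConfig d → ℝ≥0∞) ξ ≤ 1 :=
      Set.indicator_le_self' (by simp) ξ
    have h3 : Real.exp (-(totalRate γ ξ * t)) ≤ 1 :=
      Real.exp_le_one_iff.2 (by have := (totalRate γ ξ).coe_nonneg; nlinarith)
    calc _ ≤ ENNReal.ofReal (Real.exp (-(totalRate γ ξ * t))) * 1 +
          ENNReal.ofReal (1 - Real.exp (-(totalRate γ ξ * t))) := by gcongr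
      _ = 1 := by
        rw [mul_one, ← ENNReal.ofReal_add (Real.exp_nonneg _) (by linarith)]
        simp

variable (p γ) in
/-- The probability that the finite system started at `ξ` is in `A` at time `t`, as a real
number; constant for negative times. -/
def prob (A : Set (FinConfig d)) (t : ℝ) (ξ : FinConfig d) : ℝ :=
  (⨆ n, transProbLT p γ A n (max t 0) ξ).toReal

theorem toReal_transProb (t : ℝ≥0) (ξ : FinConfig d) (A : Set (FinConfig d)) :
    (transProb p γ t ξ A).toReal = prob p γ A t ξ := by
  rw [prob, transProb, max_eq_left t.coe_nonneg]

theorem iSup_transProbLT_le_one (A : Set (FinConfig d)) {t : ℝ} (ht : 0 ≤ t) (ξ : FinConfig d) :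
    ⨆ n, transProbLT p γ A n t ξ ≤ 1 :=
  iSup_le fun n => transProbLT_le_one A n ht ξ

theorem prob_nonneg (A : Set (FinConfig d)) (t : ℝ) (ξ : FinConfig d) : 0 ≤ prob p γ A t ξ :=
  ENNReal.toReal_nonneg

theorem prob_le_one (A : Set (FinConfig d)) (t : ℝ) (ξ : FinConfig d) : prob p γ A t ξ ≤ 1 :=
  ENNReal.toReal_le_of_le_ofReal zero_le_one
    ((iSup_transProbLT_le_one A (le_max_right _ _) ξ).trans (by simp))

theorem abs_prob_le_one (A : Set (FinConfig d)) (t : ℝ) (ξ : FinConfig d) :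
    |prob p γ A t ξ| ≤ 1 := by
  rw [abs_of_nonneg (prob_nonneg A t ξ)]
  exact prob_le_one A t ξ

theorem controlled_prob (A : Set (FinConfig d)) (t : ℝ) : Controlled (prob p γ A t) :=
  controlled_of_bounded 1 (abs_prob_le_one A t)

theorem ofReal_prob (A : Set (FinConfig d)) (t : ℝ) (ξ : FinConfig d) :
    ENNReal.ofReal (prob p γ A t ξ) = ⨆ n, transProbLT p γ A n (max t 0) ξ :=
  ENNReal.ofReal_toReal
    ((iSup_transProbLT_le_one A (le_max_right _ _) ξ).trans_lt ENNReal.one_lt_top).ne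

theorem measurable_prob (A : Set (FinConfig d)) (ξ : FinConfig d) :
    Measurable fun t => prob p γ A t ξ :=
  ((Measurable.iSup fun n => measurable_transProbLT A n ξ).comp
    (measurable_id.max measurable_const)).ennreal_toReal

/-- The renewal equation at the first transition, obtained by monotone convergence in the number of
transitions. -/
theorem iSup_transProbLT_eq (A : Set (FinConfig d)) (t : ℝ) (ξ : FinConfig d) :
    ⨆ n, transProbLT p γ A n t ξ =
      ENNReal.ofReal (Real.exp (-(totalRate γ ξ * t))) * A.indicator 1 ξ +
        ∫⁻ s in Set.Icc 0 t, ENNReal.ofReal (Real.exp (-(totalRate γ ξ * s))) *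
          rateSum p γ (fun ξ' => ⨆ n, transProbLT p γ A n (t - s) ξ') ξ := by
  have hmono : ∀ s ξ, Monotone fun n => transProbLT p γ A n s ξ := fun s ξ m n h =>
    monotone_transProbLT A h s ξ
  rw [← (hmono t ξ).iSup_nat_add 1]
  simp_rw [transProbLT]
  rw [← ENNReal.add_iSup]
  congr 1
  rw [← lintegral_iSup]
  · refine lintegral_congr fun s => ?_
    rw [← ENNReal.mul_iSup, ← rateSum_iSup fun m n h ζ => hmono _ ζ h]
  · intro n
    exact Measurable.mul (by fun_prop) (measurable_rateSum
      (fun ζ => (measurable_transProbLT A n ζ).comp (measurable_const.sub measurable_id)) ξ)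
  · intro m n h s
    dsimp only
    gcongr
    exact rateSum_mono (fun ζ => hmono _ ζ h) ξ

/-- The sum of a real function over all transitions, weighted by their rates. -/
theorem toReal_rateSum {g : FinConfig d → ℝ} (h0 : ∀ ξ, 0 ≤ g ξ) (hg : Controlled g)
    (ξ : FinConfig d) : rateSum p γ (fun ζ => ENNReal.ofReal (g ζ)) ξ =
      ENNReal.ofReal (gen p γ g ξ + totalRate γ ξ * g ξ) := by
  have hq : gen p γ g ξ + totalRate γ ξ * g ξ =
      ∑ x ∈ ξ.support, ((ξ x : ℝ) * ∫ v, g (jump ξ x v) ∂p.toMeasure + if ξ x = 1 then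
        (γ : ℝ) / 2 * (g (ξ + Finsupp.single x 1) + g (ξ - Finsupp.single x 1)) else 0) := by
    rw [gen, totalRate, NNReal.coe_sum, Finset.sum_mul, ← Finset.sum_add_distrib]
    refine Finset.sum_congr rfl fun x _ => ?_
    push_cast
    split_ifs
    · ring
    · push_cast; ring
  have hi : ∀ x, 0 ≤ ∫ v, g (jump ξ x v) ∂p.toMeasure := fun x => integral_nonneg fun v => h0 _
  have hb : ∀ x, 0 ≤ (γ : ℝ) / 2 *
      (g (ξ + Finsupp.single x 1) + g (ξ - Finsupp.single x 1)) := fun x =>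
    mul_nonneg (by positivity) (add_nonneg (h0 _) (h0 _))
  rw [hq, rateSum_eq_lintegral, ENNReal.ofReal_sum_of_nonneg]
  · refine Finset.sum_congr rfl fun x hx => ?_
    rw [ENNReal.ofReal_add (mul_nonneg (Nat.cast_nonneg _) (hi x)) (by split_ifs; exacts [hb x, le_rfl]),
      ENNReal.ofReal_mul (Nat.cast_nonneg _), ENNReal.ofReal_natCast,
      ofReal_integral_eq_lintegral_ofReal (hg.integrable (Finsupp.mem_support_iff.1 hx))
        (Eventually.of_forall fun v => h0 _)]
    congr 1
    split_ifs
    · rw [ENNReal.ofReal_mul (by positivity), ENNReal.ofReal_add (h0 _) (h0 _),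
        ENNReal.ofReal_div_of_pos two_pos, ENNReal.ofReal_coe_nnreal]
      simp
    · simp
  · intro x _
    exact add_nonneg (mul_nonneg (Nat.cast_nonneg _) (hi x)) (by split_ifs; exacts [hb x, le_rfl])

/-- Adding `totalRate * g` cancels the negative terms of the generator, leaving a combination of
values of `g` with nonnegative weights. -/
theorem gen_add_rate_nonneg {g : FinConfig d → ℝ} (h0 : ∀ ξ, 0 ≤ g ξ) (ξ : FinConfig d) :
    0 ≤ gen p γ g ξ + totalRate γ ξ * g ξ := by
  rw [gen, totalRate, NNReal.coe_sum, Finset.sum_mul, ← Finset.sum_add_distrib]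
  refine Finset.sum_nonneg fun x _ => ?_
  have h1 : 0 ≤ (ξ x : ℝ) * ∫ v, g (jump ξ x v) ∂p.toMeasure :=
    mul_nonneg (Nat.cast_nonneg _) (integral_nonneg fun v => h0 _)
  have h2 : 0 ≤ (γ : ℝ) / 2 * (g (ξ + Finsupp.single x 1) + g (ξ - Finsupp.single x 1)) :=
    mul_nonneg (by positivity) (add_nonneg (h0 _) (h0 _))
  push_cast
  split_ifs
  · nlinarith
  · push_cast; nlinarith

theorem gen_mono_bound {g : FinConfig d → ℝ} (h1 : ∀ ξ, |g ξ| ≤ 1) (ξ : FinConfig d) :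
    |gen p γ g ξ| ≤ 2 * (1 + γ) * size ξ := by
  rw [gen]
  refine (Finset.abs_sum_le_sum_abs _ _).trans ?_
  have hterm : ∀ x ∈ ξ.support, |(ξ x : ℝ) * (∫ v, g (jump ξ x v) ∂p.toMeasure - g ξ) +
      if ξ x = 1 then (γ : ℝ) / 2 *
        (g (ξ + Finsupp.single x 1) + g (ξ - Finsupp.single x 1) - 2 * g ξ) else 0| ≤
      (ξ x : ℝ) * 2 + 2 * γ := by
    intro x _
    have hi : |∫ v, g (jump ξ x v) ∂p.toMeasure| ≤ 1 := by
      have := norm_integral_le_of_norm_le_const (μ := p.toMeasure) (C := 1)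
        (Eventually.of_forall fun v => (Real.norm_eq_abs _).trans_le (h1 (jump ξ x v)))
      simpa using this
    have a1 := abs_le.1 hi
    have a2 := abs_le.1 (h1 ξ)
    refine (abs_add_le _ _).trans (add_le_add ?_ ?_)
    · rw [abs_mul, Nat.abs_cast]
      exact mul_le_mul_of_nonneg_left (abs_le.2 ⟨by linarith, by linarith⟩) (Nat.cast_nonneg _)
    · split_ifs
      · have a3 := abs_le.1 (h1 (ξ + Finsupp.single x 1))
        have a4 := abs_le.1 (h1 (ξ - Finsupp.single x 1))
        rw [abs_mul, abs_of_nonneg (by positivity : (0 : ℝ) ≤ (γ : ℝ) / 2)]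
        have : |g (ξ + Finsupp.single x 1) + g (ξ - Finsupp.single x 1) - 2 * g ξ| ≤ 4 :=
          abs_le.2 ⟨by linarith, by linarith⟩
        have h4 : (0 : ℝ) ≤ γ / 2 := by positivity
        nlinarith
      · simp
  refine (Finset.sum_le_sum hterm).trans ?_
  rw [Finset.sum_add_distrib, ← Finset.sum_mul, sum_eq_size, Finset.sum_const, nsmul_eq_mul]
  have := card_support_le_size ξ
  have hγ : (0 : ℝ) ≤ γ := γ.coe_nonneg
  nlinarith

theorem continuous_gen {α : Type*} [TopologicalSpace α] [FirstCountableTopology α]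
    {g : α → FinConfig d → ℝ} (hg : ∀ ξ, Continuous fun a => g a ξ) {ψ : ℕ → ℝ}
    (hψ : ∀ a ξ, |g a ξ| ≤ ψ (Finsupp.degree ξ)) (ξ : FinConfig d) :
    Continuous fun a => gen p γ (g a) ξ := by
  refine continuous_finsetSum _ fun x hx => ?_
  have hx' := Finsupp.mem_support_iff.1 hx
  refine Continuous.add (continuous_const.mul (Continuous.sub ?_ (hg ξ))) ?_
  · refine continuous_of_dominated (bound := fun _ => ψ (Finsupp.degree ξ))
      (fun a => (measurable_of_countable _).aestronglyMeasurable)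
      (fun a => Eventually.of_forall fun v => ?_) (integrable_const _)
      (Eventually.of_forall fun v => hg _)
    have := hψ a (jump ξ x v)
    rwa [degree_jump hx'] at this
  · split_ifs
    · exact continuous_const.mul (((hg _).add (hg _)).sub (continuous_const.mul (hg _)))
    · exact continuous_const

/-- The renewal equation after reversing time in the integral: `t` now enters only through the
prefactor and the upper limit. Regularity in `t` can therefore be bootstrapped from boundedness to
continuity and on to differentiability. -/
theorem prob_eq (A : Set (FinConfig d)) {t : ℝ} (ht : 0 ≤ t) (ξ : FinConfig d) :
    prob p γ A t ξ = Real.exp (-(totalRate γ ξ * t)) * (A.indicator 1 ξ +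
      ∫ s in (0 : ℝ)..t, Real.exp (totalRate γ ξ * s) *
        (gen p γ (prob p γ A s) ξ + totalRate γ ξ * prob p γ A s ξ)) := by
  set q := totalRate γ ξ with hq
  set r : ℝ → ℝ := fun s => gen p γ (prob p γ A s) ξ + q * prob p γ A s ξ with hr
  have hr0 : ∀ s, 0 ≤ r s := fun s => gen_add_rate_nonneg (prob_nonneg A s) ξ
  have hind : (0 : ℝ) ≤ A.indicator 1 ξ := Set.indicator_nonneg (fun _ _ => zero_le_one) _
  have hrofReal : ∀ s, 0 ≤ s → rateSum p γ (fun ξ' => ⨆ n, transProbLT p γ A n s ξ') ξ =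
      ENNReal.ofReal (r s) := by
    intro s hs
    rw [hr]
    dsimp only
    rw [← toReal_rateSum (prob_nonneg A s) (controlled_prob A s)]
    simp_rw [ofReal_prob, max_eq_left hs]
  have hrm : Measurable r := by
    have : r = fun s => (rateSum p γ (fun ξ' => ENNReal.ofReal (prob p γ A s ξ')) ξ).toReal := by
      ext s
      rw [toReal_rateSum (prob_nonneg A s) (controlled_prob A s), ENNReal.toReal_ofReal (hr0 s)]
    rw [this]
    exact (measurable_rateSum (fun ζ => (measurable_prob A ζ).ennreal_ofReal) ξ).ennreal_toReal
  have hrb : ∀ s, |r s| ≤ 2 * (1 + γ) * size ξ + q := fun s => by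
    refine (abs_add_le _ _).trans (add_le_add (gen_mono_bound (abs_prob_le_one A s) ξ) ?_)
    rw [abs_mul, NNReal.abs_eq]
    exact mul_le_of_le_one_right q.coe_nonneg (abs_prob_le_one A s ξ)
  have hint : IntegrableOn (fun s => Real.exp (-(q * s)) * r (t - s)) (Set.Icc 0 t) := by
    refine Integrable.of_bound (C := 1 * (2 * (1 + γ) * size ξ + q))
      (Measurable.aestronglyMeasurable (by fun_prop)) ?_
    refine (ae_restrict_iff' measurableSet_Icc).2 (Eventually.of_forall fun s hs => ?_)
    rw [norm_mul, Real.norm_eq_abs, Real.norm_eq_abs, Real.abs_exp]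
    refine mul_le_mul (Real.exp_le_one_iff.2 ?_) (hrb _) (abs_nonneg _) zero_le_one
    have := mul_nonneg q.coe_nonneg hs.1
    linarith
  have h1 : ⨆ n, transProbLT p γ A n t ξ = ENNReal.ofReal (Real.exp (-(q * t)) *
      A.indicator 1 ξ + ∫ s in Set.Icc 0 t, Real.exp (-(q * s)) * r (t - s)) := by
    rw [iSup_transProbLT_eq, ENNReal.ofReal_add
      (mul_nonneg (Real.exp_nonneg _) hind)
      (integral_nonneg fun s => mul_nonneg (Real.exp_nonneg _) (hr0 _)),
      ENNReal.ofReal_mul (Real.exp_nonneg _), ofReal_integral_eq_lintegral_ofReal hint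
        (Eventually.of_forall fun s => mul_nonneg (Real.exp_nonneg _) (hr0 _))]
    congr 1
    · congr 1
      by_cases h : ξ ∈ A <;> simp [h]
    · refine setLIntegral_congr_fun measurableSet_Icc fun s hs => ?_
      rw [hrofReal _ (sub_nonneg.2 hs.2), ENNReal.ofReal_mul (Real.exp_nonneg _)]
  rw [prob, max_eq_left ht, h1, ENNReal.toReal_ofReal (add_nonneg
    (mul_nonneg (Real.exp_nonneg _) hind)
    (integral_nonneg fun s => mul_nonneg (Real.exp_nonneg _) (hr0 _))), mul_add,
    integral_Icc_eq_integral_Ioc, ← intervalIntegral.integral_of_le ht]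
  congr 1
  rw [← intervalIntegral.integral_const_mul]
  have := intervalIntegral.integral_comp_sub_left
    (fun s => Real.exp (-(q * (t - s))) * r s) t (a := 0) (b := t)
  rw [sub_zero, sub_self] at this
  simp only [sub_sub_cancel] at this
  rw [this]
  refine intervalIntegral.integral_congr fun s _ => ?_
  rw [← mul_assoc, ← Real.exp_add]
  congr 2
  ring

theorem prob_zero (A : Set (FinConfig d)) (ξ : FinConfig d) :
    prob p γ A 0 ξ = A.indicator 1 ξ := by
  rw [prob_eq A le_rfl]
  simp

theorem continuous_prob (A : Set (FinConfig d)) (ξ : FinConfig d) :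
    Continuous fun t => prob p γ A t ξ := by
  have hm : Measurable fun s => Real.exp (totalRate γ ξ * s) *
      (gen p γ (prob p γ A s) ξ + totalRate γ ξ * prob p γ A s ξ) := by
    have : (fun s => gen p γ (prob p γ A s) ξ + totalRate γ ξ * prob p γ A s ξ) =
        fun s => (rateSum p γ (fun ξ' => ENNReal.ofReal (prob p γ A s ξ')) ξ).toReal := by
      ext s
      rw [toReal_rateSum (prob_nonneg A s) (controlled_prob A s),
        ENNReal.toReal_ofReal (gen_add_rate_nonneg (prob_nonneg A s) ξ)]
    have h2 : Measurable (fun s => gen p γ (prob p γ A s) ξ + totalRate γ ξ * prob p γ A s ξ) := by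
      rw [this]
      exact (measurable_rateSum (fun ζ => (measurable_prob A ζ).ennreal_ofReal) ξ).ennreal_toReal
    exact Measurable.mul (by fun_prop) h2
  have hint : ∀ a b : ℝ, IntervalIntegrable (fun s => Real.exp (totalRate γ ξ * s) *
      (gen p γ (prob p γ A s) ξ + totalRate γ ξ * prob p γ A s ξ)) volume a b := by
    intro a b
    refine (Continuous.intervalIntegrable (u := fun s => Real.exp (totalRate γ ξ * s) *
      (2 * (1 + γ) * size ξ + totalRate γ ξ)) (by fun_prop) a b).mono_fun
      hm.aestronglyMeasurable (Eventually.of_forall fun s => ?_)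
    dsimp only
    rw [norm_mul, norm_mul]
    refine mul_le_mul_of_nonneg_left ?_ (norm_nonneg _)
    refine le_trans ?_ (le_abs_self _)
    refine (abs_add_le _ _).trans (add_le_add (gen_mono_bound (abs_prob_le_one A s) ξ) ?_)
    rw [abs_mul, NNReal.abs_eq]
    exact mul_le_of_le_one_right (NNReal.coe_nonneg _) (abs_prob_le_one A s ξ)
  have hc := intervalIntegral.continuous_primitive hint 0
  have heq : (fun t => prob p γ A t ξ) = fun t => Real.exp (-(totalRate γ ξ * max t 0)) *
      (A.indicator 1 ξ + ∫ s in (0 : ℝ)..(max t 0), Real.exp (totalRate γ ξ * s) *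
        (gen p γ (prob p γ A s) ξ + totalRate γ ξ * prob p γ A s ξ)) := by
    ext t
    rw [← prob_eq A (le_max_right t 0)]
    simp [prob]
  rw [heq]
  have hmax : Continuous fun t : ℝ => max t 0 := by fun_prop
  exact (by fun_prop : Continuous fun t : ℝ => Real.exp (-(totalRate γ ξ * max t 0))).mul
    (continuous_const.add (hc.comp hmax))

theorem continuous_gen_prob (A : Set (FinConfig d)) (ξ : FinConfig d) :
    Continuous fun t => gen p γ (prob p γ A t) ξ :=
  continuous_gen (ψ := fun _ => 1) (continuous_prob A) (abs_prob_le_one A) ξ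

/-- The backward equation. -/
theorem hasDerivWithinAt_prob (A : Set (FinConfig d)) (ξ : FinConfig d) {t : ℝ} (ht : 0 ≤ t) :
    HasDerivWithinAt (fun t => prob p γ A t ξ) (gen p γ (prob p γ A t) ξ) (Set.Ici t) t := by
  set q := (totalRate γ ξ : ℝ) with hq
  have hc : Continuous fun s => Real.exp (q * s) *
      (gen p γ (prob p γ A s) ξ + q * prob p γ A s ξ) :=
    (by fun_prop : Continuous fun s : ℝ => Real.exp (q * s)).mul
      ((continuous_gen_prob A ξ).add (continuous_const.mul (continuous_prob A ξ)))
  have h1 : HasDerivAt (fun t => A.indicator 1 ξ + ∫ s in (0 : ℝ)..t, Real.exp (q * s) *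
      (gen p γ (prob p γ A s) ξ + q * prob p γ A s ξ)) _ t :=
    (intervalIntegral.integral_hasDerivAt_right (hc.intervalIntegrable _ _)
      hc.aestronglyMeasurable.stronglyMeasurableAtFilter hc.continuousAt).const_add _
  have h2 : HasDerivAt (fun t => Real.exp (-(q * t))) (Real.exp (-(q * t)) * -q) t := by
    have := ((hasDerivAt_id' t).const_mul q).neg.exp
    simpa using this
  have h3 := (h2.mul h1).hasDerivWithinAt (s := Set.Ici t)
  refine (h3.congr (fun s hs => prob_eq A (ht.trans hs) ξ) (prob_eq A ht ξ)).congr_deriv ?_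
  have h4 := prob_eq (p := p) (γ := γ) A ht ξ
  have h5 : Real.exp (-(q * t)) * Real.exp (q * t) = 1 := by
    rw [← Real.exp_add]; simp
  rw [← hq] at h4
  calc _ = -q * (Real.exp (-(q * t)) * (A.indicator 1 ξ + ∫ s in (0 : ℝ)..t, Real.exp (q * s) *
        (gen p γ (prob p γ A s) ξ + q * prob p γ A s ξ))) +
        (Real.exp (-(q * t)) * Real.exp (q * t)) *
          (gen p γ (prob p γ A t) ξ + q * prob p γ A t ξ) := by ring
    _ = gen p γ (prob p γ A t) ξ := by rw [← h4, h5]; ring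

/-- Comparison of a bounded subsolution of the backward equation with the transition
probabilities. -/
theorem le_prob_of_le_gen {A : Set (FinConfig d)} {u u' : ℝ → FinConfig d → ℝ} {C : ℝ}
    (hC : ∀ t, 0 ≤ t → ∀ ξ, u t ξ ≤ C) (hcontr : ∀ t, 0 ≤ t → Controlled (u t))
    (hcont : ∀ ξ, Continuous fun t => u t ξ)
    (hder : ∀ ξ, ∀ t, 0 ≤ t → HasDerivWithinAt (fun t => u t ξ) (u' t ξ) (Set.Ici t) t)
    (h0 : ∀ ξ, u 0 ξ ≤ A.indicator 1 ξ)
    (hgen : ∀ ξ, ∀ t, 0 ≤ t → u' t ξ ≤ gen p γ (u t) ξ) {t : ℝ} (ht : 0 ≤ t)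
    (ξ : FinConfig d) : u t ξ ≤ prob p γ A t ξ := by
  have := nonpos_of_le_gen (p := p) (γ := γ) (T := t) (C := C)
    (u := fun t ξ => u t ξ - prob p γ A t ξ)
    (u' := fun t ξ => u' t ξ - gen p γ (prob p γ A t) ξ)
    (fun s hs ζ => by linarith [hC s hs.1 ζ, prob_nonneg (p := p) (γ := γ) A s ζ])
    (fun s hs => (hcontr s hs.1).sub (controlled_prob A s))
    (fun ζ => ((hcont ζ).sub (continuous_prob A ζ)).continuousOn)
    (fun ζ s hs => (hder ζ s hs.1).sub (hasDerivWithinAt_prob A ζ hs.1))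
    (fun ζ => by
      have := h0 ζ
      rw [prob_zero]
      linarith)
    (fun ζ s hs => by
      rw [gen_sub (hcontr s hs.1) (controlled_prob A s)]
      have := hgen ζ s hs.1
      linarith) t ⟨ht, le_rfl⟩ ξ
  linarith

/-- The finite systems do not explode. -/
theorem prob_compl (A : Set (FinConfig d)) {t : ℝ} (ht : 0 ≤ t) (ξ : FinConfig d) :
    1 - prob p γ A t ξ ≤ prob p γ Aᶜ t ξ := by
  refine le_prob_of_le_gen (u := fun t ξ => 1 - prob p γ A t ξ)
    (u' := fun t ξ => -gen p γ (prob p γ A t) ξ) (C := 1)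
    (fun t _ ξ => by linarith [prob_nonneg (p := p) (γ := γ) A t ξ])
    (fun t _ => (controlled_const 1).sub (controlled_prob A t))
    (fun ξ => continuous_const.sub (continuous_prob A ξ))
    (fun ξ t ht => (hasDerivWithinAt_prob A ξ ht).const_sub 1) (fun ξ => ?_) (fun ξ t ht => ?_) ht ξ
  · rw [prob_zero]
    by_cases h : ξ ∈ A <;> simp [h]
  · rw [gen_sub (controlled_const 1) (controlled_prob A t), gen_const]
    linarith

end backward

/-! ### Submodularity of occupation probabilities -/

section submodular
variable {p : PMF (Site d)} {γ : ℝ≥0}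

/-- The mixed difference `g (h + a) + g (h + b) - g (h + a + b) - g h`. -/
def mixedDiff (g : FinConfig d → ℝ) (h a b : FinConfig d) : ℝ :=
  g (h + a) + g (h + b) - g (h + a + b) - g h

/-- A Lyapunov function for triples of configurations. -/
def tripleWeight (h a b : FinConfig d) : ℝ :=
  (1 + (size h + size a + size b)) * (1 + size a * size b)

/-- The second difference of `g` in the number of particles at `w`. -/
def secondDiff (g : FinConfig d → ℝ) (w : Site d) (ξ : FinConfig d) : ℝ :=
  g (ξ + Finsupp.single w 1 + Finsupp.single w 1) + g ξ - 2 * g (ξ + Finsupp.single w 1)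

/-- The branching part of the generator at the site `w`. -/
def branchAt (g : FinConfig d → ℝ) (ξ : FinConfig d) (w : Site d) : ℝ :=
  if ξ w = 1 then g (ξ + Finsupp.single w 1) + g (ξ - Finsupp.single w 1) - 2 * g ξ else 0

theorem gen_eq_sum (g : FinConfig d → ℝ) {ξ : FinConfig d} {s : Finset (Site d)}
    (hs : ξ.support ⊆ s) : gen p γ g ξ = ∑ w ∈ s,
      ((ξ w : ℝ) * (∫ v, g (jump ξ w v) ∂p.toMeasure - g ξ) + γ / 2 * branchAt g ξ w) := by
  rw [gen, ← Finset.sum_subset hs]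
  · refine Finset.sum_congr rfl fun x _ => ?_
    rw [branchAt]
    split_ifs <;> simp
  · intro x _ hx
    rw [Finsupp.notMem_support_iff.1 hx, branchAt, Finsupp.notMem_support_iff.1 hx]
    simp

theorem branchAt_of_eq {g : FinConfig d → ℝ} {ξ ζ : FinConfig d} {w : Site d}
    (h : ξ = ζ + Finsupp.single w 1) : branchAt g ξ w = if ζ w = 0 then secondDiff g w ζ else 0 := by
  subst h
  rw [branchAt, secondDiff, add_tsub_cancel_right]
  simp

theorem branchAt_of_apply_eq_zero {g : FinConfig d → ℝ} {ξ : FinConfig d} {w : Site d}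
    (h : ξ w = 0) : branchAt g ξ w = 0 := by
  rw [branchAt, if_neg (by omega)]

theorem exists_eq_add_single {ξ : FinConfig d} {w : Site d} (h : ξ w ≠ 0) :
    ∃ ζ, ξ = ζ + Finsupp.single w 1 := ⟨_, (sub_single_add_single h).symm⟩

/-- The cases are which of `h`, `a`, `b` have a particle at `w`. In each, the branching terms are
rewritten through mixed differences at neighbouring triples, bounded by `hle`, and the mixed
difference at the triple itself, controlled by `hpos`. The multiple of `e` absorbs what the weight
`tripleWeight` contributes. -/
theorem neg_mixedDiff_branchAt_le {g : FinConfig d → ℝ} {m e : ℝ} (hm : 0 ≤ m) (he : 0 ≤ e)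
    (hle : ∀ h a b, -mixedDiff g h a b - e * tripleWeight h a b ≤ m) {h a b : FinConfig d}
    (hpos : 0 < -mixedDiff g h a b - e * tripleWeight h a b) (w : Site d) :
    -(branchAt g (h + a) w + branchAt g (h + b) w - branchAt g (h + a + b) w - branchAt g h w) ≤
      3 * m + e * (2 * size b * a w + 2 * size a * b w +
        2 * (1 + (size h + size a + size b)) * (a w * b w)) := by
  have sh := size_nonneg h
  have sa := size_nonneg a
  have sb := size_nonneg b
  obtain ⟨X, hX⟩ : ∃ X, X = e * (2 * size b * a w + 2 * size a * b w +
        2 * (1 + (size h + size a + size b)) * (a w * b w)) := ⟨_, rfl⟩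
  have na : (0 : ℝ) ≤ a w := Nat.cast_nonneg _
  have nb : (0 : ℝ) ≤ b w := Nat.cast_nonneg _
  have hX0 : 0 ≤ X := by rw [hX]; positivity
  have hXa : a w ≠ 0 → e * (2 * size b) ≤ X := fun ha => by
    have : (1 : ℝ) ≤ a w := by exact_mod_cast Nat.one_le_iff_ne_zero.2 ha
    rw [hX]
    refine mul_le_mul_of_nonneg_left ?_ he
    have : 2 * size b * 1 ≤ 2 * size b * a w := by gcongr
    have : 0 ≤ 2 * size a * b w + 2 * (1 + (size h + size a + size b)) * (a w * b w) := by
      positivity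
    linarith
  have hXb : b w ≠ 0 → e * (2 * size a) ≤ X := fun hb => by
    have : (1 : ℝ) ≤ b w := by exact_mod_cast Nat.one_le_iff_ne_zero.2 hb
    rw [hX]
    refine mul_le_mul_of_nonneg_left ?_ he
    have : 2 * size a * 1 ≤ 2 * size a * b w := by gcongr
    have : 0 ≤ 2 * size b * a w + 2 * (1 + (size h + size a + size b)) * (a w * b w) := by
      positivity
    linarith
  have hXab : a w ≠ 0 → b w ≠ 0 → e * (2 * (1 + (size h + size a + size b))) ≤ X :=
    fun ha hb => by
    have h1 : (1 : ℝ) ≤ a w := by exact_mod_cast Nat.one_le_iff_ne_zero.2 ha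
    have h2 : (1 : ℝ) ≤ b w := by exact_mod_cast Nat.one_le_iff_ne_zero.2 hb
    rw [hX]
    refine mul_le_mul_of_nonneg_left ?_ he
    have : 2 * (1 + (size h + size a + size b)) * (1 * 1) ≤
      2 * (1 + (size h + size a + size b)) * (a w * b w) := by gcongr
    have : 0 ≤ 2 * size b * a w + 2 * size a * b w := by positivity
    linarith
  rw [← hX]
  clear hX na nb
  have esh := mul_nonneg he sh
  have esa := mul_nonneg he sa
  have esb := mul_nonneg he sb
  clear sh sa sb
  set δ : FinConfig d := Finsupp.single w 1 with hδ
  have sδ : size δ = 1 := by simp [hδ]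
  have δw : δ w = 1 := by simp [hδ]
  by_cases hh : h w = 0
  · by_cases ha : a w = 0
    · by_cases hb : b w = 0
      · rw [branchAt_of_apply_eq_zero (by simp [hh, ha]),
          branchAt_of_apply_eq_zero (by simp [hh, hb]),
          branchAt_of_apply_eq_zero (by simp [hh, ha, hb]), branchAt_of_apply_eq_zero hh]
        linarith
      · have hXb := hXb hb
        clear hXa hXab
        obtain ⟨b, rfl⟩ := exists_eq_add_single hb
        rw [branchAt_of_apply_eq_zero (ξ := h + a) (by simp [hh, ha]), branchAt_of_apply_eq_zero hh,
          branchAt_of_eq (ζ := h + b) (by abel), branchAt_of_eq (ζ := h + a + b) (by abel)]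
        simp only [Finsupp.add_apply, hh, ha, zero_add]
        split_ifs
        · have h1 := hle h a (b + δ + δ)
          have h2 := hle h a b
          simp only [mixedDiff, secondDiff, tripleWeight, size_add, sδ, ← hδ] at *
          simp only [add_comm, add_left_comm] at *
          linarith
        · linarith
    · obtain ⟨a, rfl⟩ := exists_eq_add_single ha
      by_cases hb : b w = 0
      · have hXa := hXa ha
        clear hXb hXab
        rw [branchAt_of_apply_eq_zero (ξ := h + b) (by simp [hh, hb]), branchAt_of_apply_eq_zero hh,
          branchAt_of_eq (ζ := h + a) (by abel), branchAt_of_eq (ζ := h + a + b) (by abel)]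
        simp only [Finsupp.add_apply, hh, hb, zero_add, add_zero]
        split_ifs
        · have h1 := hle h (a + δ + δ) b
          have h2 := hle h a b
          simp only [mixedDiff, secondDiff, tripleWeight, size_add, sδ, ← hδ] at *
          simp only [add_comm, add_left_comm] at *
          linarith
        · linarith
      · have hXab := hXab ha hb
        clear hXa hXb
        obtain ⟨b, rfl⟩ := exists_eq_add_single hb
        rw [branchAt_of_apply_eq_zero hh,
          branchAt_of_eq (ξ := h + (a + _)) (ζ := h + a) (by abel),
          branchAt_of_eq (ξ := h + (b + _)) (ζ := h + b) (by abel),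
          branchAt_of_eq (ζ := h + a + b + δ) (by abel),
          if_neg (c := (h + a + b + δ) w = 0) (by simp [hδ])]
        simp only [Finsupp.add_apply, hh, zero_add]
        -- If both `h + a + δ` and `h + b + δ` are lonely at `w`, then `h1`, `h2` and twice `hpos`
        -- suffice. If only one of them is, the second difference missing from the other is supplied
        -- by `h3` or `h4`, which accounts for the third `m`.
        have h1 := hle h (a + δ + δ) b
        have h2 := hle h a (b + δ + δ)
        have h3 := hle (h + b) δ δ
        have h4 := hle (h + a) δ δ
        simp only [mixedDiff, secondDiff, tripleWeight, size_add, sδ, ← hδ] at *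
        simp only [add_comm, add_left_comm] at *
        split_ifs <;> linarith
  · obtain ⟨h, rfl⟩ := exists_eq_add_single hh
    by_cases ha : a w = 0
    · by_cases hb : b w = 0
      · clear hXa hXb hXab
        rw [branchAt_of_eq (ζ := h) rfl, branchAt_of_eq (ζ := h + a) (by abel),
          branchAt_of_eq (ζ := h + b) (by abel), branchAt_of_eq (ζ := h + a + b) (by abel)]
        simp only [Finsupp.add_apply, ha, hb, add_zero]
        have h1 := hle (h + δ + δ) a b
        have h2 := hle h a b
        simp only [mixedDiff, secondDiff, tripleWeight, size_add, sδ, ← hδ] at *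
        simp only [add_comm, add_left_comm] at *
        split_ifs <;> linarith
      · clear hXa hXb hXab
        obtain ⟨b, rfl⟩ := exists_eq_add_single hb
        rw [branchAt_of_eq (ζ := h) rfl, branchAt_of_eq (ζ := h + a) (by abel),
          branchAt_of_eq (ζ := h + b + δ) (by abel), branchAt_of_eq (ζ := h + a + b + δ) (by abel),
          if_neg (c := (h + b + δ) w = 0) (by simp [hδ]),
          if_neg (c := (h + a + b + δ) w = 0) (by simp [hδ])]
        simp only [Finsupp.add_apply, ha, add_zero]
        have h1 := hle (h + δ + δ) a b
        have h2 := hle h a (b + δ + δ)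
        simp only [mixedDiff, secondDiff, tripleWeight, size_add, sδ, ← hδ] at *
        simp only [add_comm, add_left_comm] at *
        split_ifs <;> linarith
    · obtain ⟨a, rfl⟩ := exists_eq_add_single ha
      by_cases hb : b w = 0
      · clear hXa hXb hXab
        rw [branchAt_of_eq (ζ := h) rfl, branchAt_of_eq (ξ := _ + (a + _)) (ζ := h + a + δ) (by abel),
          branchAt_of_eq (ξ := h + Finsupp.single w 1 + b) (ζ := h + b) (by abel),
          branchAt_of_eq (ζ := h + a + b + δ) (by abel), if_neg (c := (h + a + δ) w = 0) (by simp [hδ]),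
          if_neg (c := (h + a + b + δ) w = 0) (by simp [hδ])]
        simp only [Finsupp.add_apply, hb, add_zero]
        have h1 := hle (h + δ + δ) a b
        have h2 := hle h (a + δ + δ) b
        simp only [mixedDiff, secondDiff, tripleWeight, size_add, sδ, ← hδ] at *
        simp only [add_comm, add_left_comm] at *
        split_ifs <;> linarith
      · have hXab := hXab ha hb
        clear hXa hXb
        obtain ⟨b, rfl⟩ := exists_eq_add_single hb
        rw [branchAt_of_eq (ζ := h) rfl, branchAt_of_eq (ξ := _ + (a + _)) (ζ := h + a + δ) (by abel),
          branchAt_of_eq (ξ := _ + (b + _)) (ζ := h + b + δ) (by abel),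
          branchAt_of_eq (ζ := h + a + b + δ + δ) (by abel),
          if_neg (c := (h + a + δ) w = 0) (by simp [hδ]),
          if_neg (c := (h + b + δ) w = 0) (by simp [hδ]),
          if_neg (c := (h + a + b + δ + δ) w = 0) (by simp [hδ])]
        -- Only `h + δ` can be lonely at `w`, and its second difference is `-mixedDiff g h δ δ`.
        have h1 := hle h δ δ
        have h2 := mul_nonneg he (size_nonneg a)
        simp only [mixedDiff, secondDiff, tripleWeight, size_add, sδ, ← hδ] at *
        simp only [add_comm, add_left_comm] at *
        split_ifs <;> linarith

theorem jump_add_left {ξ : FinConfig d} {w : Site d} (h : ξ w ≠ 0) (ζ : FinConfig d) (v : Site d) :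
    jump (ξ + ζ) w v = jump ξ w v + ζ := by
  obtain ⟨ξ, rfl⟩ := exists_eq_add_single h
  rw [jump, jump, add_tsub_cancel_right,
    show ξ + Finsupp.single w 1 + ζ = ξ + ζ + Finsupp.single w 1 by abel, add_tsub_cancel_right]
  abel

theorem jump_add_right {ξ : FinConfig d} {w : Site d} (h : ξ w ≠ 0) (ζ : FinConfig d)
    (v : Site d) : jump (ζ + ξ) w v = ζ + jump ξ w v := by
  rw [add_comm, jump_add_left h, add_comm]

theorem neg_le_integral_mixed {f₁ f₂ f₃ f₄ : Site d → ℝ} {c : ℝ}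
    (h₁ : Integrable f₁ p.toMeasure) (h₂ : Integrable f₂ p.toMeasure)
    (h₃ : Integrable f₃ p.toMeasure) (h₄ : Integrable f₄ p.toMeasure)
    (h : ∀ v, -(f₁ v + f₂ v - f₃ v - f₄ v) ≤ c) :
    -(∫ v, f₁ v ∂p.toMeasure + ∫ v, f₂ v ∂p.toMeasure - ∫ v, f₃ v ∂p.toMeasure -
      ∫ v, f₄ v ∂p.toMeasure) ≤ c := by
  have h12 : Integrable (fun v => f₁ v + f₂ v) p.toMeasure := h₁.add h₂
  have h123 : Integrable (fun v => f₁ v + f₂ v - f₃ v) p.toMeasure := h12.sub h₃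
  have h1234 : Integrable (fun v => -(f₁ v + f₂ v - f₃ v - f₄ v)) p.toMeasure := (h123.sub h₄).neg
  rw [← integral_add h₁ h₂, ← integral_sub h12 h₃, ← integral_sub h123 h₄, ← integral_neg]
  simpa using integral_mono h1234 (integrable_const c) h

/-- A particle of `h` jumps in all four configurations at once, while a particle of `a` or `b` jumps
only in the two that contain it. Either way the jump leads to another triple with the same sizes,
hence the same weight, where `hle` applies. -/
theorem neg_mixedDiff_jumpAt_le {g : FinConfig d → ℝ} (hg : Controlled g) {m e : ℝ}
    (hle : ∀ h a b, -mixedDiff g h a b - e * tripleWeight h a b ≤ m) {h a b : FinConfig d}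
    (hpos : 0 < -mixedDiff g h a b - e * tripleWeight h a b) (w : Site d) :
    -(((h + a) w : ℝ) * (∫ v, g (jump (h + a) w v) ∂p.toMeasure - g (h + a)) +
      ((h + b) w : ℝ) * (∫ v, g (jump (h + b) w v) ∂p.toMeasure - g (h + b)) -
      ((h + a + b) w : ℝ) * (∫ v, g (jump (h + a + b) w v) ∂p.toMeasure - g (h + a + b)) -
      (h w : ℝ) * (∫ v, g (jump h w v) ∂p.toMeasure - g h)) ≤
      ((h + a + b) w : ℝ) * m := by
  set J : FinConfig d → ℝ := fun ξ => ∫ v, g (jump ξ w v) ∂p.toMeasure with hJ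
  have int : ∀ {ξ : FinConfig d}, ξ w ≠ 0 → Integrable (fun v => g (jump ξ w v)) p.toMeasure :=
    fun hξ => hg.integrable hξ
  simp only [mixedDiff] at hpos
  have e1 : 0 ≤ (h w : ℝ) * (m + (J (h + a) - g (h + a) + (J (h + b) - g (h + b)) -
      (J (h + a + b) - g (h + a + b)) - (J h - g h))) := by
    by_cases hw : h w = 0
    · simp [hw]
    refine mul_nonneg (Nat.cast_nonneg _) ?_
    have := neg_le_integral_mixed (c := m + e * tripleWeight h a b) (int (ξ := h + a) (by simp [hw]))
      (int (ξ := h + b) (by simp [hw])) (int (ξ := h + a + b) (by simp [hw])) (int hw)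
      (fun v => by
        have := hle (jump h w v) a b
        simp only [mixedDiff, tripleWeight, size_jump hw] at this
        simp only [add_assoc, jump_add_left hw, tripleWeight] at this ⊢
        linarith)
    linarith
  have e2 : 0 ≤ (a w : ℝ) * (m + (J (h + a) - g (h + a) - (J (h + a + b) - g (h + a + b)))) := by
    by_cases hw : a w = 0
    · simp [hw]
    refine mul_nonneg (Nat.cast_nonneg _) ?_
    have := neg_le_integral_mixed (c := m + e * tripleWeight h a b) (int (ξ := h + a) (by simp [hw]))
      (integrable_const (g (h + b))) (int (ξ := h + a + b) (by simp [hw])) (integrable_const (g h))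
      (fun v => by
        have := hle h (jump a w v) b
        simp only [mixedDiff, tripleWeight, size_jump hw] at this
        simp only [add_assoc, jump_add_left hw, jump_add_right hw, tripleWeight,
          jump_add_right (ξ := a + b) (w := w) (by simp [hw])] at this ⊢
        linarith)
    simp only [integral_const, probReal_univ, one_smul] at this
    linarith
  have e3 : 0 ≤ (b w : ℝ) * (m + (J (h + b) - g (h + b) - (J (h + a + b) - g (h + a + b)))) := by
    by_cases hw : b w = 0
    · simp [hw]
    refine mul_nonneg (Nat.cast_nonneg _) ?_
    have := neg_le_integral_mixed (c := m + e * tripleWeight h a b) (integrable_const (g (h + a)))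
      (int (ξ := h + b) (by simp [hw])) (int (ξ := h + a + b) (by simp [hw])) (integrable_const (g h))
      (fun v => by
        have := hle h a (jump b w v)
        simp only [mixedDiff, tripleWeight, size_jump hw] at this
        simp only [jump_add_right hw, tripleWeight] at this ⊢
        linarith)
    simp only [integral_const, probReal_univ, one_smul] at this
    linarith
  simp only [Finsupp.add_apply, Nat.cast_add]
  linarith

/-- Summation of the jump and branching estimates over sites. The factor `1 + size a * size b` in
`tripleWeight` is there to dominate the sites shared by `a` and `b`, since the sum of `a w * b w` is
at most `size a * size b`. -/
theorem neg_mixedDiff_gen_le {g : FinConfig d → ℝ} (hg : Controlled g) {m e : ℝ} (hm : 0 ≤ m)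
    (he : 0 ≤ e) (hle : ∀ h a b, -mixedDiff g h a b - e * tripleWeight h a b ≤ m)
    {h a b : FinConfig d} (hpos : 0 < -mixedDiff g h a b - e * tripleWeight h a b) :
    -mixedDiff (gen p γ g) h a b ≤
      (1 + 3 * γ / 2) * size (h + a + b) * m + e * (3 * γ * tripleWeight h a b) := by
  set W := (h + a + b).support with hW
  have sub : ∀ ξ : FinConfig d, ξ ≤ h + a + b → ξ.support ⊆ W := fun ξ hξ =>
    Finsupp.support_mono hξ
  have le1 : h + a ≤ h + a + b := le_self_add
  have le2 : h + b ≤ h + a + b := by rw [add_right_comm]; exact le_self_add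
  have le3 : h ≤ h + a + b := le_self_add.trans le1
  have le4 : a ≤ h + a + b := le_add_self.trans le1
  have le5 : b ≤ h + a + b := le_add_self
  rw [mixedDiff, gen_eq_sum g (sub _ le1), gen_eq_sum g (sub _ le2), gen_eq_sum g (sub _ le_rfl),
    gen_eq_sum g (sub _ le3), ← Finset.sum_add_distrib, ← Finset.sum_sub_distrib,
    ← Finset.sum_sub_distrib, ← Finset.sum_neg_distrib]
  have hγ : (0 : ℝ) ≤ γ / 2 := by positivity
  have sh := size_nonneg h
  have sa := size_nonneg a
  have sb := size_nonneg b
  have hterm : ∀ w ∈ W, -(((h + a) w : ℝ) * (∫ v, g (jump (h + a) w v) ∂p.toMeasure - g (h + a)) +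
        γ / 2 * branchAt g (h + a) w +
      (((h + b) w : ℝ) * (∫ v, g (jump (h + b) w v) ∂p.toMeasure - g (h + b)) +
        γ / 2 * branchAt g (h + b) w) -
      (((h + a + b) w : ℝ) * (∫ v, g (jump (h + a + b) w v) ∂p.toMeasure - g (h + a + b)) +
        γ / 2 * branchAt g (h + a + b) w) -
      ((h w : ℝ) * (∫ v, g (jump h w v) ∂p.toMeasure - g h) + γ / 2 * branchAt g h w)) ≤
      ((h + a + b) w : ℝ) * m + (γ / 2 * (3 * m) + γ / 2 * e * (2 * size b * a w +
        (2 * size a * b w + 2 * (1 + (size h + size a + size b)) * size a * b w))) := by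
    intro w _
    have h1 := neg_mixedDiff_jumpAt_le (p := p) hg hle hpos w
    have h2 := mul_le_mul_of_nonneg_left (neg_mixedDiff_branchAt_le hm he hle hpos w) hγ
    have haw : (a w : ℝ) ≤ size a := by
      rw [← sum_eq_size]
      by_cases ha : a w = 0
      · rw [ha, Nat.cast_zero]
        exact Finset.sum_nonneg fun _ _ => Nat.cast_nonneg _
      · exact Finset.single_le_sum (f := fun x => (a x : ℝ)) (fun _ _ => Nat.cast_nonneg _)
          (Finsupp.mem_support_iff.2 ha)
    have h3 : γ / 2 * e * (2 * (1 + (size h + size a + size b)) * (a w * b w)) ≤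
        γ / 2 * e * (2 * (1 + (size h + size a + size b)) * (size a * b w)) := by gcongr
    linarith
  refine (Finset.sum_le_sum hterm).trans ?_
  have hsum : ∀ ξ : FinConfig d, ξ ≤ h + a + b → ∑ w ∈ W, (ξ w : ℝ) = size ξ := by
    intro ξ hξ
    rw [← sum_eq_size]
    refine (Finset.sum_subset (sub ξ hξ) fun x _ hx => ?_).symm
    rw [Finsupp.notMem_support_iff.1 hx, Nat.cast_zero]
  simp only [Finset.sum_add_distrib, ← Finset.sum_mul, ← Finset.mul_sum, Finset.sum_const,
    nsmul_eq_mul]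
  rw [hsum _ le_rfl, hsum _ le4, hsum _ le5]
  have hcard : (W.card : ℝ) * (γ / 2 * (3 * m)) ≤ size (h + a + b) * (γ / 2 * (3 * m)) :=
    mul_le_mul_of_nonneg_right (card_support_le_size _) (by positivity)
  have hV : 2 * size b * size a + (2 * size a * size b +
      2 * (1 + (size h + size a + size b)) * size a * size b) ≤ 6 * tripleWeight h a b := by
    rw [tripleWeight]
    have h1 := mul_nonneg sa sb
    have h2 := mul_nonneg sh h1
    have h3 := mul_nonneg sa h1
    have h4 := mul_nonneg sb h1
    nlinarith
  have hV' := mul_le_mul_of_nonneg_left hV (mul_nonneg hγ he)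
  linarith

/-- Occupation-type functions stay submodular under the evolution of the finite systems. -/
theorem mixedDiff_prob_nonneg {A : Set (FinConfig d)}
    (hA : ∀ h a b, 0 ≤ mixedDiff (A.indicator 1) h a b) {t : ℝ} (ht : 0 ≤ t)
    (h a b : FinConfig d) : 0 ≤ mixedDiff (prob p γ A t) h a b := by
  have hV0 : ∀ h a b : FinConfig d, 1 + (size h + size a + size b) ≤ tripleWeight h a b := by
    intro h a b
    have sh := size_nonneg h
    have sa := size_nonneg a
    have sb := size_nonneg b
    rw [tripleWeight]
    nlinarith [mul_nonneg sa sb, mul_nonneg sh (mul_nonneg sa sb)]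
  have hVpos : 0 < tripleWeight h a b := by
    have := hV0 h a b
    linarith [size_nonneg h, size_nonneg a, size_nonneg b]
  -- The growth rate of the weight in `neg_mixedDiff_gen_le`, compensated by letting the penalty
  -- grow like `exp (c * s)`.
  set c := 3 * (γ : ℝ) with hc
  have hc0 : 0 ≤ c := by positivity
  refine le_of_forall_pos_le_add fun δ hδ => ?_
  set ε := δ / (Real.exp (c * t) * tripleWeight h a b) with hε
  have hε0 : 0 < ε := by positivity
  have hbound : ∀ s h a b, -mixedDiff (prob p γ A s) h a b ≤ 2 := by
    intro s h a b
    have h1 := prob_nonneg (p := p) (γ := γ) A s (h + a)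
    have h2 := prob_nonneg (p := p) (γ := γ) A s (h + b)
    have h3 := prob_le_one (p := p) (γ := γ) A s (h + a + b)
    have h4 := prob_le_one (p := p) (γ := γ) A s h
    rw [mixedDiff]
    linarith
  have key := nonpos_of_rightDeriv_le (I := FinConfig d × FinConfig d × FinConfig d)
    (u := fun s i => -mixedDiff (prob p γ A s) i.1 i.2.1 i.2.2 -
      ε * Real.exp (c * s) * tripleWeight i.1 i.2.1 i.2.2)
    (u' := fun s i => -mixedDiff (gen p γ (prob p γ A s)) i.1 i.2.1 i.2.2 -
      ε * (Real.exp (c * s) * c) * tripleWeight i.1 i.2.1 i.2.2)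
    (T := t) (C := 2) (L := (1 + 3 * γ / 2) * (2 / ε)) (by positivity)
    (fun s hs i => by
      have h1 := hbound s i.1 i.2.1 i.2.2
      have h2 : 0 ≤ tripleWeight i.1 i.2.1 i.2.2 := by
        have := hV0 i.1 i.2.1 i.2.2
        linarith [size_nonneg i.1, size_nonneg i.2.1, size_nonneg i.2.2]
      have h3 : 0 ≤ ε * Real.exp (c * s) * tripleWeight i.1 i.2.1 i.2.2 := by positivity
      linarith)
    (fun i => by
      have h1 := continuous_prob (p := p) (γ := γ) A (i.1 + i.2.1)
      have h2 := continuous_prob (p := p) (γ := γ) A (i.1 + i.2.2)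
      have h3 := continuous_prob (p := p) (γ := γ) A (i.1 + i.2.1 + i.2.2)
      have h4 := continuous_prob (p := p) (γ := γ) A i.1
      simp only [mixedDiff]
      exact Continuous.continuousOn (by fun_prop))
    (fun i s hs => by
      have h1 := hasDerivWithinAt_prob (p := p) (γ := γ) A (i.1 + i.2.1) hs.1
      have h2 := hasDerivWithinAt_prob (p := p) (γ := γ) A (i.1 + i.2.2) hs.1
      have h3 := hasDerivWithinAt_prob (p := p) (γ := γ) A (i.1 + i.2.1 + i.2.2) hs.1
      have h4 := hasDerivWithinAt_prob (p := p) (γ := γ) A i.1 hs.1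
      have h5 : HasDerivWithinAt (fun s : ℝ => Real.exp (c * s)) (Real.exp (c * s) * c)
          (Set.Ici s) s := by
        have := (((hasDerivAt_id' s).const_mul c).exp).hasDerivWithinAt (s := Set.Ici s)
        simpa using this
      exact ((((h1.add h2).sub h3).sub h4).neg).sub
        ((h5.const_mul ε).mul_const (tripleWeight i.1 i.2.1 i.2.2)))
    (fun i => by
      have h1 := hA i.1 i.2.1 i.2.2
      have h2 := hV0 i.1 i.2.1 i.2.2
      have h3 : 0 ≤ ε * tripleWeight i.1 i.2.1 i.2.2 := mul_nonneg hε0.le (by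
        linarith [size_nonneg i.1, size_nonneg i.2.1, size_nonneg i.2.2])
      have h4 : prob p γ A 0 = A.indicator 1 := funext fun ξ => prob_zero A ξ
      simp only [h4, mul_zero, Real.exp_zero, mul_one]
      linarith)
    (fun s hs m hm hle i hpos => by
      have he : 1 ≤ Real.exp (c * s) := Real.one_le_exp (mul_nonneg hc0 hs.1)
      have h1 := neg_mixedDiff_gen_le (p := p) (γ := γ) (controlled_prob A s) hm
        (by positivity : 0 ≤ ε * Real.exp (c * s))
        (fun h a b => hle (h, a, b)) (h := i.1) (a := i.2.1) (b := i.2.2) hpos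
      have h2 := hV0 i.1 i.2.1 i.2.2
      have h3 := hbound s i.1 i.2.1 i.2.2
      -- As mixed differences are at least `-2`, a positive penalised value forces the weight, and
      -- with it the total size, to be bounded.
      have h4 : size (i.1 + i.2.1 + i.2.2) ≤ 2 / ε := by
        rw [le_div_iff₀ hε0, size_add, size_add]
        have h5 : ε * 1 * (size i.1 + size i.2.1 + size i.2.2) ≤
            ε * Real.exp (c * s) * tripleWeight i.1 i.2.1 i.2.2 := by
          have := size_nonneg i.1
          have := size_nonneg i.2.1
          have := size_nonneg i.2.2
          gcongr
          linarith
        linarith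
      have h6 : (1 + 3 * γ / 2) * size (i.1 + i.2.1 + i.2.2) * m ≤
          (1 + 3 * γ / 2) * (2 / ε) * m := by gcongr
      linarith) t ⟨ht, le_rfl⟩ (h, a, b)
  have h7 : ε * Real.exp (c * t) * tripleWeight h a b = δ := by
    rw [hε]
    field_simp
  simp only [h7] at key
  linarith

end submodular

/-! ### The random walk in continuous time -/

section kern

theorem tsum_nStep (p : PMF (Site d)) (n : ℕ) : ∑' z, nStep p n z = 1 := by
  induction n with
  | zero => simp [nStep]
  | succ n ih =>
    simp only [nStep]
    rw [ENNReal.tsum_comm, ← p.tsum_coe]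
    refine tsum_congr fun y => ?_
    rw [ENNReal.tsum_mul_left, ← (Equiv.addRight y).tsum_eq]
    simp [ih]

theorem nStep_le_one (p : PMF (Site d)) (n : ℕ) (z : Site d) : nStep p n z ≤ 1 :=
  (ENNReal.le_tsum z).trans_eq (tsum_nStep p n)

/-- The transition probabilities of the walk in continuous time with jump rate `1`, started at
the origin. -/
def kern (p : PMF (Site d)) (t : ℝ) (z : Site d) : ℝ :=
  Real.exp (-t) * ∑' n : ℕ, t ^ n / n.factorial * (nStep p n z).toReal

variable {p : PMF (Site d)}

theorem abs_toReal_nStep_le (n : ℕ) (z : Site d) : |(nStep p n z).toReal| ≤ 1 := by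
  rw [abs_of_nonneg ENNReal.toReal_nonneg]
  exact ENNReal.toReal_le_of_le_ofReal zero_le_one (by simpa using nStep_le_one p n z)

theorem summable_pow_div_factorial_mul (t : ℝ) {c : ℕ → ℝ} (hc : ∀ n, |c n| ≤ 1) :
    Summable fun n : ℕ => t ^ n / n.factorial * c n := by
  refine Summable.of_norm_bounded (Real.summable_pow_div_factorial |t|) fun n => ?_
  rw [norm_mul, norm_div, norm_pow, Real.norm_eq_abs, Real.norm_natCast]
  exact mul_le_of_le_one_right (by positivity) (hc n)

/-- Termwise differentiation, dominated by the exponential series on the interval of radius `|t| +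
1`. Differentiation shifts the coefficients by one. -/
theorem hasDerivAt_tsum_pow_div_factorial {c : ℕ → ℝ} (hc : ∀ n, |c n| ≤ 1) (t : ℝ) :
    HasDerivAt (fun t : ℝ => ∑' n : ℕ, t ^ n / n.factorial * c n)
      (∑' n : ℕ, t ^ n / n.factorial * c (n + 1)) t := by
  set R := |t| + 1
  have hstep : ∀ n : ℕ, ∀ s : ℝ, ((n + 1 : ℕ) : ℝ) * s ^ n / (n + 1).factorial =
      s ^ n / n.factorial := by
    intro n s
    have h1 : ((n + 1).factorial : ℝ) = ((n + 1 : ℕ) : ℝ) * n.factorial := by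
      rw [Nat.factorial_succ]; push_cast; ring
    have h2 : (n.factorial : ℝ) ≠ 0 := by positivity
    have h3 : ((n + 1 : ℕ) : ℝ) ≠ 0 := by positivity
    rw [h1, mul_div_mul_left _ _ h3]
  have h := hasDerivAt_tsum_of_isPreconnected (u := fun n : ℕ => n * R ^ (n - 1) / n.factorial)
    (g := fun (n : ℕ) (s : ℝ) => s ^ n / n.factorial * c n)
    (g' := fun (n : ℕ) (s : ℝ) => n * s ^ (n - 1) / n.factorial * c n)
    (t := Set.Ioo (-R) R) (y₀ := 0) (y := t) ?_ isOpen_Ioo isPreconnected_Ioo ?_ ?_ ?_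
    (summable_pow_div_factorial_mul 0 hc) ?_
  · refine h.congr_deriv ?_
    have hs : Summable fun n : ℕ => (n : ℝ) * t ^ (n - 1) / n.factorial * c n := by
      rw [← summable_nat_add_iff 1]
      refine (summable_pow_div_factorial_mul t fun n => hc (n + 1)).congr fun n => ?_
      rw [← hstep, Nat.add_sub_cancel]
    rw [hs.tsum_eq_zero_add]
    simp only [Nat.cast_zero, zero_mul, zero_div, zero_add]
    refine tsum_congr fun n => ?_
    rw [← hstep, Nat.add_sub_cancel]
  · rw [← summable_nat_add_iff 1]
    refine (Real.summable_pow_div_factorial R).congr fun n => ?_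
    rw [← hstep, Nat.add_sub_cancel]
  · intro n s _
    exact ((hasDerivAt_pow n s).div_const _).mul_const _
  · intro n s hs
    have hsR : |s| ≤ R := abs_le.2 ⟨hs.1.le, hs.2.le⟩
    rw [norm_mul, norm_div, norm_mul, norm_pow, Real.norm_natCast, Real.norm_natCast,
      Real.norm_eq_abs, Real.norm_eq_abs]
    refine (mul_le_of_le_one_right (by positivity) (hc n)).trans ?_
    gcongr
  · exact ⟨by simp only [R]; linarith [abs_nonneg t], by simp only [R]; linarith [abs_nonneg t]⟩
  · exact ⟨by simp only [R]; linarith [neg_abs_le t], by simp only [R]; linarith [le_abs_self t]⟩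

theorem integral_toReal_nStep (n : ℕ) (z : Site d) :
    ∫ v, (nStep p n (z - v)).toReal ∂p.toMeasure = (nStep p (n + 1) z).toReal := by
  rw [integral_toReal (measurable_of_countable _).aemeasurable
    (Eventually.of_forall fun v => (nStep_le_one p n _).trans_lt ENNReal.one_lt_top),
    lintegral_countable', nStep]
  congr 1
  refine tsum_congr fun v => ?_
  rw [PMF.toMeasure_apply_singleton _ _ (measurableSet_singleton v), mul_comm]

theorem integral_kern (t : ℝ) (z : Site d) : ∫ v, kern p t (z - v) ∂p.toMeasure =
    Real.exp (-t) * ∑' n : ℕ, t ^ n / n.factorial * (nStep p (n + 1) z).toReal := by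
  simp only [kern]
  rw [integral_const_mul]
  congr 1
  have hint : ∀ n : ℕ, Integrable
      (fun v => t ^ n / n.factorial * (nStep p n (z - v)).toReal) p.toMeasure := fun n =>
    Integrable.of_bound (C := |t ^ n / n.factorial|) (measurable_of_countable _).aestronglyMeasurable
      (Eventually.of_forall fun v => by
        rw [norm_mul]
        exact mul_le_of_le_one_right (abs_nonneg _) (abs_toReal_nStep_le n _))
  rw [← integral_tsum_of_summable_integral_norm hint]
  · simp_rw [integral_const_mul, integral_toReal_nStep]
  · refine Summable.of_nonneg_of_le (fun n => integral_nonneg fun v => norm_nonneg _) (fun n => ?_)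
      (Real.summable_pow_div_factorial |t|)
    have := integral_mono (μ := p.toMeasure) (hint n).norm (integrable_const (|t| ^ n / n.factorial))
      (fun v => by
        dsimp only
        rw [norm_mul, norm_div, norm_pow, Real.norm_eq_abs, Real.norm_natCast]
        exact mul_le_of_le_one_right (by positivity) (abs_toReal_nStep_le n _))
    simpa using this

theorem hasDerivAt_kern (t : ℝ) (z : Site d) : HasDerivAt (fun t => kern p t z)
    (∫ v, kern p t (z - v) ∂p.toMeasure - kern p t z) t := by
  have h1 : HasDerivAt (fun t : ℝ => Real.exp (-t)) (-Real.exp (-t)) t := by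
    have := (hasDerivAt_id' t).fun_neg.exp
    simpa using this
  have h2 := h1.mul (hasDerivAt_tsum_pow_div_factorial
    (c := fun n => (nStep p n z).toReal) (fun n => abs_toReal_nStep_le n z) t)
  refine h2.congr_deriv ?_
  rw [integral_kern, kern]
  ring

theorem continuous_kern (z : Site d) : Continuous fun t => kern p t z :=
  continuous_iff_continuousAt.2 fun t => (hasDerivAt_kern t z).continuousAt

theorem continuous_kern_sq (z : Site d) : Continuous fun t => kern p t z ^ 2 := by
  have := continuous_kern (p := p) z
  fun_prop

theorem kern_nonneg {t : ℝ} (ht : 0 ≤ t) (z : Site d) : 0 ≤ kern p t z :=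
  mul_nonneg (Real.exp_nonneg _) (tsum_nonneg fun _ => by positivity)

theorem kern_zero (z : Site d) : kern p 0 z = if z = 0 then 1 else 0 := by
  rw [kern, tsum_eq_single 0 fun n hn => by simp [hn]]
  simp only [nStep]
  split_ifs <;> simp

theorem ofReal_kern {t : ℝ} (ht : 0 ≤ t) (z : Site d) : ENNReal.ofReal (kern p t z) =
    ENNReal.ofReal (Real.exp (-t)) * ∑' n : ℕ, ENNReal.ofReal (t ^ n / n.factorial) *
      nStep p n z := by
  rw [kern, ENNReal.ofReal_mul (Real.exp_nonneg _), ENNReal.ofReal_tsum_of_nonneg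
    (fun n => by positivity)
    (summable_pow_div_factorial_mul t fun n => abs_toReal_nStep_le n z)]
  congr 1
  refine tsum_congr fun n => ?_
  rw [ENNReal.ofReal_mul (by positivity),
    ENNReal.ofReal_toReal ((nStep_le_one p n z).trans_lt ENNReal.one_lt_top).ne]

theorem tsum_ofReal_kern {t : ℝ} (ht : 0 ≤ t) : ∑' z, ENNReal.ofReal (kern p t z) = 1 := by
  simp_rw [ofReal_kern ht]
  rw [ENNReal.tsum_mul_left, ENNReal.tsum_comm]
  simp_rw [ENNReal.tsum_mul_left, tsum_nStep, mul_one]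
  rw [← ENNReal.ofReal_tsum_of_nonneg (fun n => by positivity) (Real.summable_pow_div_factorial t),
    ← ENNReal.ofReal_mul (Real.exp_nonneg _)]
  have : ∑' n : ℕ, t ^ n / n.factorial = Real.exp t := by
    rw [Real.exp_eq_exp_ℝ, NormedSpace.exp_eq_tsum_div]
  rw [this, ← Real.exp_add]
  simp

theorem sum_kern_le_one {t : ℝ} (ht : 0 ≤ t) (s : Finset (Site d)) : ∑ z ∈ s, kern p t z ≤ 1 := by
  rw [← ENNReal.ofReal_le_ofReal_iff zero_le_one,
    ENNReal.ofReal_sum_of_nonneg fun z _ => kern_nonneg ht z, ENNReal.ofReal_one,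
    ← tsum_ofReal_kern (p := p) ht]
  exact ENNReal.sum_le_tsum s

theorem kern_le_one {t : ℝ} (ht : 0 ≤ t) (z : Site d) : kern p t z ≤ 1 := by
  simpa using sum_kern_le_one (p := p) ht {z}

theorem kern_pos {t : ℝ} (ht : 0 < t) {z : Site d} {n : ℕ} (hz : nStep p n z ≠ 0) :
    0 < kern p t z := by
  refine mul_pos (Real.exp_pos _) (lt_of_lt_of_le ?_
    ((summable_pow_div_factorial_mul t fun n => abs_toReal_nStep_le (p := p) n z).le_tsum n
      fun m _ => by positivity))
  have : 0 < (nStep p n z).toReal :=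
    ENNReal.toReal_pos hz ((nStep_le_one p n z).trans_lt ENNReal.one_lt_top).ne
  positivity

/-- In dimension at least `1` an irreducible walk is not concentrated at any point at time `1`. -/
theorem exists_kern_one_le (hd : 1 ≤ d) (hirr : IsIrreducible (p : Site d → ℝ≥0∞)) :
    ∃ α < 1, ∀ z, kern p 1 z ≤ α := by
  -- Any nonzero site would do. Since both `0` and `z₀` carry mass at time `1`, each site leaves out
  -- at least one of these two masses.
  set z₀ : Site d := fun _ => 1 with hz₀
  have hne : z₀ ≠ 0 := fun h => by
    have := congrFun h ⟨0, hd⟩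
    simp [hz₀] at this
  obtain ⟨n, hn⟩ := hirr z₀
  have h0 : 0 < kern p 1 (0 : Site d) := kern_pos one_pos (n := 0) (by simp [nStep])
  have h1 : 0 < kern p 1 z₀ := kern_pos one_pos hn.ne'
  refine ⟨1 - min (kern p 1 0) (kern p 1 z₀), by linarith [lt_min h0 h1], fun z => ?_⟩
  by_cases hz : z = 0
  · have := sum_kern_le_one (p := p) zero_le_one {0, z₀}
    rw [Finset.sum_pair hne.symm] at this
    subst hz
    linarith [min_le_right (kern p 1 0) (kern p 1 z₀)]
  · have := sum_kern_le_one (p := p) zero_le_one {0, z}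
    rw [Finset.sum_pair (Ne.symm hz)] at this
    linarith [min_le_left (kern p 1 0) (kern p 1 z₀)]

end kern

/-! ### Recurrence of the symmetrised walk -/

section recurrence

/-- With `G x` the expected number of visits to `0` from `x`, hitting `0` from `y` yields at least
the hitting probability times `G 0`. Certain return then gives `1 + G 0 ≤ G 0`. -/
theorem tsum_nStep_zero_eq_top {q : Site d → ℝ≥0∞} (hrec : IsRecurrent q) :
    ∑' n, nStep q n 0 = ∞ := by
  set G : Site d → ℝ≥0∞ := fun x => ∑' n, nStep q n (-x) with hG
  have hG1 : ∀ x, G x = (if x = 0 then 1 else 0) + ∑' y, q y * G (x + y) := by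
    intro x
    simp only [hG]
    rw [tsum_eq_zero_add' ENNReal.summable]
    simp only [nStep, neg_eq_zero]
    rw [ENNReal.tsum_comm]
    simp_rw [ENNReal.tsum_mul_left, neg_add, sub_eq_add_neg]
  have hle : ∀ n x, hitWithin q n x * G 0 ≤ G x := by
    intro n
    induction n with
    | zero =>
      intro x
      simp only [hitWithin]
      split_ifs with h
      · rw [h, one_mul]
      · simp
    | succ n ih =>
      intro x
      simp only [hitWithin]
      split_ifs with h
      · rw [h, one_mul]
      · rw [hG1 x, if_neg h, zero_add, ← ENNReal.tsum_mul_right]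
        refine ENNReal.tsum_le_tsum fun y => ?_
        rw [mul_assoc]
        gcongr
        exact ih _
  have h0 : 1 + G 0 ≤ G 0 := by
    conv_rhs => rw [hG1 0]
    simp only [if_true, zero_add]
    gcongr
    calc G 0 = (∑' y, q y * ⨆ n, hitWithin q n y) * G 0 := by rw [hrec, one_mul]
      _ = ∑' y, q y * ⨆ n, hitWithin q n y * G 0 := by
        rw [← ENNReal.tsum_mul_right]
        refine tsum_congr fun y => ?_
        rw [mul_assoc, ENNReal.iSup_mul]
      _ ≤ _ := ENNReal.tsum_le_tsum fun y => by
        gcongr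
        exact iSup_le fun n => hle n y
  by_contra h
  have hfin : G 0 ≠ ∞ := by simpa [hG] using h
  rw [add_comm] at h0
  have h1 : G 0 + 1 ≤ G 0 + 0 := by simpa using h0
  have := (ENNReal.add_le_add_iff_left hfin).1 h1
  simp at this

/-- The law of the difference of two independent walks after `n` and `m` steps. -/
def diffStep (q : Site d → ℝ≥0∞) (n m : ℕ) (z : Site d) : ℝ≥0∞ :=
  ∑' v, nStep q n v * nStep q m (v - z)

theorem diffStep_succ_left (q : Site d → ℝ≥0∞) (n m : ℕ) (z : Site d) :
    diffStep q (n + 1) m z = ∑' y, q y * diffStep q n m (z - y) := by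
  simp only [diffStep, nStep, ← ENNReal.tsum_mul_right, ← ENNReal.tsum_mul_left]
  rw [ENNReal.tsum_comm]
  refine tsum_congr fun y => ?_
  rw [← (Equiv.addRight y).tsum_eq]
  refine tsum_congr fun v => ?_
  rw [Equiv.coe_addRight, add_sub_cancel_right, mul_assoc, sub_sub_eq_add_sub]

theorem diffStep_succ_right (q : Site d → ℝ≥0∞) (n m : ℕ) (z : Site d) :
    diffStep q n (m + 1) z = ∑' y, q (-y) * diffStep q n m (z - y) := by
  simp only [diffStep, nStep, ← ENNReal.tsum_mul_left]
  rw [ENNReal.tsum_comm, ← (Equiv.neg (Site d)).tsum_eq]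
  refine tsum_congr fun y => tsum_congr fun v => ?_
  rw [Equiv.neg_apply, mul_left_comm, show v - z - -y = v - (z - y) by abel]

/-- Each step of the symmetrised walk is, with equal probability, a step of the first walk or a
reversed step of the second. Grouping by the number of each gives binomial coefficients, and
Pascal's rule drives the induction. -/
theorem nStep_symmetrised (q : Site d → ℝ≥0∞) (N : ℕ) (z : Site d) :
    2 ^ N * nStep (symmetrised q) N z =
      ∑ ij ∈ Finset.HasAntidiagonal.antidiagonal N, (N.choose ij.1 : ℝ≥0∞) * diffStep q ij.1 ij.2 z := by
  induction N generalizing z with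
  | zero =>
    simp only [pow_zero, one_mul, Finset.HasAntidiagonal.antidiagonal_zero, Finset.sum_singleton, diffStep, nStep,
      Nat.choose_self, Nat.cast_one]
    rw [tsum_eq_single 0 fun v hv => by simp [hv]]
    simp
  | succ N ih =>
    rw [Finset.sum_antidiagonal_choose_succ_mul (fun i j => diffStep q i j z)]
    have hsymm : ∀ y, 2 * symmetrised q y = q (-y) + q y := fun y => by
      rw [symmetrised, ENNReal.mul_div_cancel two_ne_zero ENNReal.ofNat_ne_top, add_comm]
    have h1 : 2 ^ (N + 1) * nStep (symmetrised q) (N + 1) z =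
        ∑' y, (q (-y) + q y) * (2 ^ N * nStep (symmetrised q) N (z - y)) := by
      rw [nStep, ← ENNReal.tsum_mul_left]
      refine tsum_congr fun y => ?_
      rw [← hsymm, pow_succ]
      ring
    rw [h1]
    simp_rw [ih, add_mul, Finset.mul_sum]
    rw [ENNReal.tsum_add]
    congr 1
    · rw [Summable.tsum_finsetSum fun _ _ => ENNReal.summable]
      refine Finset.sum_congr rfl fun ij _ => ?_
      rw [diffStep_succ_right, ← ENNReal.tsum_mul_left]
      exact tsum_congr fun y => mul_left_comm _ _ _
    · rw [Summable.tsum_finsetSum fun _ _ => ENNReal.summable]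
      refine Finset.sum_congr rfl fun ij hij => ?_
      rw [diffStep_succ_left, ← ENNReal.tsum_mul_left]
      rw [Finset.HasAntidiagonal.mem_antidiagonal] at hij
      rw [Nat.choose_symm_of_eq_add hij.symm]
      exact tsum_congr fun y => mul_left_comm _ _ _

variable {p : PMF (Site d)}

/-- Two independent walks meet at time `r` exactly when their difference, a symmetrised walk with
jump rate `2`, is at `0`. -/
theorem tsum_ofReal_kern_sq {r : ℝ} (hr : 0 ≤ r) : ∑' v, ENNReal.ofReal (kern p r v ^ 2) =
    ∑' N : ℕ, ENNReal.ofReal (Real.exp (-(2 * r)) * ((2 * r) ^ N / N.factorial)) *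
      nStep (symmetrised p) N 0 := by
  have h1 : ∀ v, ENNReal.ofReal (kern p r v ^ 2) = ENNReal.ofReal (Real.exp (-(2 * r))) *
      ∑' n : ℕ, ∑' m : ℕ, (ENNReal.ofReal (r ^ n / n.factorial) *
        ENNReal.ofReal (r ^ m / m.factorial)) * (nStep p n v * nStep p m (v - 0)) := by
    intro v
    rw [pow_two, ENNReal.ofReal_mul (kern_nonneg hr v), ofReal_kern hr, mul_mul_mul_comm,
      ← ENNReal.ofReal_mul (Real.exp_nonneg _), ← Real.exp_add, ← ENNReal.tsum_mul_right]
    congr 2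
    · congr 1
      ring_nf
    · ext n
      rw [← ENNReal.tsum_mul_left]
      refine tsum_congr fun m => ?_
      rw [sub_zero]
      ring
  simp_rw [h1]
  rw [ENNReal.tsum_mul_left, ENNReal.tsum_comm]
  have h2 : ∑' n : ℕ, ∑' (v : Site d), ∑' m : ℕ, (ENNReal.ofReal (r ^ n / n.factorial) *
        ENNReal.ofReal (r ^ m / m.factorial)) * (nStep p n v * nStep p m (v - 0)) =
      ∑' x : ℕ × ℕ, (ENNReal.ofReal (r ^ x.1 / x.1.factorial) *
        ENNReal.ofReal (r ^ x.2 / x.2.factorial)) * diffStep p x.1 x.2 0 := by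
    rw [ENNReal.tsum_prod']
    refine tsum_congr fun n => ?_
    rw [ENNReal.tsum_comm]
    refine tsum_congr fun m => ?_
    rw [diffStep, ENNReal.tsum_mul_left]
  rw [h2, ← Finset.HasAntidiagonal.sigmaAntidiagonalEquivProd.tsum_eq, ENNReal.tsum_sigma', ← ENNReal.tsum_mul_left]
  refine tsum_congr fun N => ?_
  rw [ENNReal.ofReal_mul (Real.exp_nonneg _), mul_assoc]
  congr 1
  rw [tsum_fintype, mul_pow, mul_div_assoc, ENNReal.ofReal_mul (by positivity),
    ENNReal.ofReal_pow zero_le_two, ENNReal.ofReal_ofNat, mul_comm (2 ^ N), mul_assoc,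
    nStep_symmetrised, Finset.mul_sum]
  rw [← Finset.sum_coe_sort (Finset.HasAntidiagonal.antidiagonal N)]
  refine Finset.sum_congr rfl fun x _ => ?_
  obtain ⟨⟨i, j⟩, hij⟩ := x
  rw [Finset.HasAntidiagonal.mem_antidiagonal] at hij
  simp only [Finset.HasAntidiagonal.sigmaAntidiagonalEquivProd_apply]
  rw [← mul_assoc]
  congr 1
  rw [← ENNReal.ofReal_mul (by positivity), ← ENNReal.ofReal_natCast,
    ← ENNReal.ofReal_mul (by positivity)]
  congr 1
  simp only at hij
  subst hij
  have h3 := Nat.add_choose_mul_factorial_mul_factorial i j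
  rw [← Nat.choose_symm_add] at h3
  have h4 : ((i + j).choose i : ℝ) * i.factorial * j.factorial = (i + j).factorial := by
    exact_mod_cast h3
  rw [← h4, pow_add]
  have : (i.factorial : ℝ) ≠ 0 := by positivity
  have : (j.factorial : ℝ) ≠ 0 := by positivity
  have : ((i + j).choose i : ℝ) ≠ 0 := by
    have := Nat.choose_pos (Nat.le_add_right i j)
    positivity
  field_simp

/-- The mean holding time of a walk with rate `2`, independent of the number `N` of steps made; a
Gamma integral. -/
theorem lintegral_exp_mul_pow (N : ℕ) : ∫⁻ r in Set.Ioi (0 : ℝ),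
    ENNReal.ofReal (Real.exp (-(2 * r)) * ((2 * r) ^ N / N.factorial)) = ENNReal.ofReal (1 / 2) := by
  have h1 := Real.integral_rpow_mul_exp_neg_mul_Ioi (a := N + 1) (r := 2) (by positivity) two_pos
  have h2 : ∫ r in Set.Ioi (0 : ℝ), Real.exp (-(2 * r)) * ((2 * r) ^ N / N.factorial) = 1 / 2 := by
    have h3 : ∀ r : ℝ, Real.exp (-(2 * r)) * ((2 * r) ^ N / N.factorial) =
        (2 ^ N / N.factorial) * (r ^ ((N : ℝ) + 1 - 1) * Real.exp (-(2 * r))) := fun r => by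
      rw [add_sub_cancel_right, Real.rpow_natCast, mul_pow]
      ring
    simp_rw [h3]
    rw [integral_const_mul, h1, Real.Gamma_nat_eq_factorial]
    have h4 : ((1 : ℝ) / 2) ^ ((N : ℝ) + 1) = 1 / 2 ^ (N + 1) := by
      rw [← Nat.cast_succ, Real.rpow_natCast, div_pow, one_pow]
    rw [h4]
    have : (N.factorial : ℝ) ≠ 0 := by positivity
    field_simp
    ring
  rw [← h2, ofReal_integral_eq_lintegral_ofReal]
  · by_contra h
    rw [integral_undef h] at h2
    norm_num at h2
  · exact (ae_restrict_iff' measurableSet_Ioi).2 (Eventually.of_forall fun r hr => by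
      have : (0 : ℝ) < r := hr
      positivity)

/-- The expected time that two independent walks spend together is infinite. -/
theorem lintegral_kern_sq_eq_top (hrec : IsRecurrent (symmetrised (p : Site d → ℝ≥0∞))) :
    ∑' v, ∫⁻ r in Set.Ioi (0 : ℝ), ENNReal.ofReal (kern p r v ^ 2) = ∞ := by
  rw [← lintegral_tsum fun v => (continuous_kern_sq v).measurable.ennreal_ofReal.aemeasurable,
    setLIntegral_congr_fun measurableSet_Ioi fun r (hr : (0 : ℝ) < r) => tsum_ofReal_kern_sq hr.le,
    lintegral_tsum fun N => Measurable.aemeasurable (by fun_prop)]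
  have h1 : ∀ N : ℕ, ∫⁻ r in Set.Ioi (0 : ℝ), ENNReal.ofReal (Real.exp (-(2 * r)) *
      ((2 * r) ^ N / N.factorial)) * nStep (symmetrised p) N 0 =
      ENNReal.ofReal (1 / 2) * nStep (symmetrised p) N 0 := fun N => by
    rw [lintegral_mul_const _ (by fun_prop), lintegral_exp_mul_pow]
  simp_rw [h1]
  rw [ENNReal.tsum_mul_left, tsum_nStep_zero_eq_top hrec, ENNReal.mul_top (by simp)]

/-- The time that two independent walks spend together has unbounded truncated means. -/
theorem exists_lt_sum_lintegral_kern_sq (hrec : IsRecurrent (symmetrised (p : Site d → ℝ≥0∞)))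
    (C : ℝ) : ∃ (D : Finset (Site d)) (T : ℝ), 0 ≤ T ∧
      C < ∑ v ∈ D, ∫ r in (0 : ℝ)..T, kern p r v ^ 2 := by
  by_contra hcon
  push Not at hcon
  have h1 : ∀ D : Finset (Site d), ∑ v ∈ D, ∫⁻ r in Set.Ioi (0 : ℝ),
      ENNReal.ofReal (kern p r v ^ 2) ≤ ENNReal.ofReal C := by
    intro D
    have h2 : ∀ v : Site d, ∫⁻ r in Set.Ioi (0 : ℝ), ENNReal.ofReal (kern p r v ^ 2) =
        ⨆ n : ℕ, ENNReal.ofReal (∫ r in (0 : ℝ)..n, kern p r v ^ 2) := by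
      intro v
      have h3 : Set.Ioi (0 : ℝ) = ⋃ n : ℕ, Set.Ioc (0 : ℝ) n := by
        ext r
        simp only [Set.mem_Ioi, Set.mem_iUnion, Set.mem_Ioc]
        exact ⟨fun h => ⟨⌈r⌉₊, h, Nat.le_ceil r⟩, fun ⟨n, h⟩ => h.1⟩
      have h4 : Monotone fun n : ℕ => Set.Ioc (0 : ℝ) n := fun m n h =>
        Set.Ioc_subset_Ioc_right (by exact_mod_cast h)
      rw [h3, setLIntegral_iUnion_of_directed _ h4.directed_le]
      congr 1
      ext n
      rw [intervalIntegral.integral_of_le (Nat.cast_nonneg n), ofReal_integral_eq_lintegral_ofReal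
        ((continuous_kern_sq v).integrableOn_Ioc)
        (Eventually.of_forall fun r => sq_nonneg _)]
    simp_rw [h2]
    rw [ENNReal.finsetSum_iSup_of_monotone]
    · refine iSup_le fun n => ?_
      rw [← ENNReal.ofReal_sum_of_nonneg fun v _ =>
        intervalIntegral.integral_nonneg (Nat.cast_nonneg n) fun r _ => sq_nonneg _]
      exact ENNReal.ofReal_le_ofReal (hcon D n (Nat.cast_nonneg n))
    · intro v m n h
      refine ENNReal.ofReal_le_ofReal ?_
      have hm : (m : ℝ) ≤ n := by exact_mod_cast h
      exact intervalIntegral.integral_mono_interval le_rfl (Nat.cast_nonneg m) hm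
        (Eventually.of_forall fun r => sq_nonneg _)
        ((continuous_kern_sq v).intervalIntegrable _ _)
  have h5 := lintegral_kern_sq_eq_top hrec
  rw [ENNReal.tsum_eq_iSup_sum] at h5
  have h6 := iSup_le h1
  rw [h5] at h6
  exact ENNReal.ofReal_ne_top (top_le_iff.1 h6)

end recurrence

/-! ### Solutions of the backward equation with a source -/

section forced
variable {p : PMF (Site d)} {γ : ℝ≥0}

/-- `u` solves the backward equation with the source term `σ`. -/
structure Forced (p : PMF (Site d)) (γ : ℝ≥0) (u σ : ℝ → FinConfig d → ℝ) : Prop where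
  controlled : ∀ t, 0 ≤ t → Controlled (u t)
  continuous : ∀ ξ, Continuous fun t => u t ξ
  hasDeriv : ∀ ξ t, 0 ≤ t →
    HasDerivWithinAt (fun t => u t ξ) (gen p γ (u t) ξ + σ t ξ) (Set.Ici t) t

namespace Forced
variable {u w σ τ : ℝ → FinConfig d → ℝ}

theorem add (hu : Forced p γ u σ) (hw : Forced p γ w τ) :
    Forced p γ (fun t ξ => u t ξ + w t ξ) fun t ξ => σ t ξ + τ t ξ where
  controlled t ht := (hu.controlled t ht).add (hw.controlled t ht)
  continuous ξ := (hu.continuous ξ).add (hw.continuous ξ)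
  hasDeriv ξ t ht := by
    rw [gen_add (hu.controlled t ht) (hw.controlled t ht)]
    exact ((hu.hasDeriv ξ t ht).add (hw.hasDeriv ξ t ht)).congr_deriv (by ring)

theorem mul_fun (hu : Forced p γ u σ) {c c' : ℝ → ℝ} (hc : Continuous c)
    (hc' : ∀ t, 0 ≤ t → HasDerivWithinAt c (c' t) (Set.Ici t) t) :
    Forced p γ (fun t ξ => c t * u t ξ) fun t ξ => c' t * u t ξ + c t * σ t ξ where
  controlled t ht := (hu.controlled t ht).const_mul (c t)
  continuous ξ := hc.mul (hu.continuous ξ)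
  hasDeriv ξ t ht := by
    rw [gen_const_mul]
    exact ((hc' t ht).mul (hu.hasDeriv ξ t ht)).congr_deriv (by ring)

theorem const_mul (hu : Forced p γ u σ) (c : ℝ) :
    Forced p γ (fun t ξ => c * u t ξ) fun t ξ => c * σ t ξ := by
  simpa using hu.mul_fun (c := fun _ => c) (c' := fun _ => 0) continuous_const
    fun t _ => hasDerivWithinAt_const t _ c

theorem sub (hu : Forced p γ u σ) (hw : Forced p γ w τ) :
    Forced p γ (fun t ξ => u t ξ - w t ξ) fun t ξ => σ t ξ - τ t ξ := by
  simpa [sub_eq_add_neg] using hu.add (hw.const_mul (-1))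

theorem const (c : ℝ) : Forced p γ (fun _ _ => c) fun _ _ => 0 where
  controlled _ _ := controlled_const c
  continuous _ := continuous_const
  hasDeriv ξ t _ := by
    rw [gen_const, add_zero]
    exact hasDerivWithinAt_const t _ c

theorem sum {ι : Type*} {s : Finset ι} {u σ : ι → ℝ → FinConfig d → ℝ}
    (hu : ∀ i ∈ s, Forced p γ (u i) (σ i)) :
    Forced p γ (fun t ξ => ∑ i ∈ s, u i t ξ) fun t ξ => ∑ i ∈ s, σ i t ξ := by
  classical
  induction s using Finset.induction_on with
  | empty => simpa using const (p := p) (γ := γ) 0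
  | insert i s hi ih =>
    simp_rw [Finset.sum_insert hi]
    exact (hu i (Finset.mem_insert_self _ _)).add
      (ih fun j hj => hu j (Finset.mem_insert_of_mem hj))

theorem prob (A : Set (FinConfig d)) : Forced p γ (prob p γ A) fun _ _ => 0 where
  controlled t _ := controlled_prob A t
  continuous ξ := continuous_prob A ξ
  hasDeriv ξ t ht := by
    rw [add_zero]
    exact hasDerivWithinAt_prob A ξ ht

theorem size : Forced p γ (fun _ => size) fun _ _ => 0 where
  controlled _ _ := controlled_size
  continuous _ := continuous_const
  hasDeriv ξ t _ := by
    rw [gen_size, add_zero]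
    exact hasDerivWithinAt_const t _ _

theorem shift (hu : Forced p γ u σ) {h : ℝ} (hh : 0 ≤ h) :
    Forced p γ (fun t => u (h + t)) fun t => σ (h + t) where
  controlled t ht := hu.controlled _ (add_nonneg hh ht)
  continuous ξ := (hu.continuous ξ).comp (continuous_const_add h)
  hasDeriv ξ t ht := by
    have h1 := hu.hasDeriv ξ (h + t) (add_nonneg hh ht)
    have h2 : HasDerivWithinAt (fun t => h + t) 1 (Set.Ici t) t :=
      ((hasDerivAt_id' t).const_add h).hasDerivWithinAt
    have h3 := h1.scomp_of_eq t h2 (fun s hs => by simpa using hs) rfl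
    rw [one_smul] at h3
    exact h3

/-- Maximum principle. -/
theorem nonpos (hu : Forced p γ u σ) {T C : ℝ} (hC : ∀ t ∈ Set.Icc 0 T, ∀ ξ, u t ξ ≤ C)
    (h0 : ∀ ξ, u 0 ξ ≤ 0) (hσ : ∀ t, 0 ≤ t → ∀ ξ, σ t ξ ≤ 0) (hT : 0 ≤ T) (ξ : FinConfig d) :
    u T ξ ≤ 0 :=
  nonpos_of_le_gen (p := p) (γ := γ) hC (fun t ht => hu.controlled t ht.1)
    (fun ξ => (hu.continuous ξ).continuousOn) (fun ξ t ht => hu.hasDeriv ξ t ht.1) h0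
    (fun ξ t ht => by linarith [hσ t ht.1 ξ]) T ⟨hT, le_rfl⟩ ξ

end Forced
end forced

/-! ### Linear functions of the configuration -/

section linear
variable {p : PMF (Site d)} {γ : ℝ≥0}

/-- The sum of `f` over all particles of `ξ`. -/
def lin (f : Site d → ℝ) (ξ : FinConfig d) : ℝ := ξ.sum fun z n => n * f z

@[simp] theorem lin_zero (f : Site d → ℝ) : lin f 0 = 0 := Finsupp.sum_zero_index

theorem lin_add (f : Site d → ℝ) (ξ ζ : FinConfig d) : lin f (ξ + ζ) = lin f ξ + lin f ζ :=
  Finsupp.sum_add_index' (by simp) (by intros; push_cast; ring)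

@[simp] theorem lin_single (f : Site d → ℝ) (z : Site d) : lin f (Finsupp.single z 1) = f z := by
  rw [lin, Finsupp.sum_single_index] <;> simp

theorem lin_eq_sum (f : Site d → ℝ) (ξ : FinConfig d) : lin f ξ = ∑ z ∈ ξ.support, ξ z * f z := rfl

theorem lin_nonneg {f : Site d → ℝ} (hf : ∀ z, 0 ≤ f z) (ξ : FinConfig d) : 0 ≤ lin f ξ :=
  Finset.sum_nonneg fun z _ => mul_nonneg (Nat.cast_nonneg _) (hf z)

theorem lin_mono {f g : Site d → ℝ} (h : ∀ z, f z ≤ g z) (ξ : FinConfig d) : lin f ξ ≤ lin g ξ :=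
  Finset.sum_le_sum fun z _ => mul_le_mul_of_nonneg_left (h z) (Nat.cast_nonneg _)

theorem lin_const (c : ℝ) (ξ : FinConfig d) : lin (fun _ => c) ξ = size ξ * c := by
  rw [lin_eq_sum, ← Finset.sum_mul, sum_eq_size]

theorem lin_finsetSum {ι : Type*} (s : Finset ι) (f : ι → Site d → ℝ) (ξ : FinConfig d) :
    ∑ i ∈ s, lin (f i) ξ = lin (fun z => ∑ i ∈ s, f i z) ξ := by
  simp_rw [lin_eq_sum, Finset.mul_sum]
  exact Finset.sum_comm

/-- Finite configurations are built up by adding single particles. -/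
theorem config_induction {P : FinConfig d → Prop} (h0 : P 0)
    (h1 : ∀ ξ z, P ξ → P (ξ + Finsupp.single z 1)) (ξ : FinConfig d) : P ξ := by
  induction hn : Finsupp.degree ξ generalizing ξ with
  | zero =>
    rw [Finsupp.degree_eq_zero_iff] at hn
    rwa [hn]
  | succ n ih =>
    have : ξ ≠ 0 := fun h => by simp [h] at hn
    obtain ⟨z, hz⟩ := Finsupp.ne_iff.1 this
    have hz : ξ z ≠ 0 := hz
    rw [← sub_single_add_single hz]
    have := degree_sub_single hz
    exact h1 _ _ (ih _ (by omega))

theorem jump_add_single (ζ : FinConfig d) (w v : Site d) :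
    jump (ζ + Finsupp.single w 1) w v = ζ + Finsupp.single (w + v) 1 := by
  rw [jump, add_tsub_cancel_right]

/-- The jump part of the generator for a function that is affine in the weight of each particle. -/
theorem integral_jump_sub {g c : FinConfig d → ℝ} {f : Site d → ℝ}
    (hg : ∀ ζ y, g (ζ + Finsupp.single y 1) = g ζ + f y * c ζ) {ξ : FinConfig d} {w : Site d}
    (hw : ξ w ≠ 0) (hf : Integrable (fun v => f (w + v)) p.toMeasure) :
    ∫ v, g (jump ξ w v) ∂p.toMeasure - g ξ =
      c (ξ - Finsupp.single w 1) * (∫ v, f (w + v) ∂p.toMeasure - f w) := by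
  obtain ⟨ζ, rfl⟩ := exists_eq_add_single hw
  simp_rw [jump_add_single, hg, add_tsub_cancel_right]
  rw [integral_add (integrable_const _) (hf.mul_const _), integral_mul_const]
  simp
  ring

theorem integrable_kern {t : ℝ} (ht : 0 ≤ t) (x : Site d) (w : Site d) :
    Integrable (fun v => kern p t (x - (w + v))) p.toMeasure :=
  Integrable.of_bound (C := 1) (measurable_of_countable _).aestronglyMeasurable
    (Eventually.of_forall fun v => by
      rw [Real.norm_eq_abs, abs_of_nonneg (kern_nonneg ht _)]
      exact kern_le_one ht _)

theorem hasDerivAt_kern_sub (t : ℝ) (x w : Site d) : HasDerivAt (fun t => kern p t (x - w))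
    (∫ v, kern p t (x - (w + v)) ∂p.toMeasure - kern p t (x - w)) t := by
  simpa [sub_sub] using hasDerivAt_kern (p := p) t (x - w)

/-- The expected number of particles at `x` at time `t`. -/
def mean (p : PMF (Site d)) (x : Site d) (t : ℝ) (ξ : FinConfig d) : ℝ :=
  lin (fun z => kern p t (x - z)) ξ

theorem mean_nonneg (x : Site d) {t : ℝ} (ht : 0 ≤ t) (ξ : FinConfig d) : 0 ≤ mean p x t ξ :=
  lin_nonneg (fun _ => kern_nonneg ht _) ξ

theorem mean_le_size (x : Site d) {t : ℝ} (ht : 0 ≤ t) (ξ : FinConfig d) :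
    mean p x t ξ ≤ size ξ := by
  simpa [mean, lin_const] using lin_mono (fun z => kern_le_one (p := p) ht (x - z)) ξ

theorem mean_zero (x : Site d) (ξ : FinConfig d) : mean p x 0 ξ = ξ x := by
  rw [mean, lin_eq_sum, Finset.sum_eq_single x]
  · simp [kern_zero]
  · intro z _ hz
    rw [kern_zero, if_neg (by rwa [sub_eq_zero, eq_comm]), mul_zero]
  · intro h
    simp [Finsupp.notMem_support_iff.1 h]

/-- Critical branching does not affect expectations: a linear function has vanishing second
differences, so only the walk's own backward equation remains. -/
theorem Forced.mean (x : Site d) : Forced p γ (mean p x) fun _ _ => 0 where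
  controlled t ht := ⟨fun n => n, fun ξ => by
    rw [abs_of_nonneg (mean_nonneg x ht ξ)]
    exact mean_le_size x ht ξ⟩
  continuous ξ := continuous_finsetSum _ fun z _ => continuous_const.mul (continuous_kern _)
  hasDeriv ξ t ht := by
    have h1 : HasDerivAt (fun t => LonelyBRW.mean p x t ξ) (∑ z ∈ ξ.support, (ξ z : ℝ) *
        (∫ v, kern p t (x - (z + v)) ∂p.toMeasure - kern p t (x - z))) t :=
      HasDerivAt.fun_sum fun z _ => (hasDerivAt_kern_sub t x z).const_mul _
    refine h1.hasDerivWithinAt.congr_deriv ?_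
    rw [add_zero, gen_eq_sum _ subset_rfl]
    have hg : ∀ ζ y, LonelyBRW.mean p x t (ζ + Finsupp.single y 1) =
        LonelyBRW.mean p x t ζ + kern p t (x - y) * 1 := fun ζ y => by
      rw [LonelyBRW.mean, LonelyBRW.mean, lin_add, lin_single, mul_one]
    refine Finset.sum_congr rfl fun w hw => ?_
    rw [Finsupp.mem_support_iff] at hw
    rw [integral_jump_sub (c := fun _ => 1) hg hw (integrable_kern ht x w)]
    obtain ⟨ζ, rfl⟩ := exists_eq_add_single hw
    rw [branchAt_of_eq rfl, secondDiff, hg, hg]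
    split_ifs <;> ring

end linear

/-! ### Occupation probabilities -/

section occupation
variable {p : PMF (Site d)} {γ : ℝ≥0}

/-- The probability that the site `x` is occupied at time `t`. -/
def occ (p : PMF (Site d)) (γ : ℝ≥0) (x : Site d) (t : ℝ) (ξ : FinConfig d) : ℝ :=
  prob p γ {ξ | ξ x ≠ 0} t ξ

theorem occ_nonneg (x : Site d) (t : ℝ) (ξ : FinConfig d) : 0 ≤ occ p γ x t ξ := prob_nonneg _ _ _

theorem occ_le_one (x : Site d) (t : ℝ) (ξ : FinConfig d) : occ p γ x t ξ ≤ 1 := prob_le_one _ _ _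

theorem prob_zero_config (A : Set (FinConfig d)) {t : ℝ} (ht : 0 ≤ t) :
    prob p γ A t 0 = A.indicator 1 0 := by
  have h1 : totalRate γ (0 : FinConfig d) = 0 := by simp [totalRate]
  have h2 : ∀ g, gen p γ g (0 : FinConfig d) = 0 := fun g => by simp [gen]
  rw [prob_eq A ht, h1]
  simp [h2]

/-- Submodularity with empty base configuration. At time `0` it says that an added particle matters
less when others are already present. -/
theorem occ_add_le (x : Site d) {t : ℝ} (ht : 0 ≤ t) (ξ ζ : FinConfig d) :
    occ p γ x t (ξ + ζ) ≤ occ p γ x t ξ + occ p γ x t ζ := by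
  have h1 := mixedDiff_prob_nonneg (p := p) (γ := γ) (A := {ξ : FinConfig d | ξ x ≠ 0})
    (fun h a b => by
      classical
      simp only [mixedDiff, Set.indicator_apply, Set.mem_ofPred_eq, Finsupp.add_apply, Pi.one_apply]
      by_cases hh : h x = 0 <;> by_cases ha : a x = 0 <;> by_cases hb : b x = 0 <;>
        simp [hh, ha, hb]) ht 0 ξ ζ
  have h2 := prob_nonneg (p := p) (γ := γ) {ξ : FinConfig d | ξ x ≠ 0} t 0
  simp only [mixedDiff, zero_add] at h1
  simp only [occ]
  linarith

theorem occ_le_lin (x : Site d) {t : ℝ} (ht : 0 ≤ t) (ξ : FinConfig d) :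
    occ p γ x t ξ ≤ lin (fun z => occ p γ x t (Finsupp.single z 1)) ξ := by
  induction ξ using config_induction with
  | h0 => simp [occ, prob_zero_config _ ht]
  | h1 ξ z ih =>
    rw [lin_add, lin_single]
    exact (occ_add_le x ht _ _).trans (by linarith)

theorem occ_le_mean (x : Site d) {t : ℝ} (ht : 0 ≤ t) (ξ : FinConfig d) :
    occ p γ x t ξ ≤ mean p x t ξ := by
  have h := ((Forced.prob (p := p) (γ := γ) {ξ | ξ x ≠ 0}).sub (Forced.mean x)).nonpos (C := 1)
    (T := t) (fun s hs ζ => by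
      have := mean_nonneg (p := p) x hs.1 ζ
      have := prob_le_one (p := p) (γ := γ) {ξ : FinConfig d | ξ x ≠ 0} s ζ
      linarith) (fun ζ => by
      rw [prob_zero, mean_zero]
      by_cases h : ζ x = 0
      · simp [h]
      · have : (1 : ℝ) ≤ ζ x := by exact_mod_cast Nat.one_le_iff_ne_zero.2 h
        simpa [h] using this) (fun _ _ _ => by simp) ht ξ
  simpa [occ] using h

/-- The configuration `ξ` moved by `z`. -/
def translate (z : Site d) (ξ : FinConfig d) : FinConfig d := ξ.mapDomain (· + z)

theorem translate_add (z : Site d) (ξ ζ : FinConfig d) :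
    translate z (ξ + ζ) = translate z ξ + translate z ζ := Finsupp.mapDomain_add

theorem translate_single (z w : Site d) :
    translate z (Finsupp.single w 1) = Finsupp.single (w + z) 1 := Finsupp.mapDomain_single

theorem translate_apply_add (z w : Site d) (ξ : FinConfig d) : translate z ξ (w + z) = ξ w :=
  Finsupp.mapDomain_apply (add_left_injective z) ξ w

theorem gen_translate (g : FinConfig d → ℝ) (z : Site d) (ξ : FinConfig d) :
    gen p γ (fun ζ => g (translate z ζ)) ξ = gen p γ g (translate z ξ) := by
  classical
  have h1 : (translate z ξ).support = ξ.support.map ⟨(· + z), add_left_injective z⟩ := by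
    rw [translate, Finsupp.mapDomain_support_of_injective (add_left_injective z),
      Finset.map_eq_image]
    rfl
  rw [gen, gen, h1, Finset.sum_map]
  refine Finset.sum_congr rfl fun w hw => ?_
  rw [Finsupp.mem_support_iff] at hw
  obtain ⟨ζ, rfl⟩ := exists_eq_add_single hw
  simp only [Function.Embedding.coeFn_mk, translate_apply_add, jump_add_single,
    add_tsub_cancel_right]
  simp only [translate_add, translate_single, jump_add_single, add_tsub_cancel_right,
    add_right_comm w z]

/-- The generator commutes with translations, so both sides solve the same backward equation with
the same initial value. -/
theorem prob_translate_le (A : Set (FinConfig d)) (z : Site d) {t : ℝ} (ht : 0 ≤ t)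
    (ξ : FinConfig d) : prob p γ A t (translate z ξ) ≤ prob p γ (translate z ⁻¹' A) t ξ :=
  le_prob_of_le_gen (u := fun t ξ => prob p γ A t (translate z ξ))
    (u' := fun t ξ => gen p γ (prob p γ A t) (translate z ξ)) (C := 1)
    (fun _ _ _ => prob_le_one _ _ _)
    (fun _ _ => controlled_of_bounded 1 fun _ => abs_prob_le_one _ _ _)
    (fun _ => continuous_prob A _) (fun _ _ ht => hasDerivWithinAt_prob A _ ht)
    (fun _ => (prob_zero _ _).le) (fun ξ _ _ => (gen_translate _ z ξ).ge) ht ξ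

theorem occ_single_le (x z : Site d) {t : ℝ} (ht : 0 ≤ t) :
    occ p γ x t (Finsupp.single z 1) ≤ occ p γ (x - z) t (Finsupp.single 0 1) := by
  have h := prob_translate_le (p := p) (γ := γ) {ξ | ξ x ≠ 0} z ht (Finsupp.single 0 1)
  rw [translate_single, zero_add] at h
  refine h.trans_eq ?_
  rw [occ]
  congr 1
  ext ξ
  rw [Set.mem_preimage, Set.mem_ofPred_eq, Set.mem_ofPred_eq, ← translate_apply_add z (x - z) ξ,
    sub_add_cancel]

/-- The expected number of occupied sites for the system started from one particle. -/
def occSum (p : PMF (Site d)) (γ : ℝ≥0) (t : ℝ) : ℝ≥0∞ :=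
  ∑' x, ENNReal.ofReal (occ p γ x t (Finsupp.single 0 1))

theorem occSum_le_one {t : ℝ} (ht : 0 ≤ t) : occSum p γ t ≤ 1 := by
  rw [← tsum_ofReal_kern (p := p) ht]
  refine ENNReal.tsum_le_tsum fun x => ENNReal.ofReal_le_ofReal ?_
  simpa [mean] using occ_le_mean (p := p) (γ := γ) x ht (Finsupp.single 0 1)

/-- By subadditivity and translation invariance, each particle accounts for at most `occSum`
occupied sites. -/
theorem sum_occ_le {t : ℝ} (ht : 0 ≤ t) (X : Finset (Site d)) (ξ : FinConfig d) :
    ∑ x ∈ X, occ p γ x t ξ ≤ size ξ * (occSum p γ t).toReal := by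
  refine (Finset.sum_le_sum fun x _ => occ_le_lin x ht ξ).trans ?_
  rw [lin_finsetSum, ← lin_const]
  refine lin_mono (fun z => ?_) ξ
  refine (Finset.sum_le_sum fun x _ => occ_single_le x z ht).trans ?_
  rw [← ENNReal.ofReal_le_iff_le_toReal ((occSum_le_one ht).trans_lt ENNReal.one_lt_top).ne,
    ENNReal.ofReal_sum_of_nonneg fun _ _ => occ_nonneg _ _ _, occSum,
    ← (Equiv.subRight z).tsum_eq]
  exact ENNReal.sum_le_tsum X (f := fun x => ENNReal.ofReal (occ p γ (x - z) t _))

/-- At time `h` the expected number of occupied sites is at most `occSum h` times the initial size.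
As `size` is invariant under the evolution, the maximum principle carries this bound to all later
times. -/
theorem occSum_add_le {h t : ℝ} (hh : 0 ≤ h) (ht : 0 ≤ t) :
    occSum p γ (h + t) ≤ occSum p γ h := by
  have hne := ((occSum_le_one (p := p) (γ := γ) hh).trans_lt ENNReal.one_lt_top).ne
  rw [← ENNReal.ofReal_toReal hne, occSum, ENNReal.tsum_eq_iSup_sum]
  refine iSup_le fun X => ?_
  rw [← ENNReal.ofReal_sum_of_nonneg fun _ _ => occ_nonneg _ _ _]
  refine ENNReal.ofReal_le_ofReal ?_
  have key := ((Forced.sum (s := X) fun x _ =>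
    (Forced.prob (p := p) (γ := γ) {ξ | ξ x ≠ 0}).shift hh).sub
    (Forced.size.const_mul (occSum p γ h).toReal)).nonpos (C := X.card) (T := t)
    (fun s _ ζ => by
      have h1 := Finset.sum_le_card_nsmul X (fun x => prob p γ {ξ | ξ x ≠ 0} (h + s) ζ) 1
        fun _ _ => prob_le_one _ _ _
      have h2 : 0 ≤ (occSum p γ h).toReal * size ζ :=
        mul_nonneg ENNReal.toReal_nonneg (size_nonneg ζ)
      simp only [nsmul_eq_mul, mul_one] at h1
      linarith)
    (fun ζ => by
      have := sum_occ_le (p := p) (γ := γ) hh X ζ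
      simp only [occ] at this
      simp only [add_zero]
      linarith) (fun _ _ _ => by simp) ht (Finsupp.single 0 1)
  simp only [size_single, Nat.cast_one, mul_one, sub_nonpos] at key
  exact key

end occupation

/-! ### Thinned configurations -/

section thinning

/-- The sum of `c (ξ - δ_w) * f w` over all particles of `ξ`, where `w` is the site of the
particle. -/
def removeSum (f : Site d → ℝ) (c : FinConfig d → ℝ) (ξ : FinConfig d) : ℝ :=
  ξ.sum fun w n => n * (c (ξ - Finsupp.single w 1) * f w)

theorem removeSum_eq (f : Site d → ℝ) (c : FinConfig d → ℝ) (ξ : FinConfig d) :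
    removeSum f c ξ = ∑ w ∈ ξ.support, (ξ w : ℝ) * (c (ξ - Finsupp.single w 1) * f w) := rfl

@[simp] theorem removeSum_zero (f : Site d → ℝ) (c : FinConfig d → ℝ) : removeSum f c 0 = 0 :=
  Finsupp.sum_zero_index

theorem removeSum_add_single (f : Site d → ℝ) (c : FinConfig d → ℝ) (ζ : FinConfig d)
    (y : Site d) : removeSum f c (ζ + Finsupp.single y 1) =
      removeSum f (fun ξ => c (ξ + Finsupp.single y 1)) ζ + c ζ * f y := by
  classical
  have hs : (ζ + Finsupp.single y 1).support ⊆ insert y ζ.support := fun w hw => by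
    rw [Finset.mem_insert, Finsupp.mem_support_iff]
    by_contra h
    push Not at h
    rw [Finsupp.mem_support_iff, Finsupp.add_apply, Finsupp.single_apply, if_neg h.1.symm] at hw
    exact hw (by rw [h.2, add_zero])
  rw [removeSum, removeSum, Finsupp.sum_of_support_subset _ hs _ (by simp),
    Finsupp.sum_of_support_subset _ (Finset.subset_insert y _) _ (by simp)]
  have h1 : ∀ w, (((ζ + Finsupp.single y 1 : FinConfig d) w : ℕ) : ℝ) *
      (c (ζ + Finsupp.single y 1 - Finsupp.single w 1) * f w) =
      (ζ w : ℝ) * (c (ζ - Finsupp.single w 1 + Finsupp.single y 1) * f w) +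
        if w = y then c ζ * f y else 0 := by
    intro w
    by_cases hw : ζ w = 0
    · by_cases hwy : w = y
      · subst hwy
        simp [hw]
      · simp [hw, hwy]
    · have h2 : ζ + Finsupp.single y 1 - Finsupp.single w 1 =
          ζ - Finsupp.single w 1 + Finsupp.single y 1 := by
        obtain ⟨ζ', rfl⟩ := exists_eq_add_single hw
        rw [add_right_comm, add_tsub_cancel_right, add_tsub_cancel_right]
      rw [h2]
      by_cases hwy : w = y
      · subst hwy
        rw [sub_single_add_single hw]
        simp
        ring
      · simp [hwy]
  simp_rw [h1]
  rw [Finset.sum_add_distrib, Finset.sum_ite_eq' (insert y ζ.support) y fun _ => c ζ * f y,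
    if_pos (Finset.mem_insert_self _ _)]

theorem removeSum_linear (f : Site d → ℝ) (c c' : FinConfig d → ℝ) (r s : ℝ) (ξ : FinConfig d) :
    removeSum f (fun ξ => r * c ξ + s * c' ξ) ξ = r * removeSum f c ξ + s * removeSum f c' ξ := by
  rw [removeSum_eq, removeSum_eq, removeSum_eq, Finset.mul_sum, Finset.mul_sum,
    ← Finset.sum_add_distrib]
  exact Finset.sum_congr rfl fun w _ => by ring

/-- The probability that no particle of `ξ` is selected when each particle is selected
independently, with probability `a y` for a particle at `y`. -/
def thin (a : Site d → ℝ) (ξ : FinConfig d) : ℝ := ξ.prod fun y n => (1 - a y) ^ n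

/-- The probability that exactly one particle of `ξ` is selected. -/
def thinOne (a : Site d → ℝ) (ξ : FinConfig d) : ℝ := removeSum a (thin a) ξ

variable {a : Site d → ℝ}

@[simp] theorem thin_zero : thin a (0 : FinConfig d) = 1 := Finsupp.prod_zero_index

@[simp] theorem thinOne_zero : thinOne a (0 : FinConfig d) = 0 := removeSum_zero _ _

theorem thin_add_single (ζ : FinConfig d) (y : Site d) :
    thin a (ζ + Finsupp.single y 1) = thin a ζ + a y * -thin a ζ := by
  rw [thin, Finsupp.prod_add_index' (by simp) (fun _ _ _ => pow_add _ _ _),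
    Finsupp.prod_single_index (by simp), ← thin]
  ring

theorem thinOne_add_single (ζ : FinConfig d) (y : Site d) :
    thinOne a (ζ + Finsupp.single y 1) = thinOne a ζ + a y * (thin a ζ - thinOne a ζ) := by
  have h : (fun ξ => thin a (ξ + Finsupp.single y 1)) =
      fun ξ => (1 - a y) * thin a ξ + 0 * thin a ξ := by
    ext ξ
    rw [thin_add_single]
    ring
  rw [thinOne, removeSum_add_single, h, removeSum_linear, ← thinOne]
  ring

theorem thin_nonneg (ha : ∀ y, a y ≤ 1) (ξ : FinConfig d) : 0 ≤ thin a ξ :=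
  Finset.prod_nonneg fun y _ => pow_nonneg (sub_nonneg.2 (ha y)) _

theorem thinOne_nonneg (ha0 : ∀ y, 0 ≤ a y) (ha : ∀ y, a y ≤ 1) (ξ : FinConfig d) :
    0 ≤ thinOne a ξ :=
  Finset.sum_nonneg fun y _ => mul_nonneg (Nat.cast_nonneg _) (mul_nonneg (thin_nonneg ha _) (ha0 y))

theorem thinOne_add_thin_le_one (ha0 : ∀ y, 0 ≤ a y) (ha : ∀ y, a y ≤ 1) (ξ : FinConfig d) :
    thinOne a ξ + thin a ξ ≤ 1 := by
  induction ξ using config_induction with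
  | h0 => simp
  | h1 ζ y ih =>
    rw [thinOne_add_single, thin_add_single]
    nlinarith [mul_nonneg (ha0 y) (thinOne_nonneg ha0 ha ζ), ha0 y]

theorem thin_le_one (ha0 : ∀ y, 0 ≤ a y) (ha : ∀ y, a y ≤ 1) (ξ : FinConfig d) : thin a ξ ≤ 1 := by
  linarith [thinOne_add_thin_le_one ha0 ha ξ, thinOne_nonneg ha0 ha ξ]

theorem thin_le_thin_sub_single (ha0 : ∀ y, 0 ≤ a y) (ha : ∀ y, a y ≤ 1) {ξ : FinConfig d}
    {w : Site d} (hw : ξ w ≠ 0) : thin a ξ ≤ thin a (ξ - Finsupp.single w 1) := by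
  obtain ⟨ζ, rfl⟩ := exists_eq_add_single hw
  rw [add_tsub_cancel_right, thin_add_single]
  nlinarith [mul_nonneg (ha0 w) (thin_nonneg ha ζ)]

/-- Removing the selected particle only increases the probability that none of the remaining ones is
selected. -/
theorem lin_mul_thin_le_thinOne (ha0 : ∀ y, 0 ≤ a y) (ha : ∀ y, a y ≤ 1) (ξ : FinConfig d) :
    lin a ξ * thin a ξ ≤ thinOne a ξ := by
  rw [lin_eq_sum, thinOne, removeSum_eq, Finset.sum_mul]
  refine Finset.sum_le_sum fun w hw => ?_
  have h1 := thin_le_thin_sub_single ha0 ha (Finsupp.mem_support_iff.1 hw)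
  have h2 : 0 ≤ (ξ w : ℝ) * a w := mul_nonneg (Nat.cast_nonneg _) (ha0 w)
  nlinarith

theorem exp_neg_mul_lin_le_thin {C : ℝ} (h : ∀ y, Real.exp (-(C * a y)) ≤ 1 - a y)
    (ξ : FinConfig d) : Real.exp (-(C * lin a ξ)) ≤ thin a ξ := by
  induction ξ using config_induction with
  | h0 => simp
  | h1 ζ y ih =>
    have h0 := (Real.exp_pos (-(C * lin a ζ))).le
    calc Real.exp (-(C * lin a (ζ + Finsupp.single y 1))) =
        Real.exp (-(C * lin a ζ)) * Real.exp (-(C * a y)) := by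
          rw [lin_add, lin_single, ← Real.exp_add]
          ring_nf
      _ ≤ thin a ζ * (1 - a y) := mul_le_mul ih (h y) (Real.exp_nonneg _) (h0.trans ih)
      _ = _ := by rw [thin_add_single]; ring

theorem exp_neg_mul_le_one_sub {α r : ℝ} (hα : α < 1) (hr0 : 0 ≤ r) (hr : r ≤ α) :
    Real.exp (-(1 / (1 - α) * r)) ≤ 1 - r := by
  have h1 : 0 < 1 - r := by linarith
  have h2 : 0 < 1 - α := by linarith
  rw [Real.exp_neg, inv_le_comm₀ (Real.exp_pos _) h1]
  refine le_trans ?_ (Real.add_one_le_exp _)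
  have h3 : r / (1 - r) ≤ 1 / (1 - α) * r := by
    rw [one_div, inv_mul_eq_div]
    gcongr
  have h4 : (1 - r)⁻¹ = r / (1 - r) + 1 := by
    field_simp
    ring
  linarith

/-- For a lonely particle with `r = a w`, its factor `1 - r` is compared with `(1 - r) ^ 2` and `1`,
and `(1 - r) ^ 2 + 1 - 2 * (1 - r) = r ^ 2`. This gain is the source of the whole loss estimate. -/
theorem branchAt_thin (ξ : FinConfig d) (w : Site d) : branchAt (thin a) ξ w =
    if ξ w = 1 then a w ^ 2 * thin a (ξ - Finsupp.single w 1) else 0 := by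
  by_cases h : ξ w = 1
  · obtain ⟨ζ, rfl⟩ := exists_eq_add_single (ξ := ξ) (w := w) (by omega)
    have : ζ w = 0 := by simpa using h
    rw [branchAt_of_eq rfl, if_pos this, if_pos h, add_tsub_cancel_right, secondDiff]
    simp only [thin_add_single]
    ring
  · rw [branchAt, if_neg h, if_neg h]

theorem branchAt_thinOne (ξ : FinConfig d) (w : Site d) : branchAt (thinOne a) ξ w =
    if ξ w = 1 then a w ^ 2 * (thinOne a (ξ - Finsupp.single w 1) -
      2 * thin a (ξ - Finsupp.single w 1)) else 0 := by
  by_cases h : ξ w = 1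
  · obtain ⟨ζ, rfl⟩ := exists_eq_add_single (ξ := ξ) (w := w) (by omega)
    have : ζ w = 0 := by simpa using h
    rw [branchAt_of_eq rfl, if_pos this, if_pos h, add_tsub_cancel_right, secondDiff]
    simp only [thin_add_single, thinOne_add_single]
    ring
  · rw [branchAt, if_neg h, if_neg h]

/-- The derivative of the thinning probabilities along a differentiable family of selection
probabilities. -/
theorem hasDerivAt_thin {a : ℝ → Site d → ℝ} {a' : Site d → ℝ} {t : ℝ}
    (h : ∀ y, HasDerivAt (fun t => a t y) (a' y) t) (ξ : FinConfig d) :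
    HasDerivAt (fun t => thin (a t) ξ) (removeSum a' (fun ζ => -thin (a t) ζ) ξ) t := by
  induction ξ using config_induction with
  | h0 => simpa using hasDerivAt_const t (1 : ℝ)
  | h1 ζ y ih =>
    simp_rw [thin_add_single]
    refine (ih.add ((h y).mul ih.neg)).congr_deriv ?_
    have h1 : (fun ξ => -thin (a t) (ξ + Finsupp.single y 1)) =
        fun ξ => (1 - a t y) * -thin (a t) ξ + 0 * thin (a t) ξ := by
      ext ξ
      rw [thin_add_single]
      ring
    rw [removeSum_add_single, h1, removeSum_linear]
    simp only [Pi.neg_apply]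
    ring

theorem hasDerivAt_thinOne {a : ℝ → Site d → ℝ} {a' : Site d → ℝ} {t : ℝ}
    (h : ∀ y, HasDerivAt (fun t => a t y) (a' y) t) (ξ : FinConfig d) :
    HasDerivAt (fun t => thinOne (a t) ξ)
      (removeSum a' (fun ζ => thin (a t) ζ - thinOne (a t) ζ) ξ) t := by
  induction ξ using config_induction with
  | h0 => simpa using hasDerivAt_const t (0 : ℝ)
  | h1 ζ y ih =>
    simp_rw [thinOne_add_single]
    refine (ih.add ((h y).mul ((hasDerivAt_thin h ζ).sub ih))).congr_deriv ?_
    have h1 : (fun ξ => thin (a t) (ξ + Finsupp.single y 1) -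
        thinOne (a t) (ξ + Finsupp.single y 1)) =
        fun ξ => (1 - a t y) * (thin (a t) ξ - thinOne (a t) ξ) + a t y * -thin (a t) ξ := by
      ext ξ
      rw [thin_add_single, thinOne_add_single]
      ring
    rw [removeSum_add_single, h1, removeSum_linear]
    simp only [Pi.sub_apply]
    ring

end thinning

/-! ### Independent walks and a lower bound for single occupation -/

section thinnedWalks
variable {p : PMF (Site d)} {γ : ℝ≥0}

/-- The probability that a walk from `y` is at `x` at time `t` and is then selected with
probability `θ`. -/
def hit (p : PMF (Site d)) (θ : ℝ) (x : Site d) (t : ℝ) (y : Site d) : ℝ := θ * kern p t (x - y)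

theorem hit_nonneg {θ : ℝ} (hθ : 0 ≤ θ) (x : Site d) {t : ℝ} (ht : 0 ≤ t) (y : Site d) :
    0 ≤ hit p θ x t y := mul_nonneg hθ (kern_nonneg ht _)

theorem hit_le {θ : ℝ} (hθ : 0 ≤ θ) (x : Site d) {t : ℝ} (ht : 0 ≤ t) (y : Site d) :
    hit p θ x t y ≤ θ := mul_le_of_le_one_right hθ (kern_le_one ht _)

theorem lin_hit (θ : ℝ) (x : Site d) (t : ℝ) (ξ : FinConfig d) :
    lin (hit p θ x t) ξ = θ * mean p x t ξ := by
  rw [mean, lin_eq_sum, lin_eq_sum, Finset.mul_sum]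
  exact Finset.sum_congr rfl fun z _ => by rw [hit]; ring

theorem hasDerivAt_hit (θ : ℝ) (x : Site d) (t : ℝ) (y : Site d) :
    HasDerivAt (fun t => hit p θ x t y)
      (θ * (∫ v, kern p t (x - (y + v)) ∂p.toMeasure - kern p t (x - y))) t :=
  (hasDerivAt_kern_sub t x y).const_mul θ

/-- The jump part of the generator moves one particle's hitting probability at a time, which is
exactly the time derivative of `g`. What is left over is the branching part, with a minus sign. -/
theorem Forced.of_affine {θ : ℝ} {x : Site d} {g c : ℝ → FinConfig d → ℝ}
    (hg : ∀ t ζ y, g t (ζ + Finsupp.single y 1) = g t ζ + hit p θ x t y * c t ζ)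
    (hcontr : ∀ t, 0 ≤ t → Controlled (g t))
    (hder : ∀ t ξ, HasDerivAt (fun t => g t ξ) (removeSum (fun y =>
      θ * (∫ v, kern p t (x - (y + v)) ∂p.toMeasure - kern p t (x - y))) (c t) ξ) t) :
    Forced p γ g fun t ξ => -(γ / 2 * ∑ w ∈ ξ.support, branchAt (g t) ξ w) where
  controlled := hcontr
  continuous ξ := continuous_iff_continuousAt.2 fun t => (hder t ξ).continuousAt
  hasDeriv ξ t ht := by
    refine (hder t ξ).hasDerivWithinAt.congr_deriv ?_
    rw [gen_eq_sum _ subset_rfl, Finset.sum_add_distrib, Finset.mul_sum, add_neg_cancel_right,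
      removeSum_eq]
    refine Finset.sum_congr rfl fun w hw => ?_
    rw [integral_jump_sub (hg t) (Finsupp.mem_support_iff.1 hw)
      ((integrable_kern ht x w).const_mul θ)]
    simp only [hit]
    rw [integral_const_mul]
    ring

theorem Forced.thin {θ : ℝ} (hθ0 : 0 ≤ θ) (hθ : θ ≤ 1) (x : Site d) :
    Forced p γ (fun t => thin (hit p θ x t))
      fun t ξ => -(γ / 2 * ∑ w ∈ ξ.support, branchAt (thin (hit p θ x t)) ξ w) :=
  Forced.of_affine (θ := θ) (x := x) (fun _ => thin_add_single)
    (fun t ht => controlled_of_bounded 1 fun ξ => by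
      have h0 := hit_nonneg (p := p) hθ0 x ht
      have h1 := fun y => (hit_le (p := p) hθ0 x ht y).trans hθ
      rw [abs_of_nonneg (thin_nonneg h1 ξ)]
      exact thin_le_one h0 h1 ξ)
    fun t => hasDerivAt_thin (hasDerivAt_hit θ x t)

theorem Forced.thinOne {θ : ℝ} (hθ0 : 0 ≤ θ) (hθ : θ ≤ 1) (x : Site d) :
    Forced p γ (fun t => thinOne (hit p θ x t))
      fun t ξ => -(γ / 2 * ∑ w ∈ ξ.support, branchAt (thinOne (hit p θ x t)) ξ w) :=
  Forced.of_affine (θ := θ) (x := x) (fun _ => thinOne_add_single)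
    (fun t ht => controlled_of_bounded 1 fun ξ => by
      have h0 := hit_nonneg (p := p) hθ0 x ht
      have h1 := fun y => (hit_le (p := p) hθ0 x ht y).trans hθ
      rw [abs_of_nonneg (thinOne_nonneg h0 h1 ξ)]
      linarith [thinOne_add_thin_le_one h0 h1 ξ, thin_nonneg h1 ξ])
    fun t => hasDerivAt_thinOne (hasDerivAt_hit θ x t)

/-- The probability that there is exactly one particle at `x` at time `t`. -/
def lone (p : PMF (Site d)) (γ : ℝ≥0) (x : Site d) (t : ℝ) (ξ : FinConfig d) : ℝ :=
  prob p γ {ξ | ξ x = 1} t ξ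

theorem hit_zero (x y : Site d) (θ : ℝ) : hit p θ x 0 y = if y = x then θ else 0 := by
  rw [hit, kern_zero]
  simp [sub_eq_zero, eq_comm]

/-- Since `a ^ 2 ≤ a` for hitting probabilities, the branching terms of `thinOne` sum to at least
`-2 * thinOne`. With the factor `γ / 2` this is a loss at rate at most `γ`, offset by the
exponential. -/
theorem thinOne_le_lone (x : Site d) {t : ℝ} (ht : 0 ≤ t) (ξ : FinConfig d) :
    Real.exp (-(γ * t)) * thinOne (hit p 1 x t) ξ ≤ lone p γ x t ξ := by
  have ha0 : ∀ s, 0 ≤ s → ∀ y, 0 ≤ hit p 1 x s y := fun s hs => hit_nonneg zero_le_one x hs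
  have ha : ∀ s, 0 ≤ s → ∀ y, hit p 1 x s y ≤ 1 := fun s hs => hit_le zero_le_one x hs
  have hexp : ∀ s : ℝ, HasDerivAt (fun s : ℝ => Real.exp (-(γ * s)))
      (-γ * Real.exp (-(γ * s))) s := fun s => by
    have := ((hasDerivAt_id' s).const_mul (γ : ℝ)).fun_neg.exp
    refine this.congr_deriv ?_
    ring
  have key := (((Forced.thinOne (p := p) (γ := γ) zero_le_one le_rfl x).mul_fun
    (c := fun s => Real.exp (-(γ * s))) (by fun_prop)
    (fun s _ => (hexp s).hasDerivWithinAt)).sub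
    (Forced.prob (p := p) (γ := γ) {ξ | ξ x = 1})).nonpos (C := 1) (T := t) ?_ ?_ ?_ ht ξ
  · simp only [sub_nonpos] at key
    exact key
  · intro s hs ζ
    have h1 := prob_nonneg (p := p) (γ := γ) {ξ : FinConfig d | ξ x = 1} s ζ
    have h2 := thinOne_add_thin_le_one (ha0 s hs.1) (ha s hs.1) ζ
    have h3 := thinOne_nonneg (ha0 s hs.1) (ha s hs.1) ζ
    have h4 := thin_nonneg (ha s hs.1) ζ
    have h5 : Real.exp (-(γ * s)) ≤ 1 := Real.exp_le_one_iff.2 (by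
      have := mul_nonneg γ.coe_nonneg hs.1
      linarith)
    nlinarith [Real.exp_nonneg (-(γ * s))]
  · intro ζ
    rw [prob_zero]
    simp only [mul_zero, neg_zero, Real.exp_zero, one_mul]
    by_cases h : ζ x = 1
    · have h2 := thinOne_add_thin_le_one (ha0 0 le_rfl) (ha 0 le_rfl) ζ
      have h4 := thin_nonneg (ha 0 le_rfl) ζ
      simp [h]
      linarith
    · have : thinOne (hit p 1 x 0) ζ = 0 := by
        rw [thinOne, removeSum_eq]
        refine Finset.sum_eq_zero fun w hw => ?_
        rw [hit_zero]
        split_ifs with hwx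
        · subst hwx
          rw [Finsupp.mem_support_iff] at hw
          have h5 : (ζ - Finsupp.single w 1 : FinConfig d) w ≠ 0 := by
            simp
            omega
          obtain ⟨ζ', h6⟩ := exists_eq_add_single h5
          rw [h6, thin_add_single, hit_zero]
          simp
        · simp
      simp [this, h]
  · intro s hs ζ
    have h1 : -(2 * thinOne (hit p 1 x s) ζ) ≤
        ∑ w ∈ ζ.support, branchAt (thinOne (hit p 1 x s)) ζ w := by
      rw [thinOne, removeSum_eq, Finset.mul_sum, ← Finset.sum_neg_distrib]
      refine Finset.sum_le_sum fun w hw => ?_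
      rw [branchAt_thinOne]
      have h2 := ha0 s hs w
      have h3 := ha s hs w
      have h4 := thin_nonneg (ha s hs) (ζ - Finsupp.single w 1)
      split_ifs with hw1
      · have h5 := thinOne_nonneg (ha0 s hs) (ha s hs) (ζ - Finsupp.single w 1)
        rw [hw1]
        have h6 : hit p 1 x s w ^ 2 ≤ hit p 1 x s w := by nlinarith
        have h7 := mul_nonneg (sub_nonneg.2 h6) h4
        have h8 := mul_nonneg (sq_nonneg (hit p 1 x s w)) h5
        push_cast
        linarith
      · have h5 : (0 : ℝ) ≤ ζ w := Nat.cast_nonneg _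
        have := mul_nonneg h5 (mul_nonneg h4 h2)
        linarith
    have h2 : 0 ≤ (γ : ℝ) / 2 * Real.exp (-(γ * s)) := by positivity
    nlinarith

/-- If the walk is not concentrated at time `1`, then at any time after `1` an occupied site holds
a single particle with a probability bounded below, up to configurations with large mean. -/
theorem exists_occ_sub_mean_le_lone {α : ℝ} (hα : α < 1) (hk : ∀ z, kern p 1 z ≤ α) {K : ℝ}
    (hK : 0 < K) : ∃ c > 0, ∀ (x : Site d) (t : ℝ), 1 ≤ t → ∀ ξ,
      c * (occ p γ x t ξ - mean p x t ξ / K) ≤ lone p γ x t ξ := by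
  refine ⟨Real.exp (-γ) * Real.exp (-(1 / (1 - α) * K)), by positivity, fun x t ht ξ => ?_⟩
  set c := Real.exp (-γ) * Real.exp (-(1 / (1 - α) * K)) with hc
  have hc0 : 0 < c := by positivity
  -- It is enough to prove the bound at time `1`: all three terms solve the source-free backward
  -- equation, so it persists. If the mean exceeds `K`, the left side is not positive; otherwise
  -- `thinOne ≥ mean * thin` and `thin` is at least a constant because the kernel stays below `α <
  -- 1`.
  have h1 : ∀ ζ, c * (occ p γ x 1 ζ - mean p x 1 ζ / K) ≤ lone p γ x 1 ζ := by
    intro ζ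
    have hM := mean_nonneg (p := p) x zero_le_one ζ
    rcases le_total K (mean p x 1 ζ) with hKM | hKM
    · have h2 : 1 ≤ mean p x 1 ζ / K := (one_le_div₀ hK).2 hKM
      have h3 := occ_le_one (p := p) (γ := γ) x 1 ζ
      exact (mul_nonpos_of_nonneg_of_nonpos hc0.le (by linarith)).trans (prob_nonneg _ _ _)
    · have h2 := thinOne_le_lone (p := p) (γ := γ) x zero_le_one ζ
      have ha0 := hit_nonneg (p := p) zero_le_one x zero_le_one
      have ha := hit_le (p := p) zero_le_one x zero_le_one
      have h3 := lin_mul_thin_le_thinOne ha0 ha ζ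
      have h4 := exp_neg_mul_lin_le_thin (a := hit p 1 x 1) (C := 1 / (1 - α)) (fun y =>
        exp_neg_mul_le_one_sub hα (ha0 y) (by simpa [hit] using hk (x - y))) ζ
      rw [lin_hit, one_mul] at h3 h4
      have h5 : Real.exp (-(1 / (1 - α) * K)) ≤ Real.exp (-(1 / (1 - α) * mean p x 1 ζ)) := by
        have : 0 < 1 / (1 - α) := one_div_pos.2 (by linarith)
        gcongr
      have h6 := occ_le_mean (p := p) (γ := γ) x zero_le_one ζ
      rw [mul_one] at h2
      refine le_trans ?_ h2
      rw [hc, mul_assoc]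
      refine mul_le_mul_of_nonneg_left ?_ (Real.exp_nonneg _)
      calc _ ≤ Real.exp (-(1 / (1 - α) * K)) * mean p x 1 ζ := by
            gcongr
            have := div_nonneg hM hK.le
            linarith
        _ ≤ thin (hit p 1 x 1) ζ * mean p x 1 ζ := by gcongr; exact h5.trans h4
        _ ≤ _ := by linarith
  have key := ((((Forced.prob (p := p) (γ := γ) {ξ | ξ x ≠ 0}).sub
    ((Forced.mean x).const_mul K⁻¹)).const_mul c).sub
    (Forced.prob (p := p) (γ := γ) {ξ | ξ x = 1})).shift zero_le_one
  have key2 := key.nonpos (C := c) (T := t - 1) ?_ ?_ (fun _ _ _ => by simp) (by linarith) ξ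
  · simp only [add_sub_cancel, sub_nonpos] at key2
    rw [div_eq_inv_mul]
    exact key2
  · intro s hs ζ
    have h2 := occ_le_one (p := p) (γ := γ) x (1 + s) ζ
    have h3 := prob_nonneg (p := p) (γ := γ) {ξ : FinConfig d | ξ x = 1} (1 + s) ζ
    have h4 := mean_nonneg (p := p) x (by linarith [hs.1] : 0 ≤ 1 + s) ζ
    have h5 : 0 ≤ K⁻¹ * mean p x (1 + s) ζ := by positivity
    have h6 : c * (occ p γ x (1 + s) ζ - K⁻¹ * mean p x (1 + s) ζ) ≤ c * 1 := by
      gcongr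
      linarith
    simp only [occ] at h6
    linarith
  · intro ζ
    have h2 := h1 ζ
    rw [div_eq_inv_mul] at h2
    simp only [occ, lone] at h2
    simp only [add_zero]
    linarith

end thinnedWalks

/-! ### The cost of lonely particles -/

section convolution
variable {p : PMF (Site d)} {γ : ℝ≥0}

theorem gen_integral {μ : Measure ℝ} [SFinite μ] {G : ℝ → FinConfig d → ℝ} {b : ℝ → ℝ}
    (hG : ∀ ξ, Measurable fun r => G r ξ) (hb : ∀ r ξ, |G r ξ| ≤ b r) (hbi : Integrable b μ)
    (ξ : FinConfig d) :
    gen p γ (fun ζ => ∫ r, G r ζ ∂μ) ξ = ∫ r, gen p γ (G r) ξ ∂μ := by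
  have hi : ∀ ζ, Integrable (fun r => G r ζ) μ := fun ζ =>
    hbi.mono' (hG ζ).aestronglyMeasurable (Eventually.of_forall fun r => hb r ζ)
  have hp : ∀ x, Integrable (Function.uncurry fun r v => G r (jump ξ x v))
      (μ.prod p.toMeasure) := fun x =>
    (hbi.comp_fst p.toMeasure).mono' (measurable_from_prod_countable_left
      fun v => hG (jump ξ x v)).aestronglyMeasurable (Eventually.of_forall fun z => hb _ _)
  have hi2 : Integrable (fun r => 2 * G r ξ) μ := (hi ξ).const_mul 2
  have hd : ∀ x, Integrable (fun r => G r (ξ + Finsupp.single x 1) +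
      G r (ξ - Finsupp.single x 1)) μ := fun x => (hi _).add (hi _)
  have hB : ∀ x, Integrable (fun r => γ / 2 * (G r (ξ + Finsupp.single x 1) +
      G r (ξ - Finsupp.single x 1) - 2 * G r ξ)) μ := fun x => ((hd x).sub hi2).const_mul _
  have hj : ∀ x, Integrable (fun r => ∫ v, G r (jump ξ x v) ∂p.toMeasure) μ := fun x =>
    (hp x).integral_prod_left
  have hJ : ∀ x, Integrable (fun r => (ξ x : ℝ) *
      (∫ v, G r (jump ξ x v) ∂p.toMeasure - G r ξ)) μ := fun x => ((hj x).sub (hi ξ)).const_mul _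
  simp only [gen]
  rw [integral_finsetSum]
  · refine Finset.sum_congr rfl fun x _ => ?_
    rw [← integral_integral_swap (hp x)]
    split_ifs
    · rw [integral_add (hJ x) (hB x), integral_const_mul, integral_const_mul,
        integral_sub (hj x) (hi ξ), integral_sub (hd x) hi2, integral_add (hi _) (hi _),
        integral_const_mul]
    · simp_rw [add_zero]
      rw [integral_const_mul, integral_sub (hj x) (hi ξ)]
  · intro x _
    split_ifs
    · exact (hJ x).add (hB x)
    · simp_rw [add_zero]
      exact hJ x

theorem prob_eq_add_integral (A : Set (FinConfig d)) (ξ : FinConfig d) {s : ℝ} (hs : 0 ≤ s) :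
    prob p γ A s ξ = prob p γ A 0 ξ + ∫ τ in (0 : ℝ)..s, gen p γ (prob p γ A τ) ξ := by
  rw [intervalIntegral.integral_eq_sub_of_hasDeriv_right_of_le hs
    (continuous_prob A ξ).continuousOn
    (fun r hr => (hasDerivWithinAt_prob A ξ hr.1.le).mono Set.Ioi_subset_Ici_self)
    ((continuous_gen_prob A ξ).intervalIntegrable _ _)]
  ring

theorem abs_integral_mul_prob_le {a : ℝ → ℝ} (ha : Continuous a) (A : Set (FinConfig d)) {t : ℝ}
    (ht : 0 ≤ t) (ξ : FinConfig d) :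
    |∫ r in (0 : ℝ)..t, a r * prob p γ A (t - r) ξ| ≤ ∫ r in (0 : ℝ)..t, |a r| := by
  rw [← Real.norm_eq_abs]
  refine intervalIntegral.norm_integral_le_of_norm_le (μ := volume) ht
    (Eventually.of_forall fun r _ => ?_) (ha.abs.intervalIntegrable _ _)
  rw [norm_mul]
  exact mul_le_of_le_one_right (abs_nonneg _) (abs_prob_le_one _ _ _)

/-- Duhamel's formula: the source acts at elapsed time `t - r`, when the remaining time is `r`, on
the configuration reached by then. -/
theorem Forced.convolution {a : ℝ → ℝ} (ha : Continuous a) (A : Set (FinConfig d)) :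
    Forced p γ (fun t ξ => ∫ r in (0 : ℝ)..t, a r * LonelyBRW.prob p γ A (t - r) ξ)
      fun t ξ => a t * A.indicator 1 ξ where
  controlled t ht := controlled_of_bounded _ fun ξ => abs_integral_mul_prob_le ha A ht ξ
  continuous ξ := by
    have h := continuous_prob (p := p) (γ := γ) A ξ
    exact intervalIntegral.continuous_parametric_intervalIntegral_of_continuous
      (f := fun t r => a r * LonelyBRW.prob p γ A (t - r) ξ)
      ((ha.comp continuous_snd).mul (h.comp (continuous_fst.sub continuous_snd))) continuous_id
  hasDeriv ξ t ht := by
    refine (hasDerivWithinAt_convolution ha (continuous_gen_prob A ξ)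
      (fun s hs => prob_eq_add_integral A ξ hs) ht).congr_deriv ?_
    rw [prob_zero, add_comm]
    congr 1
    simp only [intervalIntegral.integral_of_le ht]
    rw [gen_integral (G := fun r ζ => a r * LonelyBRW.prob p γ A (t - r) ζ) (b := fun r => |a r|)
      (fun ζ => ha.measurable.mul
        ((continuous_prob A ζ).measurable.comp (measurable_const.sub measurable_id)))
      (fun r ζ => by
        rw [abs_mul]
        exact mul_le_of_le_one_right (abs_nonneg _) (abs_prob_le_one _ _ _))
      (ha.abs.integrableOn_Ioc)]
    simp_rw [gen_const_mul]

end convolution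

/-! ### Time spent together and the loss of occupation probability -/

section cost
variable {p : PMF (Site d)} {γ : ℝ≥0}

/-- The time that two independent walks spend together at a site of `D` up to time `t`. -/
def overlap (p : PMF (Site d)) (D : Finset (Site d)) (t : ℝ) : ℝ :=
  ∑ v ∈ D, ∫ r in (0 : ℝ)..t, kern p r v ^ 2

theorem hasDerivAt_overlap (D : Finset (Site d)) (t : ℝ) :
    HasDerivAt (overlap p D) (∑ v ∈ D, kern p t v ^ 2) t :=
  HasDerivAt.fun_sum fun v _ =>
    intervalIntegral.integral_hasDerivAt_right ((continuous_kern_sq v).intervalIntegrable _ _)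
      (continuous_kern_sq v).aestronglyMeasurable.stronglyMeasurableAtFilter
      (continuous_kern_sq v).continuousAt

theorem overlap_nonneg (D : Finset (Site d)) {t : ℝ} (ht : 0 ≤ t) : 0 ≤ overlap p D t :=
  Finset.sum_nonneg fun _ _ => intervalIntegral.integral_nonneg ht fun _ _ => sq_nonneg _

theorem overlap_zero (D : Finset (Site d)) : overlap p D 0 = 0 := by simp [overlap]

/-- The integrand is at most the total mass of the kernel, since its values lie in `[0, 1]`. -/
theorem overlap_add_one_le (D : Finset (Site d)) {t : ℝ} (ht : 0 ≤ t) :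
    overlap p D (t + 1) ≤ overlap p D t + 1 := by
  have h1 : overlap p D (t + 1) - overlap p D t = ∫ r in t..(t + 1), ∑ v ∈ D, kern p r v ^ 2 := by
    rw [intervalIntegral.integral_finsetSum fun v _ =>
      (continuous_kern_sq v).intervalIntegrable _ _, overlap, overlap, ← Finset.sum_sub_distrib]
    exact Finset.sum_congr rfl fun v _ => intervalIntegral.integral_interval_sub_left
      ((continuous_kern_sq v).intervalIntegrable _ _)
      ((continuous_kern_sq v).intervalIntegrable _ _)
  have h2 : ∫ r in t..(t + 1), ∑ v ∈ D, kern p r v ^ 2 ≤ ∫ r in t..(t + 1), (1 : ℝ) := by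
    refine intervalIntegral.integral_mono_on (by linarith)
      ((continuous_finsetSum _ fun v _ => continuous_kern_sq v).intervalIntegrable _ _)
      (by simp) fun r hr => ?_
    have hr0 : 0 ≤ r := ht.trans hr.1
    refine (Finset.sum_le_sum fun v _ => ?_).trans (sum_kern_le_one (p := p) hr0 D)
    have := kern_nonneg (p := p) hr0 v
    have := kern_le_one (p := p) hr0 v
    nlinarith
  simp at h2
  linarith

/-- If the mean is at least `K`, the left side is not positive. Otherwise a lonely particle
contributes `(kern / 2) ^ 2 * thin` with `thin ≥ exp (-K)`, whence the constant `γ / 8 * exp (-K)`.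
Selecting only half of the particles keeps `hit ≤ 1 / 2` at all times, as the lower bound on `thin`
needs. -/
theorem overlap_source_le {K : ℝ} (hK : 0 < K) (x : Site d) (D : Finset (Site d)) {t : ℝ}
    (ht : 0 ≤ t) (ξ : FinConfig d) :
    γ / 8 * Real.exp (-K) * (∑ v ∈ D, kern p t v ^ 2 * {ξ : FinConfig d | ξ (x - v) = 1}.indicator 1 ξ -
      (∑ v ∈ D, kern p t v ^ 2) * (K⁻¹ * mean p x t ξ)) ≤
      γ / 2 * ∑ w ∈ ξ.support, branchAt (thin (hit p (1 / 2) x t)) ξ w := by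
  classical
  have ha0 := hit_nonneg (p := p) (θ := 1 / 2) (by norm_num) x ht
  have ha2 := hit_le (p := p) (θ := 1 / 2) (by norm_num) x ht
  have ha : ∀ y, hit p (1 / 2) x t y ≤ 1 := fun y => (ha2 y).trans (by norm_num)
  have hind : ∀ v, {ξ : FinConfig d | ξ (x - v) = 1}.indicator 1 ξ =
      if ξ (x - v) = 1 then (1 : ℝ) else 0 := fun v => by
    simp [Set.indicator_apply]
  simp_rw [hind]
  rcases le_total K (mean p x t ξ) with hM | hM
  · have h1 : 1 ≤ K⁻¹ * mean p x t ξ := by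
      rw [← div_eq_inv_mul]
      exact (one_le_div₀ hK).2 hM
    have h2 : ∑ v ∈ D, kern p t v ^ 2 * (if ξ (x - v) = 1 then (1 : ℝ) else 0) ≤
        ∑ v ∈ D, kern p t v ^ 2 := Finset.sum_le_sum fun v _ => by
      have := sq_nonneg (kern p t v)
      split_ifs <;> simp [this]
    have h3 : 0 ≤ ∑ v ∈ D, kern p t v ^ 2 := Finset.sum_nonneg fun _ _ => sq_nonneg _
    refine (mul_nonpos_of_nonneg_of_nonpos (by positivity) (by nlinarith)).trans
      (mul_nonneg (by positivity) (Finset.sum_nonneg fun w _ => ?_))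
    rw [branchAt_thin]
    have := thin_nonneg ha (ξ - Finsupp.single w 1)
    split_ifs <;> positivity
  · set f : Site d → ℝ := fun w => if ξ w = 1 then kern p t (x - w) ^ 2 else 0 with hf
    have hf0 : ∀ w, 0 ≤ f w := fun w => by
      simp only [hf]
      split_ifs <;> positivity
    have h1 : ∑ v ∈ D, kern p t v ^ 2 * (if ξ (x - v) = 1 then (1 : ℝ) else 0) ≤
        ∑ w ∈ ξ.support, f w := by
      calc _ = ∑ v ∈ D, f (x - v) := Finset.sum_congr rfl fun v _ => by simp [hf]
        _ = ∑ w ∈ D.image (x - ·), f w :=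
          (Finset.sum_image fun _ _ _ _ h => sub_right_injective h).symm
        _ ≤ ∑ w ∈ D.image (x - ·) ∪ ξ.support, f w :=
          Finset.sum_le_sum_of_subset_of_nonneg Finset.subset_union_left fun w _ _ => hf0 w
        _ = _ := (Finset.sum_subset Finset.subset_union_right fun w _ hw => by
          simp [hf, Finsupp.notMem_support_iff.1 hw]).symm
    have h2 : Real.exp (-K) ≤ thin (hit p (1 / 2) x t) ξ := by
      refine le_trans ?_ (exp_neg_mul_lin_le_thin (C := 1 / (1 - 1 / 2)) (fun y =>
        exp_neg_mul_le_one_sub (by norm_num) (ha0 y) (ha2 y)) ξ)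
      rw [lin_hit]
      gcongr
      linarith
    have h3 : 0 ≤ (∑ v ∈ D, kern p t v ^ 2) * (K⁻¹ * mean p x t ξ) :=
      mul_nonneg (Finset.sum_nonneg fun _ _ => sq_nonneg _)
        (mul_nonneg (by positivity) (mean_nonneg x ht ξ))
    calc _ ≤ γ / 8 * Real.exp (-K) * ∑ w ∈ ξ.support, f w := by
          gcongr
          linarith
      _ = γ / 2 * ∑ w ∈ ξ.support, 1 / 4 * Real.exp (-K) * f w := by
          rw [← Finset.mul_sum]
          ring
      _ ≤ _ := by
          gcongr with w hw
          rw [branchAt_thin]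
          simp only [hf]
          split_ifs
          · have h4 := thin_le_thin_sub_single ha0 ha (Finsupp.mem_support_iff.1 hw)
            calc _ = (1 / 2 * kern p t (x - w)) ^ 2 * Real.exp (-K) := by ring
              _ ≤ _ := by
                rw [hit]
                gcongr
                exact h2.trans h4
          · simp

/-- Each lonely particle contributes to the loss of occupation probability. -/
theorem occ_add_convolution_le {K : ℝ} (hK : 0 < K) (x : Site d) (D : Finset (Site d)) {t : ℝ}
    (ht : 0 ≤ t) (ξ : FinConfig d) :
    1 / 2 * occ p γ x t ξ + γ / 8 * Real.exp (-K) *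
      ((∑ v ∈ D, ∫ r in (0 : ℝ)..t, kern p r v ^ 2 * lone p γ (x - v) (t - r) ξ) -
        overlap p D t * (K⁻¹ * mean p x t ξ)) ≤ 1 - thin (hit p (1 / 2) x t) ξ := by
  have ha0 := fun s (hs : 0 ≤ s) => hit_nonneg (p := p) (θ := 1 / 2) (by norm_num) x hs
  have ha2 := fun s (hs : 0 ≤ s) => hit_le (p := p) (θ := 1 / 2) (by norm_num) x hs
  have ha : ∀ s, 0 ≤ s → ∀ y, hit p (1 / 2) x s y ≤ 1 :=
    fun s hs y => (ha2 s hs y).trans (by norm_num)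
  set c := γ / 8 * Real.exp (-K) with hc
  have hc0 : 0 ≤ c := by positivity
  have hcont : Continuous (overlap p D) :=
    continuous_iff_continuousAt.2 fun t => (hasDerivAt_overlap D t).continuousAt
  have key := ((((Forced.prob (p := p) (γ := γ) {ξ | ξ x ≠ 0}).const_mul (1 / 2)).add
    (((Forced.sum (s := D) fun v _ => Forced.convolution (continuous_kern_sq (p := p) v)
      {ξ : FinConfig d | ξ (x - v) = 1}).sub
      (((Forced.mean x).const_mul K⁻¹).mul_fun hcont
        fun t _ => (hasDerivAt_overlap D t).hasDerivWithinAt)).const_mul c)).sub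
    ((Forced.const 1).sub (Forced.thin (θ := 1 / 2) (by norm_num) (by norm_num) x))).nonpos
    (C := 1 + c * ∑ v ∈ D, ∫ r in (0 : ℝ)..t, |kern p r v ^ 2|) (T := t) ?_ ?_ ?_ ht ξ
  · simp only [sub_nonpos] at key
    exact key
  · intro s hs ζ
    have h1 := prob_le_one (p := p) (γ := γ) {ξ : FinConfig d | ξ x ≠ 0} s ζ
    have h2 := thin_le_one (ha0 s hs.1) (ha s hs.1) ζ
    have h3 := mul_nonneg (overlap_nonneg (p := p) D hs.1)
      (mul_nonneg (inv_nonneg.2 hK.le) (mean_nonneg (p := p) x hs.1 ζ))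
    have h4 : ∑ v ∈ D, ∫ r in (0 : ℝ)..s, kern p r v ^ 2 *
        prob p γ {ξ | ξ (x - v) = 1} (s - r) ζ ≤ ∑ v ∈ D, ∫ r in (0 : ℝ)..t, |kern p r v ^ 2| :=
      Finset.sum_le_sum fun v _ => (le_abs_self _).trans
        ((abs_integral_mul_prob_le (continuous_kern_sq v) _ hs.1 ζ).trans
        (intervalIntegral.integral_mono_interval le_rfl hs.1 hs.2
          (Eventually.of_forall fun r => abs_nonneg _)
          ((continuous_kern_sq v).abs.intervalIntegrable _ _)))
    have h5 := mul_le_mul_of_nonneg_left (sub_le_sub h4 h3) hc0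
    rw [sub_zero] at h5
    linarith
  · intro ζ
    rw [prob_zero, overlap_zero]
    simp only [intervalIntegral.integral_same, Finset.sum_const_zero, zero_mul, sub_zero, mul_zero,
      add_zero]
    by_cases h : ζ x = 0
    · have := thin_le_one (ha0 0 le_rfl) (ha 0 le_rfl) ζ
      simp [h]
      simpa using this
    -- A single particle at `x` is already selected with probability `1 / 2`, which explains the
    -- factor in front of `occ`.
    · obtain ⟨ζ', rfl⟩ := exists_eq_add_single h
      have h1 := thin_le_one (ha0 0 le_rfl) (ha 0 le_rfl) ζ'
      rw [thin_add_single, hit_zero, if_pos rfl, Set.indicator_of_mem h, Pi.one_apply]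
      linarith
  · intro s hs ζ
    have := overlap_source_le (p := p) (γ := γ) hK x D hs ζ
    rw [← hc] at this
    simp only [mul_zero, add_zero]
    linarith

/-- Upper bound for the expected number of lonely particles of the system started from one
particle, integrated against the overlap density. -/
theorem sum_convolution_lone_le (hγ : 0 < γ) {K : ℝ} (hK : 0 < K) (D X : Finset (Site d)) {t : ℝ}
    (ht : 0 ≤ t) :
    ∑ x ∈ X, ∑ v ∈ D, ∫ r in (0 : ℝ)..t, kern p r v ^ 2 *
      lone p γ (x - v) (t - r) (Finsupp.single 0 1) ≤
      4 / γ * Real.exp K + overlap p D t / K := by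
  have hγ' : (0 : ℝ) < γ := hγ
  have h1 : ∀ x, ∑ v ∈ D, ∫ r in (0 : ℝ)..t, kern p r v ^ 2 *
      lone p γ (x - v) (t - r) (Finsupp.single 0 1) ≤
      (4 / γ * Real.exp K + overlap p D t / K) * kern p t x := by
    intro x
    have h2 := occ_add_convolution_le (p := p) (γ := γ) hK x D ht (Finsupp.single 0 1)
    have h3 := occ_nonneg (p := p) (γ := γ) x t (Finsupp.single 0 1)
    have h4 : thin (hit p (1 / 2) x t) (Finsupp.single 0 1) = 1 - 1 / 2 * kern p t x := by
      have := thin_add_single (a := hit p (1 / 2) x t) 0 0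
      rw [zero_add, thin_zero] at this
      rw [this, hit, sub_zero]
      ring
    rw [h4, mean, lin_single, sub_zero] at h2
    have h5 : ∀ a b : ℝ, γ / 8 * Real.exp (-K) * (a - b) ≤ 1 / 2 * kern p t x →
        a ≤ 4 / γ * Real.exp K * kern p t x + b := by
      intro a b h
      have h6 : γ / 8 * Real.exp (-K) * (4 / γ * Real.exp K) = 1 / 2 := by
        rw [Real.exp_neg]
        have := Real.exp_pos K
        field_simp
        norm_num
      have h7 : 0 < γ / 8 * Real.exp (-K) := by positivity
      rw [← h6, mul_assoc (γ / 8 * Real.exp (-K))] at h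
      have := le_of_mul_le_mul_left h h7
      linarith
    refine (h5 _ (overlap p D t * (K⁻¹ * kern p t x)) (by linarith)).trans_eq ?_
    ring
  refine (Finset.sum_le_sum fun x _ => h1 x).trans ?_
  rw [← Finset.mul_sum]
  have := overlap_nonneg (p := p) D ht
  exact mul_le_of_le_one_right (by positivity) (sum_kern_le_one ht X)

end cost

/-! ### Decay of the expected number of occupied sites -/

section decay
variable {p : PMF (Site d)} {γ : ℝ≥0}

theorem lone_nonneg (x : Site d) (t : ℝ) (ξ : FinConfig d) : 0 ≤ lone p γ x t ξ :=
  prob_nonneg _ _ _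

/-- Summing `hlone` over sites, the error term has total mass `κ / 2` because the kernel sums to
`1`, so half of the assumed `κ` survives. -/
theorem le_tsum_lone {c κ : ℝ} (hc : 0 < c) (hκ : 0 < κ)
    (hlone : ∀ (x : Site d) (t : ℝ), 1 ≤ t → ∀ ξ,
      c * (occ p γ x t ξ - mean p x t ξ / (2 / κ)) ≤ lone p γ x t ξ)
    {t : ℝ} (ht : 1 ≤ t) (hocc : ENNReal.ofReal κ ≤ occSum p γ t) :
    ENNReal.ofReal (c * κ / 2) ≤ ∑' x, ENNReal.ofReal (lone p γ x t (Finsupp.single 0 1)) := by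
  have ht0 : 0 ≤ t := zero_le_one.trans ht
  set L := ∑' x, ENNReal.ofReal (lone p γ x t (Finsupp.single 0 1)) with hL
  have h1 : occSum p γ t ≤ ENNReal.ofReal c⁻¹ * L + ENNReal.ofReal (κ / 2) := by
    calc occSum p γ t ≤ ∑' x, (ENNReal.ofReal c⁻¹ * ENNReal.ofReal
          (lone p γ x t (Finsupp.single 0 1)) + ENNReal.ofReal (κ / 2) *
            ENNReal.ofReal (kern p t x)) := by
          refine ENNReal.tsum_le_tsum fun x => ?_
          have h2 := hlone x t ht (Finsupp.single 0 1)
          rw [mean, lin_single, sub_zero] at h2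
          rw [← ENNReal.ofReal_mul (by positivity), ← ENNReal.ofReal_mul (by positivity),
            ← ENNReal.ofReal_add (mul_nonneg (by positivity) (lone_nonneg _ _ _))
              (mul_nonneg (by positivity) (kern_nonneg ht0 x))]
          refine ENNReal.ofReal_le_ofReal ?_
          have h3 := mul_le_mul_of_nonneg_left h2 (inv_nonneg.2 hc.le)
          rw [inv_mul_cancel_left₀ hc.ne'] at h3
          have h4 : kern p t x / (2 / κ) = κ / 2 * kern p t x := by
            field_simp
          linarith
      _ = _ := by
          rw [ENNReal.tsum_add, ENNReal.tsum_mul_left, ENNReal.tsum_mul_left,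
            tsum_ofReal_kern ht0, mul_one]
  by_cases hLtop : L = ∞
  · rw [hLtop]
    exact le_top
  · have h2 := hocc.trans h1
    rw [← ENNReal.ofReal_toReal hLtop, ← ENNReal.ofReal_mul (by positivity),
      ← ENNReal.ofReal_add (by positivity) (by positivity),
      ENNReal.ofReal_le_ofReal_iff (by positivity)] at h2
    refine ENNReal.ofReal_le_of_le_toReal ?_
    have h3 : c * κ ≤ c * (c⁻¹ * L.toReal + κ / 2) := by gcongr
    rw [mul_add, mul_inv_cancel_left₀ hc.ne'] at h3
    linarith

/-- Both sides bound the number of lonely particles integrated against the squared kernel: summing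
over sites first makes the shift by `v` disappear and leaves `c` times the overlap. -/
theorem mul_overlap_le (hγ : 0 < γ) {c K : ℝ} (hc : 0 < c) (hK : 0 < K)
    (hlone : ∀ t : ℝ, 1 ≤ t →
      ENNReal.ofReal c ≤ ∑' x, ENNReal.ofReal (lone p γ x t (Finsupp.single 0 1)))
    (D : Finset (Site d)) {T : ℝ} (hT : 0 ≤ T) :
    c * overlap p D T ≤ 4 / γ * Real.exp K + overlap p D (T + 1) / K := by
  have hT1 : 0 ≤ T + 1 := by linarith
  have hB : 0 ≤ 4 / γ * Real.exp K + overlap p D (T + 1) / K := by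
    have := overlap_nonneg (p := p) D hT1
    positivity
  set δ : FinConfig d := Finsupp.single 0 1 with hδ
  have hl : ∀ x, Continuous fun r => lone p γ x (T + 1 - r) δ := fun x =>
    (continuous_prob (p := p) (γ := γ) {ξ | ξ x = 1} δ).comp (continuous_const.sub continuous_id)
  have hg : ∀ v x, Continuous fun r => kern p r v ^ 2 * lone p γ (x - v) (T + 1 - r) δ :=
    fun v x => (continuous_kern_sq v).mul (hl _)
  have hg0 : ∀ v x r, 0 ≤ kern p r v ^ 2 * lone p γ (x - v) (T + 1 - r) δ := fun v x r =>
    mul_nonneg (sq_nonneg _) (prob_nonneg _ _ _)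
  have hI : ∀ v x, ENNReal.ofReal (∫ r in (0 : ℝ)..(T + 1),
      kern p r v ^ 2 * lone p γ (x - v) (T + 1 - r) δ) = ∫⁻ r in Set.Ioc 0 (T + 1),
        ENNReal.ofReal (kern p r v ^ 2 * lone p γ (x - v) (T + 1 - r) δ) := fun v x => by
    rw [intervalIntegral.integral_of_le hT1, ofReal_integral_eq_lintegral_ofReal
      ((hg v x).integrableOn_Ioc) (Eventually.of_forall fun r => hg0 v x r)]
  have hupper : ∑' x, ∑ v ∈ D, ∫⁻ r in Set.Ioc 0 (T + 1),
      ENNReal.ofReal (kern p r v ^ 2 * lone p γ (x - v) (T + 1 - r) δ) ≤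
      ENNReal.ofReal (4 / γ * Real.exp K + overlap p D (T + 1) / K) := by
    rw [ENNReal.tsum_eq_iSup_sum]
    refine iSup_le fun X => ?_
    simp_rw [← hI]
    have h0 : ∀ v x, 0 ≤ ∫ r in (0 : ℝ)..(T + 1),
        kern p r v ^ 2 * lone p γ (x - v) (T + 1 - r) δ := fun v x =>
      intervalIntegral.integral_nonneg hT1 fun r _ => hg0 v x r
    simp_rw [← ENNReal.ofReal_sum_of_nonneg fun v _ => h0 v _]
    rw [← ENNReal.ofReal_sum_of_nonneg fun x _ => Finset.sum_nonneg fun v _ => h0 v x]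
    exact ENNReal.ofReal_le_ofReal (sum_convolution_lone_le hγ hK D X hT1)
  rw [Summable.tsum_finsetSum fun _ _ => ENNReal.summable] at hupper
  rw [← ENNReal.ofReal_le_ofReal_iff hB]
  refine le_trans ?_ hupper
  rw [overlap, Finset.mul_sum, ENNReal.ofReal_sum_of_nonneg fun v _ => mul_nonneg hc.le
    (intervalIntegral.integral_nonneg hT fun _ _ => sq_nonneg _)]
  refine Finset.sum_le_sum fun v _ => ?_
  rw [← lintegral_tsum fun x => (hg v x).measurable.ennreal_ofReal.aemeasurable,
    ENNReal.ofReal_mul hc.le, intervalIntegral.integral_of_le hT,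
    ofReal_integral_eq_lintegral_ofReal ((continuous_kern_sq v).integrableOn_Ioc)
    (Eventually.of_forall fun r => sq_nonneg _),
    ← lintegral_const_mul _ (continuous_kern_sq v).measurable.ennreal_ofReal]
  refine le_trans ?_ (lintegral_mono_set (Set.Ioc_subset_Ioc_right (by linarith : T ≤ T + 1)))
  refine setLIntegral_mono' measurableSet_Ioc fun r hr => ?_
  simp_rw [ENNReal.ofReal_mul (sq_nonneg (kern p r v))]
  rw [ENNReal.tsum_mul_left, mul_comm]
  gcongr
  -- The horizon is `T + 1` so that at least one unit of time is left for every `r ≤ T`.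
  refine (hlone (T + 1 - r) (by linarith [hr.2])).trans_eq ?_
  exact ((Equiv.subRight v).tsum_eq
    fun x => ENNReal.ofReal (lone p γ x (T + 1 - r) δ)).symm

/-- The expected number of occupied sites for the system started from one particle vanishes in
the limit of large times. -/
theorem exists_occSum_lt (hd : 1 ≤ d) (hirr : IsIrreducible (p : Site d → ℝ≥0∞))
    (hrec : IsRecurrent (symmetrised (p : Site d → ℝ≥0∞))) (hγ : 0 < γ) {ε : ℝ} (hε : 0 < ε) :
    ∃ t, 0 ≤ t ∧ occSum p γ t < ENNReal.ofReal ε := by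
  by_contra hcon
  push Not at hcon
  obtain ⟨α, hα, hk⟩ := exists_kern_one_le hd hirr
  obtain ⟨c, hc, hlone⟩ := exists_occ_sub_mean_le_lone (γ := γ) hα hk (K := 2 / ε) (by positivity)
  set c' := c * ε / 2 with hc'
  have hc'0 : 0 < c' := by positivity
  -- With `K = 2 / c'` the error in `mul_overlap_le` is at most half of `c' * (overlap T + 1)`.
  -- Absorbing it bounds the overlap by precisely this threshold.
  obtain ⟨D, T, hT, hlt⟩ := exists_lt_sum_lintegral_kern_sq hrec
    ((8 / γ * Real.exp (2 / c') + c') / c')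
  have h1 := mul_overlap_le (p := p) hγ hc'0 (by positivity : 0 < 2 / c') (fun t ht =>
    le_tsum_lone hc hε hlone ht (hcon t (by linarith))) D hT
  have h2 := overlap_add_one_le (p := p) D hT
  rw [div_lt_iff₀ hc'0] at hlt
  have h3 : overlap p D (T + 1) / (2 / c') ≤ (overlap p D T + 1) * c' / 2 := by
    rw [div_div_eq_mul_div]
    gcongr
  have h4 : 8 / (γ : ℝ) * Real.exp (2 / c') = 2 * (4 / γ * Real.exp (2 / c')) := by ring
  rw [← overlap] at hlt
  nlinarith

theorem tendsto_occSum (hd : 1 ≤ d) (hirr : IsIrreducible (p : Site d → ℝ≥0∞))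
    (hrec : IsRecurrent (symmetrised (p : Site d → ℝ≥0∞))) (hγ : 0 < γ) :
    Tendsto (occSum p γ) atTop (𝓝 0) := by
  rw [ENNReal.tendsto_nhds_zero]
  intro ε hε
  obtain ⟨δ, hδ0, hδ⟩ := ENNReal.lt_iff_exists_real_btwn.1 hε
  have hδpos : 0 < δ := by simpa using hδ.1
  obtain ⟨t, ht, hlt⟩ := exists_occSum_lt hd hirr hrec hγ hδpos
  filter_upwards [eventually_ge_atTop t] with s hs
  have := occSum_add_le (p := p) (γ := γ) ht (sub_nonneg.2 hs)
  rw [add_sub_cancel] at this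
  exact this.trans (hlt.le.trans hδ.2.le)

end decay

/-! ### General systems -/

section general
variable {p : PMF (Site d)} {γ : ℝ≥0}

theorem truncate_apply_le (n : ℕ) (η : Config d) (z : Site d) : truncate n η z ≤ η z := by
  simp only [truncate, Finsupp.onFinset_apply]
  split_ifs <;> simp

theorem ofReal_occ_le_tsum {ξ : FinConfig d} {η : Config d} (h : ∀ z, ξ z ≤ η z) (x : Site d)
    {t : ℝ} (ht : 0 ≤ t) : ENNReal.ofReal (occ p γ x t ξ) ≤
      ∑' z, (η z : ℝ≥0∞) * ENNReal.ofReal (occ p γ (x - z) t (Finsupp.single 0 1)) := by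
  refine (ENNReal.ofReal_le_ofReal (occ_le_lin x ht ξ)).trans ?_
  rw [lin_eq_sum, ENNReal.ofReal_sum_of_nonneg fun z _ =>
    mul_nonneg (Nat.cast_nonneg _) (occ_nonneg _ _ _)]
  refine le_trans (Finset.sum_le_sum fun z _ => ?_) (ENNReal.sum_le_tsum ξ.support)
  rw [ENNReal.ofReal_mul (Nat.cast_nonneg _), ENNReal.ofReal_natCast]
  gcongr
  · exact h z
  · exact occ_single_le x z ht

/-- Non-explosion enters here: an upper bound on the probability of occupation gives a lower bound
on that of vacancy only if no mass is lost. -/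
theorem one_le_prob_add_occ (x : Site d) {t : ℝ} (ht : 0 ≤ t) (ξ : FinConfig d) :
    1 ≤ ENNReal.ofReal (prob p γ {ξ | ξ x = 0} t ξ) + ENNReal.ofReal (occ p γ x t ξ) := by
  have h1 := prob_compl (p := p) (γ := γ) {ξ : FinConfig d | ξ x ≠ 0} ht ξ
  have h2 : {ξ : FinConfig d | ξ x ≠ 0}ᶜ = {ξ | ξ x = 0} := by
    ext
    simp
  rw [h2] at h1
  rw [← ENNReal.ofReal_add (prob_nonneg _ _ _) (occ_nonneg _ _ _), ENNReal.one_le_ofReal]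
  simp only [occ]
  linarith

/-- The subadditive bound is uniform in the truncation, so it passes to the limit in the Markov
property at time `0`. Integrating over the initial configuration replaces particle numbers by their
means. -/
theorem IsLonelyBRW.one_le_add {Ω : Type*} [MeasurableSpace Ω] {μ : Measure Ω}
    [IsProbabilityMeasure μ] {η : ℝ≥0 → Ω → Config d} (hη : IsLonelyBRW p γ μ η) (x : Site d)
    (t : ℝ≥0) : 1 ≤ μ {ω | η t ω x = 0} +
      (⨆ y, ∫⁻ ω, (η 0 ω y : ℝ≥0∞) ∂μ) * occSum p γ t := by
  set R : Ω → ℝ≥0∞ := fun ω => ∑' z, (η 0 ω z : ℝ≥0∞) *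
    ENNReal.ofReal (occ p γ (x - z) t (Finsupp.single 0 1)) with hR
  have hpast : past η 0 ≤ (inferInstance : MeasurableSpace Ω) :=
    iSup₂_le fun r _ => (hη.measurable r).comap_le
  have hcoord : ∀ s y, Measurable fun ω => η s ω y := fun s y =>
    (measurable_pi_apply y).comp (hη.measurable s)
  have hset : MeasurableSet {ω | η t ω x = 0} := hcoord t x (measurableSet_singleton 0)
  set E := μ[Set.indicator {ω | η t ω x = 0} (fun _ => (1 : ℝ)) | past η 0] with hE
  have hmarkov := hη.markov 0 t {x} 0
  simp only [zero_add, Finset.mem_singleton, forall_eq, Pi.zero_apply, toReal_transProb] at hmarkov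
  have h1 : ∀ᵐ ω ∂μ, 1 ≤ ENNReal.ofReal (E ω) + R ω := by
    filter_upwards [hmarkov] with ω hω
    refine ge_of_tendsto' ((ENNReal.tendsto_ofReal hω).add tendsto_const_nhds) fun n => ?_
    refine (one_le_prob_add_occ (p := p) (γ := γ) x t.coe_nonneg (truncate n (η 0 ω))).trans ?_
    gcongr
    exact ofReal_occ_le_tsum (truncate_apply_le n _) x t.coe_nonneg
  have h2 : ∫⁻ ω, ENNReal.ofReal (E ω) ∂μ = μ {ω | η t ω x = 0} := by
    rw [← ofReal_integral_eq_lintegral_ofReal integrable_condExp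
      (condExp_nonneg (Eventually.of_forall fun ω =>
        Set.indicator_nonneg (fun _ _ => zero_le_one) ω)), integral_condExp hpast,
      integral_indicator hset]
    simp
  have h3 : ∫⁻ ω, R ω ∂μ ≤ (⨆ y, ∫⁻ ω, (η 0 ω y : ℝ≥0∞) ∂μ) * occSum p γ t := by
    have hmeas : ∀ z, Measurable fun ω => (η 0 ω z : ℝ≥0∞) := fun z =>
      (measurable_of_countable (fun n : ℕ => (n : ℝ≥0∞))).comp (hcoord 0 z)
    rw [lintegral_tsum fun z => ((hmeas z).mul_const _).aemeasurable, occSum,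
      ← (Equiv.subLeft x).tsum_eq, ← ENNReal.tsum_mul_left]
    refine ENNReal.tsum_le_tsum fun z => ?_
    rw [lintegral_mul_const _ (hmeas _), Equiv.subLeft_apply, sub_sub_cancel]
    gcongr
    exact le_iSup (fun y => ∫⁻ ω, (η 0 ω y : ℝ≥0∞) ∂μ) (x - z)
  calc (1 : ℝ≥0∞) = ∫⁻ _, 1 ∂μ := by simp
    _ ≤ ∫⁻ ω, ENNReal.ofReal (E ω) + R ω ∂μ := lintegral_mono_ae h1
    _ = ∫⁻ ω, ENNReal.ofReal (E ω) ∂μ + ∫⁻ ω, R ω ∂μ := by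
        refine lintegral_add_left (Measurable.ennreal_ofReal ?_) _
        exact (stronglyMeasurable_condExp.measurable).mono hpast le_rfl
    _ ≤ _ := by
        rw [h2]
        gcongr

end general

end LonelyBRW

end

theorem theorem1p2 {d : ℕ} (hd : 1 ≤ d) (p : PMF (LonelyBRW.Site d))
    (hirr : LonelyBRW.IsIrreducible p)
    (hrec : LonelyBRW.IsRecurrent (LonelyBRW.symmetrised p))
    (γ : ℝ≥0) (hγ : 0 < γ)
    {Ω : Type*} [MeasurableSpace Ω] (μ : Measure Ω) [IsProbabilityMeasure μ]
    (η : ℝ≥0 → Ω → LonelyBRW.Config d) (hη : LonelyBRW.IsLonelyBRW p γ μ η)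
    (hbdd : (⨆ y, ∫⁻ ω, (η 0 ω y : ℝ≥0∞) ∂μ) < ∞) (x : LonelyBRW.Site d) :
    Tendsto (fun t : ℝ≥0 => μ {ω | η t ω x = 0}) atTop (𝓝 1) := by
  have h1 := (LonelyBRW.tendsto_occSum hd hirr hrec hγ).comp
    (NNReal.tendsto_coe_atTop.2 tendsto_id)
  have h2 := ENNReal.Tendsto.const_mul (a := ⨆ y, ∫⁻ ω, (η 0 ω y : ℝ≥0∞) ∂μ) h1
    (Or.inr hbdd.ne)
  have h3 := ENNReal.Tendsto.sub (tendsto_const_nhds (x := (1 : ℝ≥0∞))) h2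
    (Or.inl ENNReal.one_ne_top)
  rw [mul_zero, tsub_zero] at h3
  exact tendsto_of_tendsto_of_tendsto_of_le_of_le h3 tendsto_const_nhds
    (fun t => tsub_le_iff_right.2 (hη.one_le_add x t)) fun t => prob_le_one
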